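/- For a graph $G$ with $m\ge 1$ edges, vertex degrees $d_v$, and a vertex partition $\mathcal A$, the modularity score is $q_{\mathcal A}(G)=\frac1{2m}\sum_{A\in\mathcal A}\sum_{u,v\in A}\big(\mathbf 1_{uv\in E}-\frac{d_ud_v}{2m}\big)$, the inner sum being over ordered pairs. Let $G_{n,p}$ be the binomial random graph on $[n]=\{1,\dots,n\}$, in which each of the $\binom n2$ possible edges is present independently with probability $p$; an event holds whp if its probability tends to $1$ as $n\to\infty$. The algorithm Swap takes a graph $G$ on $[n]$ and constructs a vertex partition as follows. Let $k=\lfloor n/6\rfloor$, $V_1=\{4k+1,\dots,6k\}$ and $V_2=\{6k+1,\dots,n\}$; for $j=1,2$ let $A_j$ and $B_j$ be the sets of odd and of even elements of $V_j$. For $i=1,\dots,2k$ let $a_i=2i-1$, $b_i=2i$ and $T_i=e(a_i,B_1)-e(a_i,A_1)+e(b_i,A_1)-e(b_i,B_1)$, where $e(v,S)$ is the number of edges between $v$ and $S$. Put $(a_i',b_i')=(b_i,a_i)$ if $T_i>0$ and $(a_i',b_i')=(a_i,b_i)$ otherwise. The output is $\mathcal A=\mathcal A(G)=\{A',B'\}$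 with $A'=\{a_1',\dots,a_{2k}'\}\cup A_1\cup A_2$ and $B'=\{b_1',\dots,b_{2k}'\}\cup B_1\cup B_2$. Theorem. For every graph $G$ on $[n]$ with $n\ge2$, the output of Swap is a partition of $[n]$ into two parts whose sizes differ by at most $1$. Swap runs in linear time: there are a program for a random access machine and a constant $C$ such that, for every $n\ge 1$ and every graph $G$ on $[n]$ with $m$ edges, given by adjacency lists, the program computes $A'$ in at most $C(n+m)$ steps, using only words smaller than $C(n+m)$. Moreover, there are constants $c_0>0$ and $a>0$ such that the following hold. (a) If $p=p(n)\in[0,1]$ satisfies $c_0\le np\le n-c_0$ for $n$ sufficiently large, then whp $q_{\mathcal A}(G_{n,p})\ge\frac15\sqrt{\frac{1-p}{np}}$. (b) If $p=p(n)\in[0,1]$ satisfies $1\le np\le n-c_0$ for $n$ sufficiently large, then whp $q_{\mathcal A}(G_{n,p})\ge a\sqrt{\frac{1-p}{np}}$. Here $\mathcal A=\mathcal A(G_{n,p})$ is the bipartition that Swap constructs from $G_{n,p}$. -/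

import Mathlib

/-! ### Modularity of a vertex partition -/

open scoped Classical in
/-- The modularity score `q_𝒜(G) = (1/2m) ∑_{A ∈ 𝒜} ∑_{u,v ∈ A} (1_{uv ∈ E} - d_u d_v / 2m)`, where
`m` is the number of edges and the inner sum is over ordered pairs. (It is `0` if `m = 0`.) -/
noncomputable def modularityScore {V : Type*} [Fintype V] [DecidableEq V]
    (G : SimpleGraph V)
    (𝒜 : Finpartition (Finset.univ : Finset V)) : ℝ :=
  1 / (2 * (G.edgeSet.ncard : ℝ)) *
    ∑ A ∈ 𝒜.parts, ∑ u ∈ A, ∑ v ∈ A,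
      ((if G.Adj u v then (1 : ℝ) else 0)
        - (G.degree u : ℝ) * (G.degree v : ℝ) / (2 * (G.edgeSet.ncard : ℝ)))

/-! ### The bipartition constructed by Swap

The vertex set is `[n] = {1, …, n}`; the element `v : Fin n` is the vertex with label `v + 1`.
With `k = ⌊n/6⌋`, we have `V₀ = {1, …, 4k}`, `V₁ = {4k+1, …, 6k}` and `V₂ = {6k+1, …, n}`. -/

namespace Swap

/-- The label of `v : Fin n` in `[n] = {1, …, n}`. -/
def label {n : ℕ} (v : Fin n) : ℕ := v.val + 1

/-- The vertices of `V₁` with odd label. -/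
def A₁ (n : ℕ) : Finset (Fin n) :=
  Finset.univ.filter fun v => Odd (label v) ∧ 4 * (n / 6) < label v ∧ label v ≤ 6 * (n / 6)

/-- The vertices of `V₁` with even label. -/
def B₁ (n : ℕ) : Finset (Fin n) :=
  Finset.univ.filter fun v => Even (label v) ∧ 4 * (n / 6) < label v ∧ label v ≤ 6 * (n / 6)

/-- The vertices of `V₂` with odd label. -/
def A₂ (n : ℕ) : Finset (Fin n) :=
  Finset.univ.filter fun v => Odd (label v) ∧ 6 * (n / 6) < label v

/-- The vertices of `V₂` with even label. -/
def B₂ (n : ℕ) : Finset (Fin n) :=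
  Finset.univ.filter fun v => Even (label v) ∧ 6 * (n / 6) < label v

/-- The odd vertex `a_i = 2i - 1` of the `i`-th pair, `1 ≤ i ≤ 2k` (here `i` counts from `0`). -/
def a {n : ℕ} (i : Fin (2 * (n / 6))) : Fin n := ⟨2 * i.val, by omega⟩

/-- The even vertex `b_i = 2i` of the `i`-th pair, `1 ≤ i ≤ 2k` (here `i` counts from `0`). -/
def b {n : ℕ} (i : Fin (2 * (n / 6))) : Fin n := ⟨2 * i.val + 1, by omega⟩

open scoped Classical in
/-- `e(v, S)`, the number of edges between the vertex `v` and the set `S`. -/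
noncomputable def edgesTo {n : ℕ} (G : SimpleGraph (Fin n)) (v : Fin n) (S : Finset (Fin n)) : ℕ :=
  (S.filter fun w => G.Adj v w).card

/-- `T_i = e(a_i, B₁) - e(a_i, A₁) + e(b_i, A₁) - e(b_i, B₁)`. -/
noncomputable def T {n : ℕ} (G : SimpleGraph (Fin n)) (i : Fin (2 * (n / 6))) : ℤ :=
  (edgesTo G (a i) (B₁ n) : ℤ) - (edgesTo G (a i) (A₁ n) : ℤ)
    + (edgesTo G (b i) (A₁ n) : ℤ) - (edgesTo G (b i) (B₁ n) : ℤ)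

/-- `a'_i`: the pair `(a_i, b_i)` is swapped exactly when `T_i > 0`. -/
noncomputable def a' {n : ℕ} (G : SimpleGraph (Fin n)) (i : Fin (2 * (n / 6))) : Fin n :=
  if 0 < T G i then b i else a i

/-- `b'_i`: the pair `(a_i, b_i)` is swapped exactly when `T_i > 0`. -/
noncomputable def b' {n : ℕ} (G : SimpleGraph (Fin n)) (i : Fin (2 * (n / 6))) : Fin n :=
  if 0 < T G i then a i else b i

/-- The part `A' = {a'_1, …, a'_{2k}} ∪ A₁ ∪ A₂`. -/
noncomputable def partA {n : ℕ} (G : SimpleGraph (Fin n)) : Finset (Fin n) :=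
  Finset.univ.image (a' G) ∪ A₁ n ∪ A₂ n

/-- The part `B' = {b'_1, …, b'_{2k}} ∪ B₁ ∪ B₂`. -/
noncomputable def partB {n : ℕ} (G : SimpleGraph (Fin n)) : Finset (Fin n) :=
  Finset.univ.image (b' G) ∪ B₁ n ∪ B₂ n

theorem mem_partA {n : ℕ} (G : SimpleGraph (Fin n)) (v : Fin n) :
    v ∈ partA G ↔ (∃ i, a' G i = v) ∨ (v.val % 2 = 0 ∧ 4 * (n / 6) ≤ v.val) := by
  simp only [partA, A₁, A₂, label, Finset.mem_union, Finset.mem_image, Finset.mem_univ, true_and,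
    Finset.mem_filter, Nat.odd_iff, or_assoc]
  refine or_congr Iff.rfl ?_
  omega

theorem mem_partB {n : ℕ} (G : SimpleGraph (Fin n)) (v : Fin n) :
    v ∈ partB G ↔ (∃ i, b' G i = v) ∨ (v.val % 2 = 1 ∧ 4 * (n / 6) ≤ v.val) := by
  simp only [partB, B₁, B₂, label, Finset.mem_union, Finset.mem_image, Finset.mem_univ, true_and,
    Finset.mem_filter, Nat.even_iff, or_assoc]
  refine or_congr Iff.rfl ?_
  omega

theorem disjoint_parts {n : ℕ} (G : SimpleGraph (Fin n)) : Disjoint (partA G) (partB G) := by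
  rw [Finset.disjoint_left]
  intro v hA hB
  rw [mem_partA] at hA
  rw [mem_partB] at hB
  have key : ∀ i j : Fin (2 * (n / 6)), a' G i ≠ b' G j := by
    intro i j h
    by_cases hij : i = j
    · subst hij
      unfold a' b' at h
      split_ifs at h <;> simp [a, b, Fin.ext_iff] at h
    · have hij' : i.val ≠ j.val := fun h => hij (Fin.ext h)
      unfold a' b' at h
      split_ifs at h <;> simp only [a, b, Fin.ext_iff] at h <;> omega
  have ha : ∀ i, (a' G i).val < 4 * (n / 6) := by
    intro i
    unfold a'
    split_ifs <;> simp only [a, b] <;> omega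
  have hb : ∀ i, (b' G i).val < 4 * (n / 6) := by
    intro i
    unfold b'
    split_ifs <;> simp only [a, b] <;> omega
  rcases hA with ⟨i, rfl⟩ | hA
  · rcases hB with ⟨j, hj⟩ | hB
    · exact key i j hj.symm
    · have := ha i
      omega
  · rcases hB with ⟨j, rfl⟩ | hB
    · have := hb j
      omega
    · omega

theorem union_parts {n : ℕ} (G : SimpleGraph (Fin n)) : partA G ∪ partB G = Finset.univ := by
  ext v
  simp only [Finset.mem_union, Finset.mem_univ, iff_true, mem_partA, mem_partB]
  by_cases hv : v.val < 4 * (n / 6)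
  · have hi : v.val / 2 < 2 * (n / 6) := by omega
    rcases Nat.mod_two_eq_zero_or_one v.val with h | h
    · have hva : a ⟨v.val / 2, hi⟩ = v := by
        apply Fin.ext
        simp only [a]
        omega
      by_cases hT : 0 < T G ⟨v.val / 2, hi⟩
      · exact Or.inr (Or.inl ⟨_, by rw [b', if_pos hT, hva]⟩)
      · exact Or.inl (Or.inl ⟨_, by rw [a', if_neg hT, hva]⟩)
    · have hvb : b ⟨v.val / 2, hi⟩ = v := by
        apply Fin.ext
        simp only [b]
        omega
      by_cases hT : 0 < T G ⟨v.val / 2, hi⟩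
      · exact Or.inl (Or.inl ⟨_, by rw [a', if_pos hT, hvb]⟩)
      · exact Or.inr (Or.inl ⟨_, by rw [b', if_neg hT, hvb]⟩)
  · omega

/-- The vertex partition `{A', B'}` constructed by Swap from the graph `G`. (An empty part, which
occurs only for `n ≤ 1`, is left out.) -/
noncomputable def partition {n : ℕ} (G : SimpleGraph (Fin n)) :
    Finpartition (Finset.univ : Finset (Fin n)) :=
  Finpartition.ofErase {partA G, partB G}
    (by
      by_cases h : partA G = partB G
      · rw [h, Finset.pair_eq_singleton]
        exact Finset.supIndep_singleton _ _
      · rw [Finset.supIndep_pair h]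
        exact disjoint_parts G)
    (by simpa using union_parts G)

end Swap

/-! ### A random access machine with step count and bounded words -/

namespace RAM

/-- Structured programs for a random access machine with registers (named by natural numbers), a
work memory of addressable cells and a random access read-only input. -/
inductive Cmd : Type
  /-- do nothing -/
  | skip : Cmd
  /-- `r_x := c` -/
  | const (x c : ℕ) : Cmd
  /-- `r_x := r_y + r_z` -/
  | add (x y z : ℕ) : Cmd
  /-- `r_x := r_y - r_z` (truncated at `0`) -/
  | sub (x y z : ℕ) : Cmd
  /-- `r_x := input[r_y]` -/
  | read (x y : ℕ) : Cmd
  /-- `r_x := mem[r_y]` -/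
  | load (x y : ℕ) : Cmd
  /-- `mem[r_x] := r_y` -/
  | store (x y : ℕ) : Cmd
  /-- first `c`, then `d` -/
  | seq (c d : Cmd) : Cmd
  /-- `if r_x < r_y then c else d` -/
  | ifLt (x y : ℕ) (c d : Cmd) : Cmd
  /-- `while r_x < r_y do c` -/
  | whileLt (x y : ℕ) (c : Cmd) : Cmd

/-- The contents of the registers and of the work memory. -/
structure State where
  reg : ℕ → ℕ
  mem : ℕ → ℕ

/-- All registers and all cells of the work memory hold `0`. -/
def State.init : State := ⟨fun _ => 0, fun _ => 0⟩

/-- Write `v` into register `x`. -/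
def State.setReg (s : State) (x v : ℕ) : State := ⟨Function.update s.reg x v, s.mem⟩

/-- Write `v` into the memory cell with address `i`. -/
def State.setMem (s : State) (i v : ℕ) : State := ⟨s.reg, Function.update s.mem i v⟩

/-- `Exec W inp c s t s'`: on the input `inp`, the program `c` started in state `s` halts in state
`s'` after exactly `t` steps, and every word written on the way is smaller than `W`. Every
elementary instruction and every evaluation of a test is one step. -/
inductive Exec (W : ℕ) (inp : ℕ → ℕ) : Cmd → State → ℕ → State → Prop
  | skip (s : State) : Exec W inp .skip s 1 s
  | const (s : State) (x c : ℕ) (h : c < W) :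
      Exec W inp (.const x c) s 1 (s.setReg x c)
  | add (s : State) (x y z : ℕ) (h : s.reg y + s.reg z < W) :
      Exec W inp (.add x y z) s 1 (s.setReg x (s.reg y + s.reg z))
  | sub (s : State) (x y z : ℕ) (h : s.reg y - s.reg z < W) :
      Exec W inp (.sub x y z) s 1 (s.setReg x (s.reg y - s.reg z))
  | read (s : State) (x y : ℕ) (h : inp (s.reg y) < W) :
      Exec W inp (.read x y) s 1 (s.setReg x (inp (s.reg y)))
  | load (s : State) (x y : ℕ) (h : s.mem (s.reg y) < W) :
      Exec W inp (.load x y) s 1 (s.setReg x (s.mem (s.reg y)))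
  | store (s : State) (x y : ℕ) (h : s.reg y < W) :
      Exec W inp (.store x y) s 1 (s.setMem (s.reg x) (s.reg y))
  | seq (s s' s'' : State) (c d : Cmd) (t t' : ℕ)
      (hc : Exec W inp c s t s') (hd : Exec W inp d s' t' s'') :
      Exec W inp (.seq c d) s (t + t') s''
  | ifTrue (s s' : State) (x y : ℕ) (c d : Cmd) (t : ℕ) (h : s.reg x < s.reg y)
      (hc : Exec W inp c s t s') :
      Exec W inp (.ifLt x y c d) s (1 + t) s'
  | ifFalse (s s' : State) (x y : ℕ) (c d : Cmd) (t : ℕ) (h : ¬ s.reg x < s.reg y)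
      (hd : Exec W inp d s t s') :
      Exec W inp (.ifLt x y c d) s (1 + t) s'
  | whileTrue (s s' s'' : State) (x y : ℕ) (c : Cmd) (t t' : ℕ) (h : s.reg x < s.reg y)
      (hc : Exec W inp c s t s') (hw : Exec W inp (.whileLt x y c) s' t' s'') :
      Exec W inp (.whileLt x y c) s (1 + t + t') s''
  | whileFalse (s : State) (x y : ℕ) (c : Cmd) (h : ¬ s.reg x < s.reg y) :
      Exec W inp (.whileLt x y c) s 1 s

/-- `L` is an adjacency list representation of `G`: for each vertex `v`, the list `L v` contains
each neighbour of `v` exactly once (in any order) and nothing else. -/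
def IsAdjList {n : ℕ} (G : SimpleGraph (Fin n)) (L : Fin n → List (Fin n)) : Prop :=
  ∀ v, (L v).Nodup ∧ ∀ w, w ∈ L v ↔ G.Adj v w

/-- The input that presents a graph by adjacency lists: the number `n`, followed for each vertex
`v = 0, …, n - 1` by the length of its list and the entries of its list. These are
`1 + n + 2m` words, where `m` is the number of edges. -/
def encode {n : ℕ} (L : Fin n → List (Fin n)) : List ℕ :=
  n :: (List.finRange n).flatMap fun v => (L v).length :: (L v).map Fin.val

/-- The input as a random access array (cells beyond its length hold `0`). -/
def input {n : ℕ} (L : Fin n → List (Fin n)) : ℕ → ℕ := fun i => (encode L).getD i 0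

/-- The program `P` computes the set of vertices `S G` from every adjacency list representation of
every graph `G`, in time `O(n + m)` with words of `log₂ (n + m) + O(1)` bits: it halts with
`mem[v] = 1` for the vertices `v` in `S G` and `mem[v] = 0` for the other vertices. -/
def ComputesInLinearTime (P : Cmd)
    (S : {n : ℕ} → SimpleGraph (Fin n) → Finset (Fin n)) : Prop :=
  ∃ C : ℕ, ∀ n : ℕ, 1 ≤ n → ∀ (G : SimpleGraph (Fin n)) (L : Fin n → List (Fin n)),
    IsAdjList G L →
      ∃ (t : ℕ) (s : State),
        Exec (C * (n + G.edgeSet.ncard)) (input L) P State.init t s ∧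
        t ≤ C * (n + G.edgeSet.ncard) ∧
        ∀ v : Fin n, s.mem v.val = if v ∈ S G then 1 else 0

end RAM

/-! Encode the bipartition by signs s_v = ±1 and put M = 2m. The modularity score becomes (1/2M)(∑
s_u s_v 1_{uv∈E} − (∑ s_u d_u)²/M), see `modularityScore_partition`. Swapping acts only on the pairs
(a_i, b_i). On V₁ the sign is the parity, and s_{b_i} is the sign of T_i, so the edges between V₀
and V₁ contribute exactly ∑ |T_i| to the sum over unordered pairs (`sum_product_spin`).

The T_i depend on disjoint sets of edges and have variance σ² = 4kp(1−p). If E|T_i| ≥ βσ, then ∑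
|T_i| has mean at least 2kβσ ≈ 0.272 β Λ with Λ = n(np(1−p))^{1/2} (`gain`), and it is concentrated.
Since M ≈ pn², this yields a score of about 0.272 β ((1−p)/(np))^{1/2}. The constant 4/15 < 0.272
leaves room for the errors, and β = 3/4 turns it into 1/5.

The moment bounds come from the characteristic function of T_i, which is at most exp(−σ²(1−cos t)).
For σ ≥ 100, partial sums of the Fourier series of the triangle wave bound |x| from below and give β
= 3/4 (a Gaussian would give about 0.798). For σ ≥ 1/2, the inequality 1 − cos x ≤ |x| gives β =
18/100.

The error terms are small for three reasons. All signs are determined by the edges between V₀ and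
V₁, so the other edges are independent of them and their centred sum has standard deviation
O(n(p(1−p))^{1/2}). The mean of that contribution is at least −pn/2, because the signs on V₀ cancel
and (∑ s_v)² ≥ 0. The volume difference has second moment O(pn²): the dangerous term ∑ s_{b_i}(deg
b_i − deg a_i), degrees into V₁, is centred, since exchanging all partners fixes T_i and negates the
degree difference (`expect_spin_mul_diff`). Markov's inequality for second moments bounds the
failure probability by O(1/n).

For the running time, an explicit program is verified with a loop rule in which a potential pays for
the steps. The potential is the unread part of the input. -/

namespace Swap

variable {n : ℕ}

/-! ### The two parts as a sign vector -/

theorem a_mem_partA (G : SimpleGraph (Fin n)) (i : Fin (2 * (n / 6))) :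
    a i ∈ partA G ↔ ¬ 0 < T G i := by
  rw [mem_partA]
  constructor
  · rintro (⟨j, hj⟩ | h)
    · intro hT
      unfold a' at hj
      split_ifs at hj with h'
      · simp only [a, b, Fin.ext_iff] at hj
        omega
      · have : j = i := by
          simp only [a, Fin.ext_iff] at hj
          exact Fin.ext (by omega)
        exact h' (this ▸ hT)
    · simp only [a] at h
      omega
  · intro h
    exact Or.inl ⟨i, by rw [a', if_neg h]⟩

theorem b_mem_partA (G : SimpleGraph (Fin n)) (i : Fin (2 * (n / 6))) :
    b i ∈ partA G ↔ 0 < T G i := by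
  rw [mem_partA]
  constructor
  · rintro (⟨j, hj⟩ | h)
    · unfold a' at hj
      split_ifs at hj with h'
      · have : j = i := by
          simp only [b, Fin.ext_iff] at hj
          exact Fin.ext (by omega)
        exact this ▸ h'
      · simp only [a, b, Fin.ext_iff] at hj
        omega
    · simp only [b] at h
      omega
  · intro h
    exact Or.inl ⟨i, by rw [a', if_pos h]⟩

theorem a'_val_lt (G : SimpleGraph (Fin n)) (i : Fin (2 * (n / 6))) :
    (a' G i).val < 4 * (n / 6) := by
  unfold a'
  split_ifs <;> simp only [a, b] <;> omega

theorem mem_partA_of_le (G : SimpleGraph (Fin n)) {v : Fin n} (hv : 4 * (n / 6) ≤ v.val) :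
    v ∈ partA G ↔ v.val % 2 = 0 := by
  rw [mem_partA]
  constructor
  · rintro (⟨j, hj⟩ | h)
    · have := a'_val_lt G j
      rw [hj] at this
      omega
    · exact h.1
  · exact fun h => Or.inr ⟨h, hv⟩

/-- The sign `+1` on the part `A'` and `-1` on the part `B'`. -/
noncomputable def spin (G : SimpleGraph (Fin n)) (v : Fin n) : ℝ := if v ∈ partA G then 1 else -1

/-- The sign `+1` on odd labels and `-1` on even labels. -/
def parity (v : Fin n) : ℝ := if v.val % 2 = 0 then 1 else -1

theorem spin_mul_self (G : SimpleGraph (Fin n)) (v : Fin n) : spin G v * spin G v = 1 := by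
  unfold spin
  split_ifs <;> norm_num

theorem parity_mul_self (v : Fin n) : parity v * parity v = 1 := by
  unfold parity
  split_ifs <;> norm_num

theorem spin_a (G : SimpleGraph (Fin n)) (i : Fin (2 * (n / 6))) :
    spin G (a i) = if 0 < T G i then -1 else 1 := by
  unfold spin
  simp only [a_mem_partA]
  split_ifs <;> rfl

theorem spin_b (G : SimpleGraph (Fin n)) (i : Fin (2 * (n / 6))) :
    spin G (b i) = if 0 < T G i then 1 else -1 := by
  unfold spin
  simp only [b_mem_partA]

theorem spin_of_le (G : SimpleGraph (Fin n)) {v : Fin n} (hv : 4 * (n / 6) ≤ v.val) :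
    spin G v = parity v := by
  unfold spin parity
  simp only [mem_partA_of_le G hv]

/-- The other vertex of the pair `{2i - 1, 2i}`; the vertex `n` is its own partner if `n` is odd. -/
def partner (v : Fin n) : Fin n :=
  if h : v.val % 2 = 0 then
    if h' : v.val + 1 < n then ⟨v.val + 1, h'⟩ else v
  else ⟨v.val - 1, by omega⟩

theorem partner_val (v : Fin n) (hv : v.val + 1 < n ∨ n % 2 = 0) :
    (partner v).val = if v.val % 2 = 0 then v.val + 1 else v.val - 1 := by
  have := v.isLt
  unfold partner
  split_ifs <;> simp_all
  omega

theorem partner_partner (v : Fin n) : partner (partner v) = v := by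
  have := v.isLt
  apply Fin.ext
  unfold partner
  split_ifs <;> simp_all <;> omega

theorem exists_a_or_b {v : Fin n} (hv : v.val < 4 * (n / 6)) : ∃ i, v = a i ∨ v = b i := by
  refine ⟨⟨v.val / 2, by omega⟩, ?_⟩
  simp only [a, b, Fin.ext_iff]
  omega

theorem partner_a (i : Fin (2 * (n / 6))) : partner (a i) = b i := by
  apply Fin.ext
  have : (a i).val + 1 < n := by simp only [a]; omega
  rw [partner_val _ (Or.inl this)]
  simp [a, b]

theorem partner_b (i : Fin (2 * (n / 6))) : partner (b i) = a i := by
  rw [← partner_a, partner_partner]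

theorem parity_partner {v : Fin n} (hv : v.val + 1 < n ∨ n % 2 = 0) :
    parity (partner v) = -parity v := by
  unfold parity
  rw [partner_val v hv]
  split_ifs <;> first | omega | norm_num

/-- This is the source of balance: swapping exchanges two partners, so partners stay in opposite
parts whatever the T_i are. Only the unpaired vertex n for odd n survives in `sum_spin`. -/
theorem spin_partner (G : SimpleGraph (Fin n)) {v : Fin n} (hv : v.val + 1 < n ∨ n % 2 = 0) :
    spin G (partner v) = -spin G v := by
  by_cases h : v.val < 4 * (n / 6)
  · obtain ⟨i, rfl | rfl⟩ := exists_a_or_b h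
    · rw [partner_a, spin_a, spin_b]
      split_ifs <;> norm_num
    · rw [partner_b, spin_a, spin_b]
      split_ifs <;> norm_num
  · have h2 : 4 * (n / 6) ≤ (partner v).val := by
      rw [partner_val v hv]
      split_ifs <;> omega
    rw [spin_of_le G h2, spin_of_le G (by omega), parity_partner hv]

theorem partner_ne {v : Fin n} (hv : v.val + 1 < n ∨ n % 2 = 0) : partner v ≠ v := by
  intro h
  have := congrArg Fin.val h
  rw [partner_val v hv] at this
  split_ifs at this <;> omega

/-- A sum over a set of pairs vanishes if the summand is odd under exchange of partners. -/
theorem sum_eq_zero_of_partner {S : Finset (Fin n)} {f : Fin n → ℝ}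
    (hS : ∀ v ∈ S, partner v ∈ S) (hS' : ∀ v ∈ S, v.val + 1 < n ∨ n % 2 = 0)
    (hf : ∀ v ∈ S, f (partner v) = -f v) : ∑ v ∈ S, f v = 0 :=
  Finset.sum_involution (fun v _ => partner v) (fun v hv => by rw [hf v hv, add_neg_cancel])
    (fun v hv _ => partner_ne (hS' v hv)) hS (fun v _ => partner_partner v)

theorem sum_spin (G : SimpleGraph (Fin n)) : ∑ v, spin G v = (n % 2 : ℕ) := by
  rcases Nat.mod_two_eq_zero_or_one n with h | h
  · rw [h, Nat.cast_zero]
    exact sum_eq_zero_of_partner (by simp) (fun _ _ => Or.inr h)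
      (fun v _ => spin_partner G (Or.inr h))
  · have hn : n - 1 < n := by omega
    rw [← Finset.add_sum_erase _ _ (Finset.mem_univ (⟨n - 1, hn⟩ : Fin n)), h]
    have key : ∀ v ∈ Finset.univ.erase (⟨n - 1, hn⟩ : Fin n), v.val + 1 < n := by
      intro v hv
      have : v.val ≠ n - 1 := by simpa [Fin.ext_iff] using hv
      omega
    rw [sum_eq_zero_of_partner, spin_of_le G (by dsimp only; omega), parity,
      if_pos (by dsimp only; omega)]
    · simp
    · intro v hv
      have h1 := key v hv
      simp only [Finset.mem_erase, Finset.mem_univ, and_true, ne_eq, Fin.ext_iff]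
      rw [partner_val v (Or.inl h1)]
      split_ifs <;> omega
    · exact fun v hv => Or.inl (key v hv)
    · exact fun v hv => spin_partner G (Or.inl (key v hv))

theorem partB_eq_compl (G : SimpleGraph (Fin n)) : partB G = (partA G)ᶜ :=
  eq_compl_iff_isCompl.2
    (IsCompl.of_eq (Finset.disjoint_iff_inter_eq_empty.1 (disjoint_parts G).symm)
      (by rw [sup_comm]; exact union_parts G))

theorem card_parts (G : SimpleGraph (Fin n)) :
    (partA G).card + (partB G).card = n ∧ (partA G).card = (partB G).card + n % 2 := by
  have h1 : (partA G).card + (partB G).card = n := by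
    rw [partB_eq_compl, Finset.card_add_card_compl, Fintype.card_fin]
  refine ⟨h1, ?_⟩
  have h2 := sum_spin G
  have h3 : ∑ v, spin G v = ((partA G).card : ℝ) - (partB G).card := by
    rw [← Finset.sum_add_sum_compl (partA G), ← partB_eq_compl, sub_eq_add_neg]
    congr 1
    · rw [Finset.sum_congr rfl fun v hv => (show spin G v = 1 from if_pos hv)]
      simp
    · have : ∀ v ∈ partB G, spin G v = -1 := fun v hv =>
        if_neg (by simpa [partB_eq_compl] using hv)
      rw [Finset.sum_congr rfl this]
      simp
  rw [h3, sub_eq_iff_eq_add'] at h2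
  exact_mod_cast h2

theorem partition_parts (hn : 2 ≤ n) (G : SimpleGraph (Fin n)) :
    (partition G).parts = {partA G, partB G} := by
  obtain ⟨h1, h2⟩ := card_parts G
  refine Finset.erase_eq_of_notMem ?_
  simp only [Finset.bot_eq_empty, Finset.mem_insert, Finset.mem_singleton, not_or]
  constructor <;> intro h <;> simp only [← h, Finset.card_empty] at h1 h2 <;> omega

theorem partA_ne_partB (hn : 2 ≤ n) (G : SimpleGraph (Fin n)) : partA G ≠ partB G := by
  intro h
  have h1 := disjoint_parts G
  rw [← h, disjoint_self, Finset.bot_eq_empty] at h1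
  have h2 := (card_parts G).1
  rw [← h, h1, Finset.card_empty] at h2
  omega

theorem partition_card_and_isEquipartition (hn : 2 ≤ n) (G : SimpleGraph (Fin n)) :
    (partition G).parts.card = 2 ∧ (partition G).IsEquipartition := by
  constructor
  · rw [partition_parts hn, Finset.card_pair (partA_ne_partB hn G)]
  · obtain ⟨h1, h2⟩ := card_parts G
    intro X Y hX hY
    rw [partition_parts hn] at hX hY
    simp only [Finset.coe_insert, Finset.coe_singleton, Set.mem_insert_iff,
      Set.mem_singleton_iff] at hX hY
    rcases hX with rfl | rfl <;> rcases hY with rfl | rfl <;> omega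

/-! ### The modularity score in terms of signs -/

open scoped Classical in
/-- The indicator of the edge `uv`. -/
noncomputable def adj (G : SimpleGraph (Fin n)) (u v : Fin n) : ℝ := if G.Adj u v then 1 else 0

theorem adj_comm (G : SimpleGraph (Fin n)) (u v : Fin n) : adj G u v = adj G v u := by
  unfold adj
  congr 1
  exact propext (G.adj_comm u v)

open scoped Classical in
theorem degree_eq_sum_adj (G : SimpleGraph (Fin n)) (u : Fin n) :
    (G.degree u : ℝ) = ∑ v, adj G u v := by
  simp only [adj, Finset.sum_boole, ← SimpleGraph.card_neighborFinset_eq_degree,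
    SimpleGraph.neighborFinset_eq_filter]

theorem two_mul_ncard_edgeSet (G : SimpleGraph (Fin n)) :
    2 * (G.edgeSet.ncard : ℝ) = ∑ u, ∑ v, adj G u v := by
  classical
  have h := G.sum_degrees_eq_twice_card_edges
  rw [← SimpleGraph.coe_edgeFinset, Set.ncard_coe_finset]
  rw [← Nat.cast_two, ← Nat.cast_mul, ← h, Nat.cast_sum]
  exact Finset.sum_congr rfl fun u _ => by rw [← degree_eq_sum_adj]

/-- The indicator of u and v lying in the same part is (1 + s_u s_v)/2. -/
theorem sum_parts_eq (G : SimpleGraph (Fin n)) (f : Fin n → Fin n → ℝ) :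
    (∑ u ∈ partA G, ∑ v ∈ partA G, f u v) + ∑ u ∈ partB G, ∑ v ∈ partB G, f u v
      = (∑ u, ∑ v, f u v + ∑ u, ∑ v, spin G u * spin G v * f u v) / 2 := by
  have hA : ∀ g : Fin n → ℝ, ∑ v ∈ partA G, g v = ∑ v, (1 + spin G v) / 2 * g v := by
    intro g
    rw [← Finset.sum_add_sum_compl (partA G), ← add_zero (∑ v ∈ partA G, g v)]
    congr 1
    · refine Finset.sum_congr rfl fun v hv => ?_
      rw [spin, if_pos hv]
      ring
    · refine (Finset.sum_eq_zero fun v hv => ?_).symm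
      rw [spin, if_neg (by simpa using hv)]
      ring
  have hB : ∀ g : Fin n → ℝ, ∑ v ∈ partB G, g v = ∑ v, (1 - spin G v) / 2 * g v := by
    intro g
    have := Finset.sum_add_sum_compl (partA G) g
    rw [← partB_eq_compl, hA] at this
    rw [← sub_eq_iff_eq_add'.2 this.symm, ← Finset.sum_sub_distrib]
    exact Finset.sum_congr rfl fun v _ => by ring
  simp only [hA, hB, Finset.mul_sum, ← Finset.sum_add_distrib, Finset.sum_div]
  exact Finset.sum_congr rfl fun u _ => Finset.sum_congr rfl fun v _ => by ring

/-- The modularity score of the bipartition, in terms of the signs: with `M = 2m` it is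
`(1 / 2M) (∑_{u,v} s_u s_v 1_{uv ∈ E} - (∑_u s_u d_u)² / M)`. -/
theorem modularityScore_partition (hn : 2 ≤ n) (G : SimpleGraph (Fin n)) {M : ℝ}
    (hM : M = ∑ u, ∑ v, adj G u v) :
    modularityScore G (partition G) = 1 / (2 * M) *
      (∑ u, ∑ v, spin G u * spin G v * adj G u v
        - (∑ u, ∑ v, spin G u * adj G u v) ^ 2 / M) := by
  classical
  unfold modularityScore
  rw [partition_parts hn, Finset.sum_pair (partA_ne_partB hn G), sum_parts_eq,
    two_mul_ncard_edgeSet, ← hM]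
  have h0 : ∀ u v, (if G.Adj u v then (1 : ℝ) else 0) = adj G u v := fun u v => by
    unfold adj
    congr
  set d : Fin n → ℝ := fun u => ∑ v, adj G u v with hd
  have h1 : ∀ u, ((G.degree u : ℕ) : ℝ) = d u := fun u => by
    simp only [hd, ← degree_eq_sum_adj]
  simp only [h0, h1]
  -- The entries of the modularity matrix sum to 0, so only the half weighted by signs remains.
  -- `mul_self_div_self` also covers M = 0.
  have h2 : ∑ u, ∑ v, (adj G u v - d u * d v / M) = 0 := by
    simp only [Finset.sum_sub_distrib]
    rw [← hM]
    have : ∑ u, ∑ v, d u * d v / M = M * M / M := by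
      simp only [← Finset.sum_div, ← Finset.sum_mul_sum]
      rw [← hM]
    rw [this, mul_self_div_self, sub_self]
  have h3 : ∑ u, ∑ v, spin G u * spin G v * (adj G u v - d u * d v / M)
      = ∑ u, ∑ v, spin G u * spin G v * adj G u v
        - (∑ u, ∑ v, spin G u * adj G u v) ^ 2 / M := by
    simp only [mul_sub, Finset.sum_sub_distrib]
    congr 1
    simp only [← Finset.mul_sum]
    rw [sq, Finset.sum_mul_sum, Finset.sum_div]
    refine Finset.sum_congr rfl fun u _ => ?_
    rw [Finset.sum_div]
    exact Finset.sum_congr rfl fun v _ => by rw [hd]; ring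
  rw [h2, h3, zero_add]
  ring

end Swap

/-! ### Independent Bernoulli variables on a finite product space -/

namespace BernoulliProduct

variable {ι : Type*}

theorem dependsOn_coord (e : ι) (f : Bool → ℝ) :
    DependsOn (fun ω : ι → Bool => f (ω e)) {e} := fun _ _ h => congrArg f (h e rfl)

variable [Fintype ι] [DecidableEq ι]

/-- The probability of the value `b` of a Bernoulli variable with parameter `p`. -/
def mass (p : ℝ) (b : Bool) : ℝ := if b then p else 1 - p

/-- The expectation of `f` for independent Bernoulli variables with parameter `p`. -/
def expect (p : ℝ) (f : (ι → Bool) → ℝ) : ℝ := ∑ ω, (∏ e, mass p (ω e)) * f ω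

/-- The value of a Bernoulli variable as a real number. -/
def ind (b : Bool) : ℝ := if b then 1 else 0

variable {p : ℝ}

/-- Distributivity of the product over the sum. Values in an algebra over ℝ are allowed so that the
same identity serves for probabilities and, with R = ℂ, for characteristic functions. -/
theorem sum_prod_mass_mul {R : Type*} [CommRing R] [Algebra ℝ R] (f : ι → Bool → R) :
    ∑ ω : ι → Bool, algebraMap ℝ R (∏ e, mass p (ω e)) * ∏ e, f e (ω e)
      = ∏ e, (algebraMap ℝ R p * f e true + algebraMap ℝ R (1 - p) * f e false) := by
  have h := Finset.prod_univ_sum (fun _ : ι => (Finset.univ : Finset Bool))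
    (fun e b => algebraMap ℝ R (mass p b) * f e b)
  simp only [Fintype.sum_bool, Fintype.piFinset_univ] at h
  simp only [map_prod, ← Finset.prod_mul_distrib]
  rw [← h]
  simp [mass]

/-- Expectations of products of functions of distinct coordinates factorize. -/
theorem sum_prod_mass_mul_of_injective {R : Type*} [CommRing R] [Algebra ℝ R] {κ : Type*}
    [Fintype κ] {g : κ → ι} (hg : Function.Injective g) (f : κ → Bool → R) :
    ∑ ω : ι → Bool, algebraMap ℝ R (∏ e, mass p (ω e)) * ∏ x, f x (ω (g x))
      = ∏ x, (algebraMap ℝ R p * f x true + algebraMap ℝ R (1 - p) * f x false) := by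
  have h := sum_prod_mass_mul (p := p) (Function.extend g f (fun _ _ => 1))
  have h1 : ∀ ω : ι → Bool, ∏ x, f x (ω (g x))
      = ∏ e, Function.extend g f (fun _ _ => 1) e (ω e) := fun ω =>
    Fintype.prod_of_injective g hg _ _
      (fun e he => by rw [Function.extend_apply' _ _ _ (by simpa using he)])
      (fun x => by rw [hg.extend_apply])
  simp only [h1, h]
  refine (Fintype.prod_of_injective g hg _ _ (fun e he => ?_) (fun x => ?_)).symm
  · rw [Function.extend_apply' _ _ _ (by simpa using he)]
    simp
  · rw [hg.extend_apply]

theorem expect_one : expect p (fun _ : ι → Bool => 1) = 1 := by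
  have h := sum_prod_mass_mul (p := p) (fun (_ : ι) _ => (1 : ℝ))
  simpa [expect] using h

theorem expect_add (f g : (ι → Bool) → ℝ) :
    expect p (fun ω => f ω + g ω) = expect p f + expect p g := by
  simp only [expect, mul_add, Finset.sum_add_distrib]

theorem expect_sub (f g : (ι → Bool) → ℝ) :
    expect p (fun ω => f ω - g ω) = expect p f - expect p g := by
  simp only [expect, mul_sub, Finset.sum_sub_distrib]

theorem expect_const_mul (c : ℝ) (f : (ι → Bool) → ℝ) :
    expect p (fun ω => c * f ω) = c * expect p f := by
  simp only [expect, Finset.mul_sum]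
  exact Finset.sum_congr rfl fun ω _ => by ring

theorem expect_const (c : ℝ) : expect p (fun _ : ι → Bool => c) = c := by
  simpa [expect_one] using expect_const_mul (ι := ι) (p := p) c (fun _ => 1)

theorem expect_sum {κ : Type*} (s : Finset κ) (f : κ → (ι → Bool) → ℝ) :
    expect p (fun ω => ∑ x ∈ s, f x ω) = ∑ x ∈ s, expect p (f x) := by
  simp only [expect, Finset.mul_sum]
  exact Finset.sum_comm

theorem mass_nonneg (h0 : 0 ≤ p) (h1 : p ≤ 1) (b : Bool) : 0 ≤ mass p b := by
  cases b <;> simp [mass, h0, h1]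

theorem expect_mono (h0 : 0 ≤ p) (h1 : p ≤ 1) {f g : (ι → Bool) → ℝ} (h : ∀ ω, f ω ≤ g ω) :
    expect p f ≤ expect p g :=
  Finset.sum_le_sum fun ω _ =>
    mul_le_mul_of_nonneg_left (h ω) (Finset.prod_nonneg fun _ _ => mass_nonneg h0 h1 _)

/-- Permuting the coordinates does not change expectations. -/
theorem expect_comp_perm (π : Equiv.Perm ι) (f : (ι → Bool) → ℝ) :
    expect p (fun ω => f (fun e => ω (π e))) = expect p f := by
  unfold expect
  refine Fintype.sum_equiv (π.symm.arrowCongr (Equiv.refl Bool)) _ _ fun ω => ?_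
  congr 1
  exact (Equiv.prod_comp π (fun e => mass p (ω e))).symm

/-- Functions of disjoint sets of coordinates are independent. -/
theorem expect_mul_of_dependsOn {S : Set ι} {f g : (ι → Bool) → ℝ} (hf : DependsOn f S)
    (hg : DependsOn g Sᶜ) : expect p (fun ω => f ω * g ω) = expect p f * expect p g := by
  classical
  let Φ := Equiv.piEquivPiSubtypeProd (fun e => e ∈ S) (fun _ => Bool)
  let wS : ({e // e ∈ S} → Bool) → ℝ := fun x => ∏ e, mass p (x e)
  let wC : ({e // e ∉ S} → Bool) → ℝ := fun x => ∏ e, mass p (x e)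
  -- The coordinates that f and g ignore are frozen at `false`; any value would do.
  let fS : ({e // e ∈ S} → Bool) → ℝ := fun x => f (Φ.symm (x, fun _ => false))
  let gC : ({e // e ∉ S} → Bool) → ℝ := fun y => g (Φ.symm (fun _ => false, y))
  have hfS : ∀ z, f (Φ.symm z) = fS z.1 := fun z => hf fun e he => by
    simp [Φ, Equiv.piEquivPiSubtypeProd, he]
  have hgC : ∀ z, g (Φ.symm z) = gC z.2 := fun z => hg fun e he => by
    have he' : e ∉ S := he
    simp [Φ, Equiv.piEquivPiSubtypeProd, he']
  have hw : ∀ z, ∏ e, mass p (Φ.symm z e) = wS z.1 * wC z.2 := fun z => by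
    rw [← Fintype.prod_subtype_mul_prod_subtype (fun e => e ∈ S)]
    congr 1 <;> refine Finset.prod_congr rfl fun e _ => ?_
    · simp [Φ, Equiv.piEquivPiSubtypeProd, e.2]
    · simp [Φ, Equiv.piEquivPiSubtypeProd, e.2]
  have key : ∀ h : (ι → Bool) → ℝ, expect p h = ∑ x, ∑ y, wS x * wC y * h (Φ.symm (x, y)) := by
    intro h
    unfold expect
    rw [← Φ.symm.sum_comp, Fintype.sum_prod_type]
    simp only [hw]
  have hS1 : ∑ x, wS x = 1 := by simpa [expect] using expect_one (ι := {e // e ∈ S}) (p := p)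
  have hC1 : ∑ y, wC y = 1 := by simpa [expect] using expect_one (ι := {e // e ∉ S}) (p := p)
  have e1 : expect p f = ∑ x, wS x * fS x := by
    rw [key]
    refine Finset.sum_congr rfl fun x _ => ?_
    simp only [hfS]
    rw [← Finset.sum_mul, ← Finset.mul_sum, hC1, mul_one]
  have e2 : expect p g = ∑ y, wC y * gC y := by
    rw [key, Finset.sum_comm]
    refine Finset.sum_congr rfl fun y _ => ?_
    simp only [hgC]
    rw [← Finset.sum_mul, ← Finset.sum_mul, hS1, one_mul]
  rw [e1, e2, key, Finset.sum_mul_sum]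
  refine Finset.sum_congr rfl fun x _ => Finset.sum_congr rfl fun y _ => ?_
  rw [hfS, hgC]
  ring

theorem expect_coord (e : ι) (f : Bool → ℝ) :
    expect p (fun ω : ι → Bool => f (ω e)) = p * f true + (1 - p) * f false := by
  have h := sum_prod_mass_mul_of_injective (p := p) (ι := ι) (κ := Unit) (g := fun _ => e)
    (fun _ _ _ => rfl) (fun _ => f)
  simpa [expect] using h

theorem expect_mul_centered {e : ι} {g : (ι → Bool) → ℝ} (hg : DependsOn g {e}ᶜ) :
    expect p (fun ω => g ω * (ind (ω e) - p)) = 0 := by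
  have h := expect_mul_of_dependsOn (p := p) (dependsOn_coord e (fun b => ind b - p)) hg
  simp only [mul_comm (g _)]
  rw [h, expect_coord e (fun b => ind b - p)]
  simp [ind]
  ring_nf
  simp

/-- The second moment of a linear combination of centred coordinates whose coefficients depend
only on the other coordinates. -/
theorem expect_sq_sum_le (h0 : 0 ≤ p) (h1 : p ≤ 1) {κ : Type*} (K : Finset κ) {g : κ → ι}
    (hg : Set.InjOn g K) {c : κ → (ι → Bool) → ℝ}
    (hc : ∀ x ∈ K, DependsOn (c x) (g '' K)ᶜ) {B : ℝ} (hB : ∀ x ∈ K, ∀ ω, c x ω ^ 2 ≤ B) :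
    expect p (fun ω => (∑ x ∈ K, c x ω * (ind (ω (g x)) - p)) ^ 2)
      ≤ K.card * (B * (p * (1 - p))) := by
  have h2 : ∀ ω : ι → Bool, (∑ x ∈ K, c x ω * (ind (ω (g x)) - p)) ^ 2
      = ∑ x ∈ K, ∑ y ∈ K, c x ω * (ind (ω (g x)) - p) * (c y ω * (ind (ω (g y)) - p)) :=
    fun ω => by rw [sq, Finset.sum_mul_sum]
  simp only [h2, expect_sum]
  have h3 : ∀ x ∈ K, ∑ y ∈ K,
      expect p (fun ω => c x ω * (ind (ω (g x)) - p) * (c y ω * (ind (ω (g y)) - p)))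
        ≤ B * (p * (1 - p)) := by
    intro x hx
    rw [Finset.sum_eq_single x]
    · have : ∀ ω : ι → Bool, c x ω * (ind (ω (g x)) - p) * (c x ω * (ind (ω (g x)) - p))
          ≤ B * (ind (ω (g x)) - p) ^ 2 := fun ω => by
        have := mul_le_mul_of_nonneg_right (hB x hx ω) (sq_nonneg (ind (ω (g x)) - p))
        nlinarith
      refine (expect_mono h0 h1 this).trans (le_of_eq ?_)
      rw [expect_const_mul, expect_coord (g x) (fun b => (ind b - p) ^ 2)]
      simp only [ind, if_true, Bool.false_eq_true, if_false]
      ring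
    -- Off the diagonal the coordinate `g y` enters only through the last factor: the coefficients
    -- avoid `g '' K`, and injectivity keeps `g x` apart from `g y`. Hence the mixed term has mean
    -- 0.
    · intro y hy hyx
      have h4 : ∀ ω : ι → Bool, c x ω * (ind (ω (g x)) - p) * (c y ω * (ind (ω (g y)) - p))
          = c x ω * c y ω * (ind (ω (g x)) - p) * (ind (ω (g y)) - p) := fun ω => by ring
      simp only [h4]
      refine expect_mul_centered fun ω ω' hω => ?_
      have hyK : g y ∈ g '' (K : Set κ) := ⟨y, hy, rfl⟩
      have hsub : ∀ e ∈ (g '' (K : Set κ))ᶜ, ω e = ω' e := fun e he =>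
        hω e fun h => he (by rw [show e = g y from h]; exact hyK)
      rw [hc x hx hsub, hc y hy hsub, hω (g x) fun h => hyx (hg hy hx (h : g x = g y).symm)]
    · exact fun h => absurd hx h
  refine (Finset.sum_le_sum h3).trans (le_of_eq ?_)
  rw [Finset.sum_const, nsmul_eq_mul]

/-- Markov's inequality for the probability of an event. -/
theorem expect_indicator_le (h0 : 0 ≤ p) (h1 : p ≤ 1) (P : (ι → Bool) → Prop) [DecidablePred P]
    {f : (ι → Bool) → ℝ} (hf : ∀ ω, 0 ≤ f ω) {t : ℝ} (ht : 0 < t) (hP : ∀ ω, P ω → t ≤ f ω) :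
    expect p (fun ω => if P ω then 1 else 0) ≤ expect p f / t := by
  rw [le_div_iff₀ ht, mul_comm, ← expect_const_mul]
  refine expect_mono h0 h1 fun ω => ?_
  split_ifs with h
  · simpa using hP ω h
  · simpa using hf ω

end BernoulliProduct

namespace BernoulliProduct

/-! ### The binomial random graph as a product space -/

variable {V : Type*}

/-- The graph whose edges are the (non-loop) coordinates with value `true`. -/
def graphOf (ω : Sym2 V → Bool) : SimpleGraph V := SimpleGraph.fromEdgeSet {e | ω e = true}

theorem graphOf_adj (ω : Sym2 V → Bool) (u v : V) :
    (graphOf ω).Adj u v ↔ ω s(u, v) = true ∧ u ≠ v := by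
  simp [graphOf]

theorem graphOf_eq_iff (ω : Sym2 V → Bool) (G : SimpleGraph V) :
    graphOf ω = G ↔ ∀ e : Sym2 V, ¬ e.IsDiag → (ω e = true ↔ e ∈ G.edgeSet) := by
  constructor
  · rintro rfl e
    induction e with
    | h u v =>
      intro h
      simp only [Sym2.mk_isDiag_iff] at h
      simp [graphOf_adj, h]
  · intro h
    ext u v
    rw [graphOf_adj]
    by_cases huv : u = v
    · simp [huv]
    · have := h s(u, v) (by simpa using huv)
      simpa [huv] using this

variable [Fintype V] [DecidableEq V]

-- The event is a product over coordinates: an edge of G contributes p, a non-edge 1 − p, and a loop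
-- p + (1 − p) = 1, so the superfluous diagonal coordinates do no harm.
open scoped Classical in
theorem expect_graphOf_eq (p : ℝ) (G : SimpleGraph V) :
    expect p (fun ω : Sym2 V → Bool => if graphOf ω = G then 1 else 0)
      = p ^ G.edgeSet.ncard * (1 - p) ^ ((Fintype.card V).choose 2 - G.edgeSet.ncard) := by
  have h1 : ∀ ω : Sym2 V → Bool, (if graphOf ω = G then (1 : ℝ) else 0)
      = ∏ e : Sym2 V, if e.IsDiag ∨ (ω e = true ↔ e ∈ G.edgeSet) then 1 else 0 := by
    intro ω
    rw [Finset.prod_boole]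
    simp only [graphOf_eq_iff, Finset.mem_univ, true_implies]
    congr 1
    exact propext (forall_congr' fun e => by tauto)
  simp only [expect, h1]
  have h2 := sum_prod_mass_mul (p := p) (fun (e : Sym2 V) b =>
    if e.IsDiag ∨ (b = true ↔ e ∈ G.edgeSet) then (1 : ℝ) else 0)
  simp only [Algebra.algebraMap_self, RingHom.id_apply] at h2
  rw [h2]
  have h3 : ∀ e : Sym2 V,
      p * (if e.IsDiag ∨ (True ↔ e ∈ G.edgeSet) then (1 : ℝ) else 0)
        + (1 - p) * (if e.IsDiag ∨ (false = true ↔ e ∈ G.edgeSet) then (1 : ℝ) else 0)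
      = (if e ∈ G.edgeFinset then p else 1) *
        (if e ∈ Finset.univ.filter (fun e : Sym2 V => ¬ e.IsDiag) \ G.edgeFinset
          then 1 - p else 1) := by
    intro e
    by_cases hd : e.IsDiag
    · have : e ∉ G.edgeSet := fun h => G.not_isDiag_of_mem_edgeSet h hd
      simp [hd, this]
    · by_cases he : e ∈ G.edgeSet <;> simp [hd, he]
  rw [Finset.prod_congr rfl fun e _ => h3 e]
  simp only [Finset.prod_mul_distrib, Finset.prod_ite_mem, Finset.univ_inter,
    Finset.prod_const]
  rw [← SimpleGraph.coe_edgeFinset, Set.ncard_coe_finset, Finset.card_sdiff_of_subset]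
  · congr 3
    rw [← Fintype.card_subtype, Sym2.card_subtype_not_diag]
  · intro e he
    simpa using G.not_isDiag_of_mem_edgeSet (by simpa using he)

-- The bridge from the measure on graphs to finite sums: both sides are sums over the graphs in the
-- event of their point masses.
open scoped Classical in
theorem binomialRandom_real (p : unitInterval) (P : SimpleGraph V → Prop) :
    (SimpleGraph.binomialRandom V p).real {G | P G}
      = expect (p : ℝ) (fun ω : Sym2 V → Bool => if P (graphOf ω) then 1 else 0) := by
  have h1 : ∀ ω : Sym2 V → Bool, (if P (graphOf ω) then (1 : ℝ) else 0)
      = ∑ G ∈ Finset.univ.filter P, if graphOf ω = G then 1 else 0 := by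
    intro ω
    rw [Finset.sum_ite_eq]
    simp
  simp only [h1, expect_sum, expect_graphOf_eq]
  have h2 : {G : SimpleGraph V | P G}
      = ((Finset.univ.filter P : Finset (SimpleGraph V)) : Set _) := by
    ext
    simp
  have : MeasurableSingletonClass (SimpleGraph V) := ⟨fun G => by
    have := SimpleGraph.measurable_edgeSet (measurableSet_singleton G.edgeSet)
    convert! this using 1
    ext H
    simp⟩
  rw [h2, ← MeasureTheory.sum_measureReal_singleton]
  refine Finset.sum_congr rfl fun G _ => ?_
  rw [MeasureTheory.measureReal_def, SimpleGraph.binomialRandom_singleton]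
  simp

end BernoulliProduct

/-! ### Lower bounds for the first absolute moment -/

-- Subtract the Fourier series of the second Bernoulli polynomial from ∑ 1/n² = π²/6. The term n = 0
-- is 0 by the convention for division by zero.
open Real in
theorem hasSum_one_sub_cos {y : ℝ} (hy : y ∈ Set.Icc (0 : ℝ) 1) :
    HasSum (fun n : ℕ => (1 - cos (2 * π * n * y)) / (n : ℝ) ^ 2) (π ^ 2 * (y - y ^ 2)) := by
  have e := hasSum_one_div_nat_pow_mul_cos (k := 1) one_ne_zero hy
  have hB : Polynomial.eval y (Polynomial.map (algebraMap ℚ ℝ) (Polynomial.bernoulli (2 * 1)))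
      = y ^ 2 - y + 6⁻¹ := bernoulliFun_two y
  rw [hB] at e
  have e2 := hasSum_zeta_two.sub e
  have hv : π ^ 2 / 6 - (-1) ^ (1 + 1) * (2 * π) ^ (2 * 1) / 2 / ((2 * 1).factorial : ℝ)
      * (y ^ 2 - y + 6⁻¹) = π ^ 2 * (y - y ^ 2) := by
    norm_num [Nat.factorial]
    ring
  rw [hv] at e2
  have hf : (fun n : ℕ => (1 - cos (2 * π * n * y)) / (n : ℝ) ^ 2) =
      fun n : ℕ => 1 / (n : ℝ) ^ 2 - 1 / (n : ℝ) ^ (2 * 1) * cos (2 * π * n * y) := by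
    funext n
    rw [mul_one]
    ring
  rw [hf]
  exact e2

-- The odd part of the previous series at y = x/(2π). What is left is linear in x, because the
-- quadratic terms of the full and the even series cancel.
open Real in
theorem hasSum_one_sub_cos_odd {x : ℝ} (h0 : 0 ≤ x) (h1 : x ≤ π) :
    HasSum (fun j : ℕ => (1 - cos ((2 * j + 1) * x)) / (2 * j + 1) ^ 2) (π / 4 * x) := by
  have hπ := pi_pos
  have hy1 : x / (2 * π) ∈ Set.Icc (0 : ℝ) 1 :=
    ⟨by positivity, by rw [div_le_one (by positivity)]; linarith⟩
  have hy2 : x / π ∈ Set.Icc (0 : ℝ) 1 := ⟨by positivity, by rw [div_le_one hπ]; exact h1⟩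
  have k1 := hasSum_one_sub_cos hy1
  have k2 := (hasSum_one_sub_cos hy2).div_const 4
  set F : ℕ → ℝ := fun n => (1 - cos (2 * π * n * (x / (2 * π)))) / (n : ℝ) ^ 2 with hF
  have hs : Summable (fun j : ℕ => F (2 * j + 1)) :=
    k1.summable.comp_injective (i := fun j : ℕ => 2 * j + 1) (fun a b h => by simpa using h)
  -- The terms of even index form one quarter of the same series at the doubled argument.
  have heven : HasSum (fun j : ℕ => F (2 * j)) (π ^ 2 * (x / π - (x / π) ^ 2) / 4) := by
    have : (fun j : ℕ => F (2 * j)) = fun j : ℕ =>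
        (1 - cos (2 * π * j * (x / π))) / (j : ℝ) ^ 2 / 4 := by
      funext j
      simp only [hF]
      push_cast
      rw [show 2 * π * (2 * (j : ℝ)) * (x / (2 * π)) = 2 * π * j * (x / π) by field_simp, mul_pow,
        div_div, mul_comm ((j : ℝ) ^ 2)]
      norm_num
    rw [this]
    exact k2
  have hu := (heven.even_add_odd hs.hasSum).unique k1
  have hv : ∑' j : ℕ, F (2 * j + 1) = π / 4 * x := by
    rw [← eq_sub_iff_add_eq'] at hu
    rw [hu]
    field_simp
    ring
  have hodd := hs.hasSum
  rw [hv] at hodd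
  have : (fun j : ℕ => F (2 * j + 1)) =
      fun j : ℕ => (1 - cos ((2 * j + 1) * x)) / (2 * (j : ℝ) + 1) ^ 2 := by
    funext j
    simp only [hF]
    push_cast
    rw [show 2 * π * (2 * (j : ℝ) + 1) * (x / (2 * π)) = (2 * j + 1) * x by field_simp]
  rwa [this] at hodd

open Real in
/-- Partial sums of the Fourier series of the triangle wave lie below `|x|`. -/
theorem sum_one_sub_cos_odd_le (N : ℕ) (x : ℝ) :
    ∑ j ∈ Finset.range N, (1 - cos ((2 * j + 1) * x)) / (2 * (j : ℝ) + 1) ^ 2 ≤ π / 4 * |x| := by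
  have hπ := pi_pos
  have main : ∀ y : ℝ, 0 ≤ y → y ≤ π →
      ∑ j ∈ Finset.range N, (1 - cos ((2 * j + 1) * y)) / (2 * (j : ℝ) + 1) ^ 2 ≤ π / 4 * y :=
    fun y h0 h1 => sum_le_hasSum _
      (fun j _ => div_nonneg (by linarith [cos_le_one ((2 * j + 1) * y)]) (by positivity))
      (hasSum_one_sub_cos_odd h0 h1)
  have habs : ∀ j : ℕ, cos ((2 * j + 1) * x) = cos ((2 * j + 1) * |x|) := fun j => by
    rw [← cos_abs, abs_mul, abs_of_nonneg (by positivity : (0 : ℝ) ≤ 2 * j + 1)]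
  simp only [habs]
  rcases le_total |x| π with h | h
  · exact main _ (abs_nonneg x) h
  -- Beyond π each term is at most its value at π, where every odd frequency attains the maximum of
  -- 1 − cos.
  · refine le_trans (Finset.sum_le_sum fun j _ => ?_) ((main π hπ.le le_rfl).trans ?_)
    · have : cos ((2 * (j : ℝ) + 1) * π) = -1 := by
        rw [show (2 * (j : ℝ) + 1) * π = π + j * (2 * π) by ring, cos_add_nat_mul_two_pi, cos_pi]
      rw [this]
      gcongr
      linarith [neg_one_le_cos ((2 * (j : ℝ) + 1) * |x|)]
    · gcongr

-- 1 − cos x = 2 sin²(x/2) ≤ 2|sin(x/2)| ≤ |x|.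
open Real in
theorem one_sub_cos_le_abs (x : ℝ) : 1 - cos x ≤ |x| := by
  have h := cos_sq (x / 2)
  rw [mul_div_cancel₀ x two_ne_zero] at h
  have h2 := sin_sq_add_cos_sq (x / 2)
  have h3 : |sin (x / 2)| ≤ |x / 2| := abs_sin_le_abs
  have h4 := abs_sin_le_one (x / 2)
  have h5 := abs_nonneg (sin (x / 2))
  have h6 : |x / 2| = |x| / 2 := by rw [abs_div, abs_two]
  have h7 := sq_abs (sin (x / 2))
  nlinarith

-- Quadratic approximation of the cosine: the left side is slightly below (6/5)²c²/2 = 0.72 c². The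
-- range c ≤ 15 covers the odd frequencies 1, 3, …, 15, whose arguments stay below 0.18.
open Real in
theorem le_sq_mul_one_sub_cos {σ c : ℝ} (hσ : 100 ≤ σ) (hc0 : 0 ≤ c) (hc : c ≤ 15) :
    71 / 100 * c ^ 2 ≤ σ ^ 2 * (1 - cos (c * (6 / 5 / σ))) := by
  have hσ0 : 0 < σ := by linarith
  set x := c * (6 / 5 / σ) with hx
  have hxσ : x * σ = 6 / 5 * c := by
    rw [hx]
    field_simp
  have hx0 : 0 ≤ x := by positivity
  have hx1 : x ≤ 18 / 100 := by nlinarith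
  have hb := cos_bound (x := x) (by rw [abs_of_nonneg hx0]; linarith)
  rw [abs_of_nonneg hx0] at hb
  have hb2 := (abs_le.1 hb).2
  have h2 : σ ^ 2 * (x ^ 2 / 2 - x ^ 4 * (5 / 96)) ≤ σ ^ 2 * (1 - cos x) := by
    refine mul_le_mul_of_nonneg_left ?_ (sq_nonneg σ)
    linarith
  refine le_trans ?_ h2
  have h3 : σ ^ 2 * (x ^ 2 / 2 - x ^ 4 * (5 / 96)) = (x * σ) ^ 2 * (1 / 2 - x ^ 2 * (5 / 96)) := by
    ring
  rw [h3, hxσ]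
  have h4 : x ^ 2 ≤ (18 / 100) ^ 2 := by gcongr
  nlinarith [sq_nonneg c]

theorem exp_neg_seventy_one_hundredths_le : Real.exp (-(71 / 100)) ≤ 197 / 400 := by
  rw [Real.exp_neg]
  have h := Real.sum_le_exp_of_nonneg (x := 71 / 100) (by norm_num) 7
  rw [inv_le_comm₀ (Real.exp_pos _) (by norm_num)]
  refine le_trans ?_ h
  norm_num [Finset.sum_range_succ, Nat.factorial]

theorem exp_neg_six_le : Real.exp (-6) ≤ 3 / 1000 := by
  rw [Real.exp_neg]
  rw [inv_le_comm₀ (Real.exp_pos _) (by norm_num)]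
  have h := Real.exp_one_gt_d9
  have h6 : Real.exp 6 = Real.exp 1 ^ 6 := by rw [← Real.exp_nat_mul]; norm_num
  rw [h6]
  calc (3 / 1000 : ℝ)⁻¹ ≤ 2.7 ^ 6 := by norm_num
    _ ≤ Real.exp 1 ^ 6 := by gcongr; linarith

theorem one_sub_exp_neg_ge : 18 / 100 ≤ 1 - Real.exp (-(1 / 5)) := by
  have h := Real.sum_le_exp_of_nonneg (x := 1 / 5) (by norm_num) 4
  have h2 : Real.exp (-(1 / 5)) ≤ 82 / 100 := by
    rw [Real.exp_neg, inv_le_comm₀ (Real.exp_pos _) (by norm_num)]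
    refine le_trans ?_ h
    norm_num [Finset.sum_range_succ, Nat.factorial]
  linarith

namespace BernoulliProduct

variable {ι : Type*} [Fintype ι] [DecidableEq ι] {p : ℝ}

theorem one_sub_exp_le_expect {f : (ι → Bool) → ℝ} {σ : ℝ}
    (hf : ∀ t, expect p (fun ω => Real.cos (t * f ω)) ≤ Real.exp (-(σ ^ 2 * (1 - Real.cos t))))
    {t y : ℝ} (hy : y ≤ σ ^ 2 * (1 - Real.cos t)) :
    1 - Real.exp (-y) ≤ expect p (fun ω => 1 - Real.cos (t * f ω)) := by
  rw [expect_sub, expect_const]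
  have := (hf t).trans (Real.exp_le_exp.2 (neg_le_neg hy))
  linarith

/-- A variable with sub-Gaussian characteristic function near the origin has first absolute
moment close to that of a Gaussian. -/
theorem three_quarters_mul_le_expect_abs (h0 : 0 ≤ p) (h1 : p ≤ 1) {f : (ι → Bool) → ℝ} {σ : ℝ}
    (hσ : 100 ≤ σ)
    (hf : ∀ t, expect p (fun ω => Real.cos (t * f ω)) ≤ Real.exp (-(σ ^ 2 * (1 - Real.cos t)))) :
    3 / 4 * σ ≤ expect p (fun ω => |f ω|) := by
  have hσ0 : 0 < σ := by linarith
  -- The scale 6/5 is a numerical choice: the loss is concentrated in the lowest frequency, where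
  -- exp(−0.71) remains, while from frequency 3 on the characteristic function is at most exp(−6).
  set h := 6 / 5 / σ with hh
  have hpos : 0 < h := by positivity
  have hm := expect_mono (ι := ι) h0 h1 (fun ω => sum_one_sub_cos_odd_le 8 (h * f ω))
  have hr : (fun ω : ι → Bool => Real.pi / 4 * |h * f ω|) =
      fun ω => Real.pi / 4 * h * |f ω| := by
    funext ω
    rw [abs_mul, abs_of_pos hpos]
    ring
  rw [hr, expect_const_mul, expect_sum] at hm
  have hl : ∀ j ∈ Finset.range 8,
      (1 - (if j = 0 then 197 / 400 else 3 / 1000)) / (2 * (j : ℝ) + 1) ^ 2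
      ≤ expect p (fun ω => (1 - Real.cos ((2 * (j : ℝ) + 1) * (h * f ω)))
        / (2 * (j : ℝ) + 1) ^ 2) := by
    intro j hj
    have hj8 : (j : ℝ) ≤ 7 := by
      have := Finset.mem_range.1 hj
      exact_mod_cast (by omega : j ≤ 7)
    have e1 : (fun ω : ι → Bool => (1 - Real.cos ((2 * (j : ℝ) + 1) * (h * f ω)))
        / (2 * (j : ℝ) + 1) ^ 2) = fun ω => (1 / (2 * (j : ℝ) + 1) ^ 2) *
          (1 - Real.cos ((2 * (j : ℝ) + 1) * h * f ω)) := by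
      funext ω
      rw [mul_assoc]
      ring
    rw [e1, expect_const_mul, div_eq_mul_one_div, mul_comm]
    gcongr
    have hb := le_sq_mul_one_sub_cos hσ (c := 2 * (j : ℝ) + 1) (by positivity) (by linarith)
    split_ifs with hj0
    · subst hj0
      have := one_sub_exp_le_expect hf hb
      norm_num at this ⊢
      have h2 := exp_neg_seventy_one_hundredths_le
      linarith
    · have hj1 : (1 : ℝ) ≤ j := by exact_mod_cast Nat.one_le_iff_ne_zero.2 hj0
      have := one_sub_exp_le_expect hf (y := 6) (le_trans (by nlinarith) hb)
      have h2 := exp_neg_six_le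
      linarith
  have hfin := (Finset.sum_le_sum hl).trans hm
  -- Eight terms suffice: 0.709/(3.1416/4 · 6/5) is about 0.752, just above 3/4.
  have hnum : (709 / 1000 : ℝ) ≤ ∑ j ∈ Finset.range 8,
      (1 - (if j = 0 then 197 / 400 else 3 / 1000)) / (2 * (j : ℝ) + 1) ^ 2 := by
    norm_num [Finset.sum_range_succ]
  have hπ := Real.pi_lt_d4
  have hE : 0 ≤ expect p (fun ω => |f ω|) := by
    have := expect_mono (ι := ι) h0 h1 (f := fun _ => 0) (fun ω => abs_nonneg (f ω))
    rwa [expect_const] at this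
  have hc : Real.pi / 4 * h * expect p (fun ω => |f ω|)
      ≤ 3.1416 / 4 * h * expect p (fun ω => |f ω|) := by gcongr
  have hfin2 := hnum.trans (hfin.trans hc)
  have hhσ : h * σ = 6 / 5 := by
    rw [hh]
    field_simp
  have h3 : 709 / 1000 * σ ≤ 3.1416 / 4 * (6 / 5) * expect p (fun ω => |f ω|) := by
    calc 709 / 1000 * σ ≤ 3.1416 / 4 * h * expect p (fun ω => |f ω|) * σ := by gcongr
      _ = 3.1416 / 4 * (h * σ) * expect p (fun ω => |f ω|) := by ring
      _ = _ := by rw [hhσ]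
  linarith

/-- A cruder bound that survives bounded variance. Test at t = 1/σ ≤ 2 < π, where 1 − cos t ≥ 2t²/π²
makes the exponent at least 2/π² ≥ 1/5, and 1 − e^{−1/5} ≥ 0.18. -/
theorem mul_le_expect_abs (h0 : 0 ≤ p) (h1 : p ≤ 1) {f : (ι → Bool) → ℝ} {σ : ℝ}
    (hσ : 1 / 2 ≤ σ)
    (hf : ∀ t, expect p (fun ω => Real.cos (t * f ω)) ≤ Real.exp (-(σ ^ 2 * (1 - Real.cos t)))) :
    18 / 100 * σ ≤ expect p (fun ω => |f ω|) := by
  have hσ0 : 0 < σ := by linarith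
  have hm := expect_mono (ι := ι) h0 h1 (fun ω => one_sub_cos_le_abs (1 / σ * f ω))
  have hr : (fun ω : ι → Bool => |1 / σ * f ω|) = fun ω => 1 / σ * |f ω| := by
    funext ω
    rw [abs_mul, abs_of_pos (by positivity)]
  rw [hr, expect_const_mul] at hm
  have hπ := Real.pi_gt_three
  have hπ2 := Real.pi_lt_d2
  have ht : 1 / σ ≤ 2 := by
    rw [div_le_iff₀ hσ0]
    linarith
  have hcos := Real.cos_le_one_sub_mul_cos_sq (x := 1 / σ)
    (by rw [abs_of_pos (by positivity)]; linarith)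
  have hy : 1 / 5 ≤ σ ^ 2 * (1 - Real.cos (1 / σ)) := by
    calc (1 / 5 : ℝ) ≤ 2 / Real.pi ^ 2 := by
          rw [div_le_div_iff₀ (by norm_num) (by positivity)]
          nlinarith
      _ = σ ^ 2 * (2 / Real.pi ^ 2 * (1 / σ) ^ 2) := by field_simp
      _ ≤ _ := by
          gcongr
          linarith
  have h2 := (one_sub_exp_neg_ge.trans (one_sub_exp_le_expect hf hy)).trans hm
  rw [one_div, inv_mul_eq_div, le_div_iff₀ hσ0] at h2
  exact h2

end BernoulliProduct

namespace Swap

variable {n : ℕ}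

/-! ### Splitting sums over edges -/

/-- The vertices `1, …, 4k`, which may be swapped. -/
def V₀ (n : ℕ) : Finset (Fin n) := Finset.univ.filter fun v => v.val < 4 * (n / 6)

/-- The vertices `4k + 1, …, 6k`. -/
def V₁ (n : ℕ) : Finset (Fin n) :=
  Finset.univ.filter fun v => 4 * (n / 6) ≤ v.val ∧ v.val < 6 * (n / 6)

/-- The pairs `u < v` of vertices. -/
def pairs (n : ℕ) : Finset (Fin n × Fin n) := Finset.univ.filter fun z => z.1 < z.2

/-- The pairs `u < v` of vertices other than those in `V₀ × V₁`. -/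
def otherPairs (n : ℕ) : Finset (Fin n × Fin n) := pairs n \ V₀ n ×ˢ V₁ n

theorem mem_V₀ {v : Fin n} : v ∈ V₀ n ↔ v.val < 4 * (n / 6) := by simp [V₀]

theorem mem_V₁ {v : Fin n} : v ∈ V₁ n ↔ 4 * (n / 6) ≤ v.val ∧ v.val < 6 * (n / 6) := by
  simp [V₁]

theorem mem_pairs {z : Fin n × Fin n} : z ∈ pairs n ↔ z.1 < z.2 := by simp [pairs]

theorem product_subset_pairs : V₀ n ×ˢ V₁ n ⊆ pairs n := by
  intro z hz
  rw [Finset.mem_product, mem_V₀, mem_V₁] at hz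
  rw [mem_pairs, Fin.lt_def]
  omega

theorem partner_mem_V₁ {v : Fin n} (hv : v ∈ V₁ n) : partner v ∈ V₁ n := by
  rw [mem_V₁] at hv ⊢
  by_cases h : v.val + 1 < n ∨ n % 2 = 0
  · rw [partner_val v h]
    split_ifs <;> omega
  · have := v.isLt
    omega

theorem lt_or_even_of_mem_V₁ {v : Fin n} (hv : v ∈ V₁ n) : v.val + 1 < n ∨ n % 2 = 0 := by
  rw [mem_V₁] at hv
  omega

theorem spin_of_mem_V₁ (G : SimpleGraph (Fin n)) {v : Fin n} (hv : v ∈ V₁ n) :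
    spin G v = parity v := spin_of_le G (mem_V₁.1 hv).1

theorem a_injective : Function.Injective (a : Fin (2 * (n / 6)) → Fin n) := fun i j h => by
  simp only [a, Fin.mk.injEq] at h
  exact Fin.ext (by omega)

theorem b_injective : Function.Injective (b : Fin (2 * (n / 6)) → Fin n) := fun i j h => by
  simp only [b, Fin.mk.injEq] at h
  exact Fin.ext (by omega)

theorem a_ne_b (i j : Fin (2 * (n / 6))) : (a i : Fin n) ≠ b j := fun h => by
  simp only [a, b, Fin.mk.injEq] at h
  omega

theorem a_mem_V₀ (i : Fin (2 * (n / 6))) : (a i : Fin n) ∈ V₀ n := by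
  rw [mem_V₀]
  simp only [a]
  omega

theorem b_mem_V₀ (i : Fin (2 * (n / 6))) : (b i : Fin n) ∈ V₀ n := by
  rw [mem_V₀]
  simp only [b]
  omega

theorem sum_V₀ (f : Fin n → ℝ) : ∑ v ∈ V₀ n, f v = ∑ i, (f (a i) + f (b i)) := by
  have h : V₀ n = Finset.univ.map ⟨a, a_injective⟩ ∪ Finset.univ.map ⟨b, b_injective⟩ := by
    ext v
    simp only [Finset.mem_union, Finset.mem_map, Finset.mem_univ, true_and,
      Function.Embedding.coeFn_mk]
    constructor
    · intro hv
      obtain ⟨i, h | h⟩ := exists_a_or_b (mem_V₀.1 hv)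
      · exact Or.inl ⟨i, h.symm⟩
      · exact Or.inr ⟨i, h.symm⟩
    · rintro (⟨i, rfl⟩ | ⟨i, rfl⟩)
      · exact a_mem_V₀ i
      · exact b_mem_V₀ i
  have hd : Disjoint (Finset.univ.map (⟨a, a_injective⟩ : Fin (2 * (n / 6)) ↪ Fin n))
      (Finset.univ.map ⟨b, b_injective⟩) := by
    rw [Finset.disjoint_left]
    intro v h1 h2
    simp only [Finset.mem_map, Finset.mem_univ, true_and, Function.Embedding.coeFn_mk] at h1 h2
    obtain ⟨i, rfl⟩ := h1
    obtain ⟨j, hj⟩ := h2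
    exact a_ne_b i j hj.symm
  rw [h, Finset.sum_union hd, Finset.sum_map, Finset.sum_map, Finset.sum_add_distrib]
  rfl

theorem spin_a_eq_neg (G : SimpleGraph (Fin n)) (i : Fin (2 * (n / 6))) :
    spin G (a i) = -spin G (b i) := by
  rw [spin_a, spin_b]
  split_ifs <;> norm_num

theorem sum_V₀_spin (G : SimpleGraph (Fin n)) : ∑ v ∈ V₀ n, spin G v = 0 := by
  rw [sum_V₀]
  exact Finset.sum_eq_zero fun i _ => by rw [spin_a_eq_neg, neg_add_cancel]

theorem card_V₁ : (V₁ n).card = 2 * (n / 6) := by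
  have h : (V₁ n).map Fin.valEmbedding = Finset.Ico (4 * (n / 6)) (6 * (n / 6)) := by
    ext v
    simp only [Finset.mem_map, mem_V₁, Fin.valEmbedding_apply, Finset.mem_Ico]
    constructor
    · rintro ⟨w, hw, rfl⟩
      exact hw
    · intro hv
      exact ⟨⟨v, by omega⟩, hv, rfl⟩
  rw [← Finset.card_map Fin.valEmbedding, h, Nat.card_Ico]
  omega

theorem edgesTo_eq_sum (G : SimpleGraph (Fin n)) (v : Fin n) (S : Finset (Fin n)) :
    (edgesTo G v S : ℝ) = ∑ w ∈ S, adj G v w := by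
  classical
  rw [edgesTo, Finset.card_filter]
  push_cast
  exact Finset.sum_congr rfl fun w _ => by
    unfold adj
    congr

theorem sum_A₁_sub_sum_B₁ (f : Fin n → ℝ) :
    ∑ w ∈ A₁ n, f w - ∑ w ∈ B₁ n, f w = ∑ w ∈ V₁ n, parity w * f w := by
  have hA : A₁ n = (V₁ n).filter fun w => w.val % 2 = 0 := by
    ext w
    simp only [A₁, V₁, label, Finset.mem_filter, Finset.mem_univ, true_and, Nat.odd_iff]
    omega
  have hB : B₁ n = (V₁ n).filter fun w => ¬ w.val % 2 = 0 := by
    ext w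
    simp only [B₁, V₁, label, Finset.mem_filter, Finset.mem_univ, true_and, Nat.even_iff]
    omega
  rw [← Finset.sum_filter_add_sum_filter_not (V₁ n) (fun w => w.val % 2 = 0), hA, hB,
    sub_eq_add_neg, ← Finset.sum_neg_distrib]
  congr 1 <;> refine Finset.sum_congr rfl fun w hw => ?_ <;>
    rw [Finset.mem_filter] at hw <;> simp [parity, hw.2]

theorem T_eq_sum (G : SimpleGraph (Fin n)) (i : Fin (2 * (n / 6))) :
    (T G i : ℝ) = ∑ w ∈ V₁ n, parity w * (adj G (b i) w - adj G (a i) w) := by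
  rw [T]
  push_cast
  simp only [edgesTo_eq_sum, mul_sub, Finset.sum_sub_distrib, ← sum_A₁_sub_sum_B₁]
  ring

/-- The gain of the algorithm: for each pair the signs ∓ on a_i and b_i turn the edges into V₁ into
s_{b_i} T_i, and the swapping rule makes s_{b_i} T_i = |T_i|. -/
theorem sum_product_spin (G : SimpleGraph (Fin n)) :
    ∑ z ∈ V₀ n ×ˢ V₁ n, spin G z.1 * spin G z.2 * adj G z.1 z.2 = ∑ i, |(T G i : ℝ)| := by
  rw [Finset.sum_product, sum_V₀]
  refine Finset.sum_congr rfl fun i _ => ?_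
  have h : |(T G i : ℝ)| = spin G (b i) * (T G i : ℝ) := by
    rw [spin_b]
    split_ifs with h
    · rw [one_mul, abs_of_pos (by exact_mod_cast h)]
    · rw [neg_one_mul, abs_of_nonpos (by exact_mod_cast not_lt.1 h)]
  rw [h, T_eq_sum, Finset.mul_sum, ← Finset.sum_add_distrib]
  refine Finset.sum_congr rfl fun w hw => ?_
  dsimp only
  rw [spin_of_mem_V₁ G hw, spin_a_eq_neg]
  ring

theorem sum_sum_eq_sum_pairs (f : Fin n → Fin n → ℝ) :
    ∑ u, ∑ v, f u v = ∑ z ∈ pairs n, (f z.1 z.2 + f z.2 z.1) + ∑ u, f u u := by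
  have h1 : ∑ z ∈ pairs n, f z.2 z.1 = ∑ u, ∑ v, if v < u then f u v else 0 := by
    rw [pairs, Finset.sum_filter, Fintype.sum_prod_type_right]
  have h2 : ∑ z ∈ pairs n, f z.1 z.2 = ∑ u, ∑ v, if u < v then f u v else 0 := by
    rw [pairs, Finset.sum_filter, Fintype.sum_prod_type]
  have h3 : ∑ u, f u u = ∑ u, ∑ v, if u = v then f u v else 0 := by simp
  rw [Finset.sum_add_distrib, h1, h2, h3]
  simp only [← Finset.sum_add_distrib]
  refine Finset.sum_congr rfl fun u _ => Finset.sum_congr rfl fun v _ => ?_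
  rcases lt_trichotomy u v with h | h | h
  · simp [h, h.ne, h.not_gt]
  · simp [h]
  · simp [h, h.ne', h.not_gt]

theorem sum_pairs_eq (f : Fin n × Fin n → ℝ) :
    ∑ z ∈ pairs n, f z = ∑ z ∈ V₀ n ×ˢ V₁ n, f z + ∑ z ∈ otherPairs n, f z := by
  rw [otherPairs, add_comm, Finset.sum_sdiff product_subset_pairs]

theorem adj_self (G : SimpleGraph (Fin n)) (u : Fin n) : adj G u u = 0 := by
  simp [adj]

theorem sum_sum_spin_mul (G : SimpleGraph (Fin n)) :
    ∑ u, ∑ v, spin G u * spin G v * adj G u v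
      = 2 * ∑ z ∈ pairs n, spin G z.1 * spin G z.2 * adj G z.1 z.2 := by
  rw [sum_sum_eq_sum_pairs, Finset.mul_sum]
  simp only [adj_self, mul_zero, Finset.sum_const_zero, add_zero]
  refine Finset.sum_congr rfl fun z _ => ?_
  rw [adj_comm G z.2 z.1]
  ring

theorem sum_sum_spin (G : SimpleGraph (Fin n)) :
    ∑ u, ∑ v, spin G u * adj G u v
      = ∑ z ∈ pairs n, (spin G z.1 + spin G z.2) * adj G z.1 z.2 := by
  rw [sum_sum_eq_sum_pairs]
  simp only [adj_self, mul_zero, Finset.sum_const_zero, add_zero]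
  refine Finset.sum_congr rfl fun z _ => ?_
  rw [adj_comm G z.2 z.1]
  ring

theorem sum_sum_adj (G : SimpleGraph (Fin n)) :
    ∑ u, ∑ v, adj G u v = 2 * ∑ z ∈ pairs n, adj G z.1 z.2 := by
  rw [sum_sum_eq_sum_pairs, Finset.mul_sum]
  simp only [adj_self, Finset.sum_const_zero, add_zero]
  refine Finset.sum_congr rfl fun z _ => ?_
  rw [adj_comm G z.2 z.1]
  ring

theorem card_pairs : (2 : ℝ) * (pairs n).card = n * (n - 1) := by
  have h := sum_sum_eq_sum_pairs (n := n) (fun _ _ => 1)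
  simp at h
  linarith

theorem card_pairs_le : ((pairs n).card : ℝ) ≤ (n : ℝ) ^ 2 / 2 := by
  have h := card_pairs (n := n)
  have : (0 : ℝ) ≤ n := Nat.cast_nonneg n
  nlinarith

/-- Expand 0 ≤ (∑ s_v)² = n + 2 ∑_{u<v} s_u s_v; the pairs in V₀ × V₁ sum to 0 because the signs on
V₀ do. -/
theorem sum_otherPairs_spin_mul (G : SimpleGraph (Fin n)) :
    -(n / 2 : ℝ) ≤ ∑ z ∈ otherPairs n, spin G z.1 * spin G z.2 := by
  have h1 := sum_pairs_eq (n := n) (fun z => spin G z.1 * spin G z.2)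
  have h2 : ∑ z ∈ V₀ n ×ˢ V₁ n, spin G z.1 * spin G z.2 = 0 := by
    rw [Finset.sum_product, ← Finset.sum_mul_sum, sum_V₀_spin, zero_mul]
  have h3 := sum_sum_eq_sum_pairs (n := n) (fun u v => spin G u * spin G v)
  rw [← Finset.sum_mul_sum] at h3
  have h4 : ∑ u : Fin n, spin G u * spin G u = n := by simp [spin_mul_self]
  have h5 : ∑ z ∈ pairs n, (spin G z.1 * spin G z.2 + spin G z.2 * spin G z.1)
      = 2 * ∑ z ∈ pairs n, spin G z.1 * spin G z.2 := by
    rw [Finset.mul_sum]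
    exact Finset.sum_congr rfl fun z _ => by ring
  rw [h4, h5] at h3
  have h6 := mul_self_nonneg (∑ u, spin G u)
  linarith

theorem sum_pairs_spin_add (G : SimpleGraph (Fin n)) :
    ∑ z ∈ pairs n, (spin G z.1 + spin G z.2) = (n - 1) * (n % 2 : ℕ) := by
  have h3 := sum_sum_eq_sum_pairs (n := n) (fun u _ => spin G u)
  rw [sum_spin] at h3
  simp only [Finset.sum_const, Finset.card_univ, Fintype.card_fin, nsmul_eq_mul] at h3
  rw [← Finset.mul_sum, sum_spin] at h3
  linarith

/-- The number of edges inside the parts minus the number of edges between them is bounded below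
in terms of centred edge indicators. -/
theorem sum_pairs_spin_mul_ge (G : SimpleGraph (Fin n)) {p : ℝ} (hp : 0 ≤ p) :
    ∑ i, |(T G i : ℝ)| + ∑ z ∈ otherPairs n, spin G z.1 * spin G z.2 * (adj G z.1 z.2 - p)
        - p * n / 2
      ≤ ∑ z ∈ pairs n, spin G z.1 * spin G z.2 * adj G z.1 z.2 := by
  rw [sum_pairs_eq, sum_product_spin]
  simp only [mul_sub, Finset.sum_sub_distrib, ← Finset.sum_mul]
  have := mul_le_mul_of_nonneg_right (sum_otherPairs_spin_mul G) hp
  linarith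

/-- The difference of the volumes of the parts in terms of centred edge indicators. -/
theorem sum_pairs_spin_add_mul (G : SimpleGraph (Fin n)) (p : ℝ) :
    ∑ z ∈ pairs n, (spin G z.1 + spin G z.2) * adj G z.1 z.2
      = ∑ z ∈ otherPairs n, (spin G z.1 + spin G z.2) * (adj G z.1 z.2 - p)
        + ∑ z ∈ V₀ n ×ˢ V₁ n, parity z.2 * (adj G z.1 z.2 - p)
        + ∑ i, spin G (b i) * ∑ w ∈ V₁ n, (adj G (b i) w - adj G (a i) w)
        + p * ((n - 1) * (n % 2 : ℕ)) := by
  have h1 : ∑ z ∈ pairs n, (spin G z.1 + spin G z.2) * adj G z.1 z.2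
      = ∑ z ∈ pairs n, (spin G z.1 + spin G z.2) * (adj G z.1 z.2 - p)
        + p * ((n - 1) * (n % 2 : ℕ)) := by
    rw [← sum_pairs_spin_add G, Finset.mul_sum, ← Finset.sum_add_distrib]
    exact Finset.sum_congr rfl fun z _ => by ring
  have h2 : ∑ z ∈ V₀ n ×ˢ V₁ n, (spin G z.1 + spin G z.2) * (adj G z.1 z.2 - p)
      = ∑ z ∈ V₀ n ×ˢ V₁ n, parity z.2 * (adj G z.1 z.2 - p)
        + ∑ i, spin G (b i) * ∑ w ∈ V₁ n, (adj G (b i) w - adj G (a i) w) := by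
    -- The centring constant p drops out of the difference, since s_{a_i} = −s_{b_i}.
    have h3 : ∑ i, spin G (b i) * ∑ w ∈ V₁ n, (adj G (b i) w - adj G (a i) w)
        = ∑ z ∈ V₀ n ×ˢ V₁ n, spin G z.1 * (adj G z.1 z.2 - p) := by
      rw [Finset.sum_product, sum_V₀]
      refine Finset.sum_congr rfl fun i _ => ?_
      rw [Finset.mul_sum, ← Finset.sum_add_distrib]
      refine Finset.sum_congr rfl fun w _ => ?_
      dsimp only
      rw [spin_a_eq_neg]
      ring
    rw [h3, ← Finset.sum_add_distrib]
    refine Finset.sum_congr rfl fun z hz => ?_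
    rw [spin_of_mem_V₁ G (Finset.mem_product.1 hz).2]
    ring
  rw [h1, sum_pairs_eq, h2]
  ring

end Swap

namespace BernoulliProduct

variable {ι : Type*} [Fintype ι] [DecidableEq ι] {p : ℝ}

/-- The second moment of a sum of centred functions of disjoint sets of coordinates. -/
theorem expect_sq_sum_of_disjoint {κ : Type*} (K : Finset κ) {E : κ → Set ι}
    (hE : ∀ x ∈ K, ∀ y ∈ K, x ≠ y → Disjoint (E x) (E y)) {f : κ → (ι → Bool) → ℝ}
    (hf : ∀ x ∈ K, DependsOn (f x) (E x)) (h0 : ∀ x ∈ K, expect p (f x) = 0) :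
    expect p (fun ω => (∑ x ∈ K, f x ω) ^ 2) = ∑ x ∈ K, expect p (fun ω => f x ω ^ 2) := by
  have h2 : ∀ ω : ι → Bool, (∑ x ∈ K, f x ω) ^ 2 = ∑ x ∈ K, ∑ y ∈ K, f x ω * f y ω :=
    fun ω => by rw [sq, Finset.sum_mul_sum]
  simp only [h2, expect_sum]
  refine Finset.sum_congr rfl fun x hx => ?_
  rw [Finset.sum_eq_single x]
  · simp only [sq]
  · intro y hy hyx
    rw [expect_mul_of_dependsOn (hf x hx) (g := f y), h0 x hx, zero_mul]
    exact fun ω ω' h => hf y hy fun e he =>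
      h e fun he' => Set.disjoint_left.1 (hE x hx y hy hyx.symm) he' he
  · exact fun h => absurd hx h

end BernoulliProduct

namespace Swap

open BernoulliProduct

variable {n : ℕ} {p : ℝ}

/-! ### Moments for the binomial random graph -/

theorem adj_graphOf (ω : Sym2 (Fin n) → Bool) {u v : Fin n} (h : u ≠ v) :
    adj (graphOf ω) u v = ind (ω s(u, v)) := by
  unfold adj ind
  simp [graphOf_adj, h]

theorem ne_of_mem {u v : Fin n} (hu : u ∈ V₀ n) (hv : v ∈ V₁ n) : u ≠ v := by
  rintro rfl
  rw [mem_V₀] at hu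
  rw [mem_V₁] at hv
  omega

theorem sym2_eq_of_mem {u u' v v' : Fin n} (hu : u ∈ V₀ n) (hv : v' ∈ V₁ n)
    (h : s(u, v) = s(u', v')) : u = u' ∧ v = v' := by
  rcases Sym2.eq_iff.1 h with h | h
  · exact h
  · exact absurd h.1 (ne_of_mem hu hv)

/-- The edges between the `i`-th pair and `V₁`. -/
def edgesAt (i : Fin (2 * (n / 6))) : Set (Sym2 (Fin n)) :=
  {e | ∃ w ∈ V₁ n, e = s(a i, w) ∨ e = s(b i, w)}

/-- The edges between `V₀` and `V₁`. -/
def edgesBetween (n : ℕ) : Set (Sym2 (Fin n)) := {e | ∃ u ∈ V₀ n, ∃ w ∈ V₁ n, e = s(u, w)}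

theorem edgesAt_subset (i : Fin (2 * (n / 6))) : edgesAt i ⊆ edgesBetween n := by
  rintro e ⟨w, hw, h | h⟩
  · exact ⟨_, a_mem_V₀ i, w, hw, h⟩
  · exact ⟨_, b_mem_V₀ i, w, hw, h⟩

theorem disjoint_edgesAt {i j : Fin (2 * (n / 6))} (hij : i ≠ j) :
    Disjoint (edgesAt i) (edgesAt j) := by
  rw [Set.disjoint_left]
  rintro e ⟨w, _, h⟩ ⟨w', hw', h'⟩
  rcases h with rfl | rfl <;> rcases h' with h' | h'
  · exact hij (a_injective (sym2_eq_of_mem (a_mem_V₀ i) hw' h').1)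
  · exact a_ne_b i j (sym2_eq_of_mem (a_mem_V₀ i) hw' h').1
  · exact a_ne_b j i (sym2_eq_of_mem (b_mem_V₀ i) hw' h').1.symm
  · exact hij (b_injective (sym2_eq_of_mem (b_mem_V₀ i) hw' h').1)

/-- The difference of the degrees of `b_i` and `a_i` into `V₁` with weights `η`. -/
noncomputable def diff (η : Fin n → ℝ) (i : Fin (2 * (n / 6))) (ω : Sym2 (Fin n) → Bool) : ℝ :=
  ∑ w ∈ V₁ n, η w * (ind (ω s(b i, w)) - ind (ω s(a i, w)))

theorem diff_eq (η : Fin n → ℝ) (i : Fin (2 * (n / 6))) (ω : Sym2 (Fin n) → Bool) :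
    diff η i ω = ∑ w ∈ V₁ n, η w * (adj (graphOf ω) (b i) w - adj (graphOf ω) (a i) w) :=
  Finset.sum_congr rfl fun w hw => by
    rw [adj_graphOf _ (ne_of_mem (a_mem_V₀ i) hw), adj_graphOf _ (ne_of_mem (b_mem_V₀ i) hw)]

theorem T_graphOf (ω : Sym2 (Fin n) → Bool) (i : Fin (2 * (n / 6))) :
    (T (graphOf ω) i : ℝ) = diff parity i ω := by
  rw [T_eq_sum, diff_eq]

theorem dependsOn_diff (η : Fin n → ℝ) (i : Fin (2 * (n / 6))) :
    DependsOn (diff η i) (edgesAt i) := fun ω ω' h =>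
  Finset.sum_congr rfl fun w hw => by
    rw [h _ ⟨w, hw, Or.inl rfl⟩, h _ ⟨w, hw, Or.inr rfl⟩]

theorem dependsOn_T (i : Fin (2 * (n / 6))) :
    DependsOn (fun ω : Sym2 (Fin n) → Bool => T (graphOf ω) i) (edgesAt i) := fun ω ω' h => by
  have := dependsOn_diff parity i h
  rw [← T_graphOf, ← T_graphOf] at this
  exact_mod_cast this

theorem dependsOn_spin_b (i : Fin (2 * (n / 6))) :
    DependsOn (fun ω : Sym2 (Fin n) → Bool => spin (graphOf ω) (b i)) (edgesAt i) :=
  fun ω ω' h => by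
    have : T (graphOf ω) i = T (graphOf ω') i := dependsOn_T i h
    simp only [spin_b, this]

/-- The reason for reserving V₁: all signs are determined by the edges between V₀ and V₁, so the
remaining edges are independent of the partition. -/
theorem dependsOn_spin (v : Fin n) :
    DependsOn (fun ω : Sym2 (Fin n) → Bool => spin (graphOf ω) v) (edgesBetween n) :=
  fun ω ω' h => by
    by_cases hv : v.val < 4 * (n / 6)
    · obtain ⟨i, rfl | rfl⟩ := exists_a_or_b hv <;>
        have := dependsOn_spin_b i (fun e he => h e (edgesAt_subset i he))
      · simp only [spin_a_eq_neg] at this ⊢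
        rw [this]
      · exact this
    · simp only [spin_of_le _ (not_lt.1 hv)]

/-- The difference is a combination of 4k distinct centred edge indicators with coefficients ±η; the
means cancel between a_i and b_i. -/
theorem expect_diff_sq_le (h0 : 0 ≤ p) (h1 : p ≤ 1) {η : Fin n → ℝ} (hη : ∀ w, η w ^ 2 ≤ 1)
    (i : Fin (2 * (n / 6))) :
    expect p (fun ω => diff η i ω ^ 2) ≤ 4 * (n / 6 : ℕ) * (p * (1 - p)) := by
  have h := expect_sq_sum_le (ι := Sym2 (Fin n)) h0 h1 (V₁ n ×ˢ (Finset.univ : Finset Bool))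
    (g := fun x => s(if x.2 then b i else a i, x.1))
    (c := fun x _ => η x.1 * (if x.2 then 1 else -1)) (B := 1) ?_ ?_ ?_
  · rw [Finset.card_product, card_V₁] at h
    have e1 : ∀ ω : Sym2 (Fin n) → Bool, ∑ x ∈ V₁ n ×ˢ (Finset.univ : Finset Bool),
        η x.1 * (if x.2 then 1 else -1) * (ind (ω s(if x.2 then b i else a i, x.1)) - p)
          = diff η i ω := by
      intro ω
      rw [Finset.sum_product, diff]
      refine Finset.sum_congr rfl fun w _ => ?_
      simp
      ring
    simp only [e1] at h
    refine h.trans (le_of_eq ?_)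
    rw [Finset.card_univ, Fintype.card_bool]
    push_cast
    ring
  · rintro ⟨w, c⟩ hx ⟨w', c'⟩ hx' h
    simp only [Finset.coe_product, Set.mem_prod, Finset.mem_coe] at hx hx'
    have hc : ∀ c : Bool, (if c then b i else a i : Fin n) ∈ V₀ n := fun c => by
      cases c
      · exact a_mem_V₀ i
      · exact b_mem_V₀ i
    obtain ⟨h1, h2⟩ := sym2_eq_of_mem (hc c) hx'.1 h
    have h3 : c = c' := by
      cases c <;> cases c'
      · rfl
      · exact absurd h1 (a_ne_b i i)
      · exact absurd h1.symm (a_ne_b i i)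
      · rfl
    exact Prod.ext h2 h3
  · exact fun x _ ω ω' _ => rfl
  · intro x _ ω
    have := hη x.1
    rcases x with ⟨w, c⟩
    cases c <;> simpa using this

theorem parity_sq (v : Fin n) : parity v ^ 2 = 1 := by rw [sq, parity_mul_self]

theorem spin_sq (G : SimpleGraph (Fin n)) (v : Fin n) : spin G v ^ 2 = 1 := by
  rw [sq, spin_mul_self]

theorem expect_T_sq_le (h0 : 0 ≤ p) (h1 : p ≤ 1) (i : Fin (2 * (n / 6))) :
    expect p (fun ω : Sym2 (Fin n) → Bool => (T (graphOf ω) i : ℝ) ^ 2)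
      ≤ 4 * (n / 6 : ℕ) * (p * (1 - p)) := by
  simp only [T_graphOf]
  exact expect_diff_sq_le h0 h1 (fun w => (parity_sq w).le) i

/-- The second moment of the centred sum of the `|T_i|`. -/
theorem expect_sum_abs_T_sq_le (h0 : 0 ≤ p) (h1 : p ≤ 1) :
    expect p (fun ω : Sym2 (Fin n) → Bool => (∑ i, (|(T (graphOf ω) i : ℝ)|
      - expect p (fun ω => |(T (graphOf ω) i : ℝ)|))) ^ 2)
        ≤ 8 * (n / 6 : ℕ) ^ 2 * (p * (1 - p)) := by
  rw [expect_sq_sum_of_disjoint _ (E := edgesAt) (fun i _ j _ h => disjoint_edgesAt h)]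
  · have : ∀ i ∈ (Finset.univ : Finset (Fin (2 * (n / 6)))),
        expect p (fun ω : Sym2 (Fin n) → Bool => (|(T (graphOf ω) i : ℝ)|
          - expect p (fun ω => |(T (graphOf ω) i : ℝ)|)) ^ 2)
            ≤ 4 * (n / 6 : ℕ) * (p * (1 - p)) := by
      intro i _
      refine le_trans ?_ (expect_T_sq_le h0 h1 i)
      set μ := expect p (fun ω => |(T (graphOf ω) i : ℝ)|) with hμ
      -- The variance of |T_i| is at most the second moment of T_i.
      have h2 : ∀ ω : Sym2 (Fin n) → Bool, (|(T (graphOf ω) i : ℝ)| - μ) ^ 2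
          = (T (graphOf ω) i : ℝ) ^ 2 - 2 * μ * |(T (graphOf ω) i : ℝ)| + μ ^ 2 := fun ω => by
        rw [sub_sq, sq_abs]
        ring
      simp only [h2, expect_add, expect_sub, expect_const_mul, expect_const]
      rw [← hμ]
      nlinarith [sq_nonneg μ]
    refine (Finset.sum_le_sum this).trans (le_of_eq ?_)
    rw [Finset.sum_const, Finset.card_univ, Fintype.card_fin, nsmul_eq_mul]
    push_cast
    ring
  · intro i _ ω ω' h
    have : T (graphOf ω) i = T (graphOf ω') i := dependsOn_T i h
    simp only [this]
  · intro i _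
    rw [expect_sub, expect_const, sub_self]

/-- Exchanging all partners preserves `T_i` and reverses the sign of the degree difference. -/
theorem diff_comp_partner {η : Fin n → ℝ} {ε : ℝ} (hη : ∀ w ∈ V₁ n, η (partner w) = ε * η w)
    (i : Fin (2 * (n / 6))) (ω : Sym2 (Fin n) → Bool) :
    diff η i (fun e => ω (Sym2.map partner e)) = -ε * diff η i ω := by
  unfold diff
  simp only [Sym2.map_mk, partner_a, partner_b, Finset.mul_sum]
  refine Finset.sum_bij (fun w _ => partner w) (fun w hw => partner_mem_V₁ hw)
    (fun w _ w' _ h => by rw [← partner_partner w, h, partner_partner])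
    (fun w hw => ⟨partner w, partner_mem_V₁ hw, partner_partner w⟩) (fun w hw => ?_)
  have h1 := hη (partner w) (partner_mem_V₁ hw)
  rw [partner_partner] at h1
  rw [h1]
  ring

theorem expect_comp_partner (f : (Sym2 (Fin n) → Bool) → ℝ) :
    expect p (fun ω => f (fun e => ω (Sym2.map partner e))) = expect p f := by
  have hinv : Function.Involutive (Sym2.map (partner : Fin n → Fin n)) := fun e => by
    rw [Sym2.map_map, show (partner ∘ partner : Fin n → Fin n) = id from
      funext partner_partner, Sym2.map_id]
    rfl
  exact expect_comp_perm hinv.toPerm f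

/-- Exchanging all partners preserves the distribution. With weights `parity` (ε = −1) it fixes T_i,
hence the sign of b_i; with weights 1 (ε = 1) it negates the degree difference. So the expectation
equals its own negative. This makes the terms centred, and the second moment of their sum is
O(n²p(1−p)). -/
theorem expect_spin_mul_diff (i : Fin (2 * (n / 6))) :
    expect p (fun ω : Sym2 (Fin n) → Bool =>
      spin (graphOf ω) (b i) * diff (fun _ => 1) i ω) = 0 := by
  have h := expect_comp_partner (p := p) (fun ω : Sym2 (Fin n) → Bool =>
      spin (graphOf ω) (b i) * diff (fun _ => 1) i ω)
  have h1 : ∀ ω : Sym2 (Fin n) → Bool,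
      spin (graphOf fun e => ω (Sym2.map partner e)) (b i) = spin (graphOf ω) (b i) := by
    intro ω
    have h2 := diff_comp_partner (η := parity) (ε := -1)
      (fun w hw => by rw [parity_partner (lt_or_even_of_mem_V₁ hw)]; ring) i ω
    rw [← T_graphOf, ← T_graphOf, neg_neg, one_mul] at h2
    have h3 : T (graphOf fun e => ω (Sym2.map partner e)) i = T (graphOf ω) i := by
      exact_mod_cast h2
    rw [spin_b, spin_b, h3]
  have h2 : ∀ ω : Sym2 (Fin n) → Bool,
      diff (fun _ => 1) i (fun e => ω (Sym2.map partner e)) = -1 * diff (fun _ => 1) i ω :=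
    fun ω => diff_comp_partner (fun w _ => by ring) i ω
  simp only [h1, h2] at h
  have h3 : ∀ ω : Sym2 (Fin n) → Bool, spin (graphOf ω) (b i) * (-1 * diff (fun _ => 1) i ω)
      = -1 * (spin (graphOf ω) (b i) * diff (fun _ => 1) i ω) := fun ω => by ring
  simp only [h3, expect_const_mul] at h
  linarith

theorem expect_sum_spin_mul_diff_sq_le (h0 : 0 ≤ p) (h1 : p ≤ 1) :
    expect p (fun ω : Sym2 (Fin n) → Bool =>
      (∑ i, spin (graphOf ω) (b i) * diff (fun _ => 1) i ω) ^ 2)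
        ≤ 8 * (n / 6 : ℕ) ^ 2 * (p * (1 - p)) := by
  rw [expect_sq_sum_of_disjoint _ (E := edgesAt) (fun i _ j _ h => disjoint_edgesAt h)]
  · have : ∀ i ∈ (Finset.univ : Finset (Fin (2 * (n / 6)))),
        expect p (fun ω : Sym2 (Fin n) → Bool =>
          (spin (graphOf ω) (b i) * diff (fun _ => 1) i ω) ^ 2)
            ≤ 4 * (n / 6 : ℕ) * (p * (1 - p)) := by
      intro i _
      simp only [mul_pow, spin_sq, one_mul]
      exact expect_diff_sq_le h0 h1 (fun _ => by norm_num) i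
    refine (Finset.sum_le_sum this).trans (le_of_eq ?_)
    rw [Finset.sum_const, Finset.card_univ, Fintype.card_fin, nsmul_eq_mul]
    push_cast
    ring
  · intro i _ ω ω' h
    have h1 := dependsOn_spin_b i h
    have h2 := dependsOn_diff (fun _ => 1) i h
    dsimp only at h1 ⊢
    rw [h1, h2]
  · exact fun i _ => expect_spin_mul_diff i

/-- A linear combination of centred edge indicators over pairs outside `V₀ × V₁`, with
coefficients determined by the signs. -/
theorem expect_otherPairs_sq_le (h0 : 0 ≤ p) (h1 : p ≤ 1) {B : ℝ} (hB0 : 0 ≤ B)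
    {c : Fin n × Fin n → (Sym2 (Fin n) → Bool) → ℝ}
    (hc : ∀ z, DependsOn (c z) (edgesBetween n)) (hB : ∀ z ω, c z ω ^ 2 ≤ B) :
    expect p (fun ω => (∑ z ∈ otherPairs n, c z ω * (adj (graphOf ω) z.1 z.2 - p)) ^ 2)
      ≤ n ^ 2 / 2 * (B * (p * (1 - p))) := by
  have hmem : ∀ z ∈ otherPairs n, z.1 < z.2 := fun z hz =>
    mem_pairs.1 (Finset.sdiff_subset hz)
  have hinj : Set.InjOn (fun z : Fin n × Fin n => s(z.1, z.2)) (otherPairs n) := by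
    intro z hz z' hz' h
    have h1 := hmem z hz
    have h2 := hmem z' hz'
    rcases Sym2.eq_iff.1 h with h | h
    · exact Prod.ext h.1 h.2
    · rw [h.1, h.2] at h1
      exact absurd h1 h2.not_gt
  have h := expect_sq_sum_le (p := p) h0 h1 (otherPairs n) hinj (c := c) (B := B) ?_
    (fun z _ ω => hB z ω)
  · have e1 : ∀ ω : Sym2 (Fin n) → Bool,
        ∑ z ∈ otherPairs n, c z ω * (adj (graphOf ω) z.1 z.2 - p)
          = ∑ z ∈ otherPairs n, c z ω * (ind (ω s(z.1, z.2)) - p) := fun ω =>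
      Finset.sum_congr rfl fun z hz => by rw [adj_graphOf _ (hmem z hz).ne]
    simp only [e1]
    refine h.trans ?_
    have hq : 0 ≤ 1 - p := by linarith
    have hcard : ((otherPairs n).card : ℝ) ≤ n ^ 2 / 2 :=
      le_trans (by exact_mod_cast Finset.card_le_card Finset.sdiff_subset) card_pairs_le
    gcongr
  · rintro z hz ω ω' hω
    -- The coefficients see only edges between V₀ and V₁, and no pair of `otherPairs` is such an
    -- edge, in either orientation.
    refine hc z fun e he => hω e ?_
    rintro ⟨z', hz', rfl⟩
    obtain ⟨u, hu, w, hw, h⟩ := he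
    have h2 := hmem z' hz'
    have h3 := (Finset.mem_sdiff.1 hz').2
    rcases Sym2.eq_iff.1 h with h | h
    · exact h3 (Finset.mem_product.2 ⟨by rw [h.1]; exact hu, by rw [h.2]; exact hw⟩)
    · rw [h.1, h.2, Fin.lt_def] at h2
      rw [mem_V₀] at hu
      rw [mem_V₁] at hw
      omega

/-- A linear combination of centred edge indicators with constant coefficients. -/
theorem expect_pairs_sq_le (h0 : 0 ≤ p) (h1 : p ≤ 1) {S : Finset (Fin n × Fin n)}
    (hS : S ⊆ pairs n) {c : Fin n × Fin n → ℝ} (hc : ∀ z, c z ^ 2 ≤ 1) :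
    expect p (fun ω => (∑ z ∈ S, c z * (adj (graphOf ω) z.1 z.2 - p)) ^ 2)
      ≤ n ^ 2 / 2 * (p * (1 - p)) := by
  have hmem : ∀ z ∈ S, z.1 < z.2 := fun z hz => mem_pairs.1 (hS hz)
  have hinj : Set.InjOn (fun z : Fin n × Fin n => s(z.1, z.2)) S := by
    intro z hz z' hz' h
    have h1 := hmem z hz
    have h2 := hmem z' hz'
    rcases Sym2.eq_iff.1 h with h | h
    · exact Prod.ext h.1 h.2
    · rw [h.1, h.2] at h1
      exact absurd h1 h2.not_gt
  have h := expect_sq_sum_le (p := p) h0 h1 S hinj (c := fun z _ => c z) (B := 1)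
    (fun _ _ _ _ _ => rfl) (fun z _ _ => hc z)
  have e1 : ∀ ω : Sym2 (Fin n) → Bool, ∑ z ∈ S, c z * (adj (graphOf ω) z.1 z.2 - p)
      = ∑ z ∈ S, c z * (ind (ω s(z.1, z.2)) - p) := fun ω =>
    Finset.sum_congr rfl fun z hz => by rw [adj_graphOf _ (hmem z hz).ne]
  simp only [e1]
  refine h.trans ?_
  have hq : 0 ≤ 1 - p := by linarith
  have hcard : (S.card : ℝ) ≤ n ^ 2 / 2 :=
    le_trans (by exact_mod_cast Finset.card_le_card hS) card_pairs_le
  rw [one_mul]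
  gcongr

end Swap

/-! ### The characteristic function of `T_i` -/

namespace Swap

open BernoulliProduct

variable {n : ℕ} {p : ℝ}

/-- One vertex of V₁ contributes its edges to b_i and a_i with opposite signs. The two factors are
complex conjugates, with product p² + (1−p)² + 2p(1−p) cos θ. -/
theorem charFun_factor (p θ : ℝ) :
    ((p : ℂ) * Complex.exp (θ * Complex.I) + ((1 - p : ℝ) : ℂ)) *
      ((p : ℂ) * Complex.exp (-θ * Complex.I) + ((1 - p : ℝ) : ℂ))
      = ((1 - 2 * (p * (1 - p)) * (1 - Real.cos θ) : ℝ) : ℂ) := by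
  rw [Complex.exp_mul_I, Complex.exp_mul_I, Complex.cos_neg, Complex.sin_neg]
  push_cast
  have h := Complex.sin_sq_add_cos_sq (θ : ℂ)
  linear_combination (p : ℂ) ^ 2 * h - (p : ℂ) ^ 2 * Complex.sin θ ^ 2 * (Complex.I_sq)

/-- The characteristic function of `T_i`. -/
theorem expect_cos_T (i : Fin (2 * (n / 6))) (t : ℝ) :
    expect p (fun ω : Sym2 (Fin n) → Bool => Real.cos (t * T (graphOf ω) i))
      = (1 - 2 * (p * (1 - p)) * (1 - Real.cos t)) ^ (2 * (n / 6)) := by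
  have hV : ∀ c : Bool, (if c then b i else a i : Fin n) ∈ V₀ n := fun c => by
    cases c
    · exact a_mem_V₀ i
    · exact b_mem_V₀ i
  let g : {w // w ∈ V₁ n} × Bool → Sym2 (Fin n) := fun x => s(if x.2 then b i else a i, x.1.1)
  have hg : Function.Injective g := by
    rintro ⟨w, c⟩ ⟨w', c'⟩ h
    obtain ⟨h1, h2⟩ := sym2_eq_of_mem (hV c) w'.2 h
    have h3 : c = c' := by
      cases c <;> cases c'
      · rfl
      · exact absurd h1 (a_ne_b i i)
      · exact absurd h1.symm (a_ne_b i i)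
      · rfl
    exact Prod.ext (Subtype.ext h2) h3
  let f : {w // w ∈ V₁ n} × Bool → Bool → ℂ := fun x β =>
    Complex.exp ((t * parity x.1.1 * (if x.2 then 1 else -1) * ind β : ℝ) * Complex.I)
  have h := sum_prod_mass_mul_of_injective (p := p) (R := ℂ) hg f
  have h1 : ∀ ω : Sym2 (Fin n) → Bool, ∏ x, f x (ω (g x))
      = Complex.exp ((t * T (graphOf ω) i : ℝ) * Complex.I) := by
    intro ω
    have hs : ∑ x : {w // w ∈ V₁ n} × Bool,
        t * parity x.1.1 * (if x.2 then 1 else -1) * ind (ω (g x)) = t * T (graphOf ω) i := by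
      rw [Fintype.sum_prod_type, T_graphOf, diff, Finset.mul_sum, ← Finset.sum_coe_sort (V₁ n)]
      refine Finset.sum_congr rfl fun w _ => ?_
      simp [g]
      ring
    simp only [f]
    rw [← Complex.exp_sum, ← Finset.sum_mul, ← Complex.ofReal_sum, hs]
  have h2 : ∏ x, (algebraMap ℝ ℂ p * f x true + algebraMap ℝ ℂ (1 - p) * f x false)
      = (((1 - 2 * (p * (1 - p)) * (1 - Real.cos t)) ^ (2 * (n / 6)) : ℝ) : ℂ) := by
    rw [Fintype.prod_prod_type]
    have : ∀ w : {w // w ∈ V₁ n}, ∏ c : Bool,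
        (algebraMap ℝ ℂ p * f (w, c) true + algebraMap ℝ ℂ (1 - p) * f (w, c) false)
          = ((1 - 2 * (p * (1 - p)) * (1 - Real.cos t) : ℝ) : ℂ) := by
      intro w
      -- The factor depends on its argument only through the cosine, so the weight ±1 of w is
      -- irrelevant.
      have hc : Real.cos t = Real.cos (t * parity w.1) := by
        unfold parity
        split_ifs
        · rw [mul_one]
        · rw [mul_neg_one, Real.cos_neg]
      rw [hc, ← charFun_factor, Fintype.prod_bool]
      simp [f, ind]
    simp only [this, Finset.prod_const, Finset.card_univ, Fintype.card_coe, card_V₁]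
    push_cast
    rfl
  rw [h2] at h
  simp only [h1] at h
  have h3 := congrArg Complex.re h
  rw [Complex.ofReal_re, Complex.re_sum] at h3
  rw [← h3]
  refine Finset.sum_congr rfl fun ω _ => ?_
  rw [Complex.coe_algebraMap, Complex.re_ofReal_mul, Complex.exp_ofReal_mul_I_re]

/-- Apply 1 − x ≤ e^{−x} to each of the 2k factors; the base is nonnegative because p(1−p) ≤ 1/4. -/
theorem expect_cos_T_le (h0 : 0 ≤ p) (h1 : p ≤ 1) (i : Fin (2 * (n / 6))) (t : ℝ) :
    expect p (fun ω : Sym2 (Fin n) → Bool => Real.cos (t * T (graphOf ω) i))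
      ≤ Real.exp (-(Real.sqrt (4 * (n / 6 : ℕ) * (p * (1 - p))) ^ 2 * (1 - Real.cos t))) := by
  have hq : 0 ≤ 1 - p := by linarith
  rw [expect_cos_T, Real.sq_sqrt (by positivity)]
  have hc := Real.neg_one_le_cos t
  have hc1 := Real.cos_le_one t
  have hpq : p * (1 - p) ≤ 1 / 4 := by nlinarith [sq_nonneg (p - 1 / 2)]
  have hpq0 : 0 ≤ p * (1 - p) := by positivity
  have hb : 0 ≤ 1 - 2 * (p * (1 - p)) * (1 - Real.cos t) := by nlinarith
  have he : 1 - 2 * (p * (1 - p)) * (1 - Real.cos t)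
      ≤ Real.exp (-(2 * (p * (1 - p)) * (1 - Real.cos t))) := by
    linarith [Real.add_one_le_exp (-(2 * (p * (1 - p)) * (1 - Real.cos t)))]
  refine (pow_le_pow_left₀ hb he _).trans (le_of_eq ?_)
  rw [← Real.exp_nat_mul]
  congr 1
  push_cast
  ring

end Swap

namespace Swap

open BernoulliProduct

variable {n : ℕ} {p : ℝ}

/-! ### Large modularity with high probability -/

/-- The order of magnitude `n (n p (1 - p))^{1/2}` of the gain achieved by swapping. -/
noncomputable def gain (n : ℕ) (p : ℝ) : ℝ := n * Real.sqrt (n * (p * (1 - p)))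

theorem half_le_mul_mul_one_sub (h0 : 0 ≤ p) (h1 : p ≤ 1) (hp : 1 ≤ n * p)
    (hq : 10 ^ 8 ≤ n * (1 - p)) : 1 / 2 ≤ n * (p * (1 - p)) := by
  rcases le_total p (1 / 2) with h | h
  · nlinarith
  · nlinarith

theorem sq_gain (h0 : 0 ≤ p) (h1 : p ≤ 1) : gain n p ^ 2 = n ^ 3 * (p * (1 - p)) := by
  have hq : 0 ≤ 1 - p := by linarith
  rw [gain, mul_pow, Real.sq_sqrt (by positivity)]
  ring

theorem gain_nonneg : 0 ≤ gain n p := by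
  unfold gain
  positivity

/-- Needed for the volume term, whose expected contribution is bounded: the gain must be at least of
order n. -/
theorem half_mul_le_gain (h0 : 0 ≤ p) (h1 : p ≤ 1) (hp : 1 ≤ n * p)
    (hq : 10 ^ 8 ≤ n * (1 - p)) : (n : ℝ) / 2 ≤ gain n p := by
  have h := half_le_mul_mul_one_sub h0 h1 hp hq
  have h2 : (1 / 2 : ℝ) ≤ Real.sqrt (n * (p * (1 - p))) := by
    apply Real.le_sqrt_of_sq_le
    linarith
  have hn : (0 : ℝ) ≤ n := Nat.cast_nonneg n
  rw [gain]
  nlinarith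

/-- The place that fixes the size of c₀ at the dense end: n(1−p) ≥ 10⁸ gives np(1−p) ≥ (10⁴p)², so
the mean contribution of the other pairs is negligible. -/
theorem mul_le_gain (h0 : 0 ≤ p) (h1 : p ≤ 1) (hq : 10 ^ 8 ≤ n * (1 - p)) :
    p * n ≤ 1 / 10000 * gain n p := by
  have h2 : 10 ^ 4 * p ≤ Real.sqrt (n * (p * (1 - p))) := by
    apply Real.le_sqrt_of_sq_le
    nlinarith
  have hn : (0 : ℝ) ≤ n := Nat.cast_nonneg n
  rw [gain]
  nlinarith

/-- With k ≈ n/6 the ratio tends to (1/3)(2/3)^{1/2} ≈ 0.2722. The factor 9999/10000 absorbs the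
floor, and 0.8163 is just below (2/3)^{1/2}. -/
theorem third_mul_sqrt_ge (hn : 10 ^ 5 ≤ n) (h0 : 0 ≤ p) (h1 : p ≤ 1) :
    2719 / 10000 * gain n p
      ≤ 2 * (n / 6 : ℕ) * Real.sqrt (4 * (n / 6 : ℕ) * (p * (1 - p))) := by
  have hq : 0 ≤ 1 - p := by linarith
  have hk : (n : ℝ) * (9999 / 60000) ≤ (n / 6 : ℕ) := by
    have h1 : n ≤ 6 * (n / 6) + 5 := by omega
    have h2 : (n : ℝ) ≤ 6 * (n / 6 : ℕ) + 5 := by exact_mod_cast h1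
    have h3 : (10 ^ 5 : ℝ) ≤ n := by exact_mod_cast hn
    linarith
  have hs : 8163 / 10000 * Real.sqrt (n * (p * (1 - p)))
      ≤ Real.sqrt (4 * (n / 6 : ℕ) * (p * (1 - p))) := by
    apply Real.le_sqrt_of_sq_le
    rw [mul_pow, Real.sq_sqrt (by positivity)]
    have : 0 ≤ p * (1 - p) := by positivity
    nlinarith
  calc 2719 / 10000 * gain n p
      ≤ 2 * ((n : ℝ) * (9999 / 60000)) * (8163 / 10000 * Real.sqrt (n * (p * (1 - p)))) := by
        rw [gain]
        have : 0 ≤ (n : ℝ) * Real.sqrt (n * (p * (1 - p))) := by positivity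
        nlinarith
    _ ≤ _ := by gcongr

/-- A lower bound for the modularity score of the output of Swap for graphs whose edge statistics
are typical. -/
theorem modularityScore_ge (hn : 10 ^ 5 ≤ n) (h0 : 0 ≤ p) (h1 : p ≤ 1) (hp : 1 ≤ n * p)
    (hq : 10 ^ 8 ≤ n * (1 - p)) (G : SimpleGraph (Fin n)) {β : ℝ} (hβ : 18 / 100 ≤ β)
    {μ : Fin (2 * (n / 6)) → ℝ}
    (hμ : ∀ i, β * Real.sqrt (4 * (n / 6 : ℕ) * (p * (1 - p))) ≤ μ i)
    (hX : |∑ z ∈ pairs n, (adj G z.1 z.2 - p)| < 1 / 10000 * (p * n ^ 2))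
    (hT : |∑ i, (|(T G i : ℝ)| - μ i)| < 1 / 10000 * gain n p)
    (hO : |∑ z ∈ otherPairs n, spin G z.1 * spin G z.2 * (adj G z.1 z.2 - p)|
      < 1 / 10000 * gain n p)
    (hD : (∑ z ∈ pairs n, (spin G z.1 + spin G z.2) * adj G z.1 z.2) ^ 2
      < 1 / 10000 * (p * n ^ 2) * gain n p) :
    4 / 15 * β * Real.sqrt ((1 - p) / (n * p)) ≤ modularityScore G (partition G) := by
  have hn5 : (10 ^ 5 : ℝ) ≤ n := by exact_mod_cast hn
  have hn0 : (0 : ℝ) < n := by linarith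
  have hp0 : 0 < p := by
    rcases h0.lt_or_eq with h | h
    · exact h
    · rw [← h] at hp
      norm_num at hp
  have hq0 : 0 ≤ 1 - p := by linarith
  rw [modularityScore_partition (by omega) G rfl, sum_sum_spin_mul, sum_sum_spin, sum_sum_adj]
  set Λ := gain n p with hΛ
  have hΛ0 : 0 ≤ Λ := gain_nonneg
  set R := p * (n : ℝ) ^ 2 with hR
  have hR0 : 0 < R := by positivity
  set M := 2 * ∑ z ∈ pairs n, adj G z.1 z.2 with hM
  set S := ∑ z ∈ pairs n, spin G z.1 * spin G z.2 * adj G z.1 z.2 with hS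
  set D := ∑ z ∈ pairs n, (spin G z.1 + spin G z.2) * adj G z.1 z.2 with hDdef
  have hM1 : M = 2 * ∑ z ∈ pairs n, (adj G z.1 z.2 - p) + (R - p * n) := by
    rw [Finset.sum_sub_distrib, Finset.sum_const, nsmul_eq_mul, hM, hR]
    linear_combination p * card_pairs (n := n)
  obtain ⟨hX1, hX2⟩ := abs_lt.1 hX
  have hpn : p * n ≤ 1 / 10000 * R := by
    rw [hR]
    have : 0 ≤ p * n := by positivity
    nlinarith
  have hpn0 : 0 ≤ p * n := by positivity
  have hMu : M ≤ 10002 / 10000 * R := by linarith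
  have hMl : 1 / 2 * R ≤ M := by linarith
  have hM0 : 0 < M := by linarith
  have hDM : D ^ 2 / M ≤ 2 / 10000 * Λ := by
    rw [div_le_iff₀ hM0]
    nlinarith
  -- The losses are 1/10000 each from `hT` and `hO`, and 1/20000 from the mean term pn/2.
  have hSl : 2 * (2719 / 10000 * β - 2 / 10000 - 1 / 20000) * Λ ≤ 2 * S := by
    have h6 := sum_pairs_spin_mul_ge G h0
    have h2 := (abs_lt.1 hO).1
    have h3 := (abs_lt.1 hT).1
    rw [Finset.sum_sub_distrib] at h3
    have h4 : β * (2719 / 10000 * Λ) ≤ ∑ i, μ i := by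
      calc β * (2719 / 10000 * Λ)
          ≤ β * (2 * (n / 6 : ℕ) * Real.sqrt (4 * (n / 6 : ℕ) * (p * (1 - p)))) := by
            have := third_mul_sqrt_ge hn h0 h1
            gcongr
        _ = ∑ _i : Fin (2 * (n / 6)), β * Real.sqrt (4 * (n / 6 : ℕ) * (p * (1 - p))) := by
            rw [Finset.sum_const, Finset.card_univ, Fintype.card_fin, nsmul_eq_mul]
            push_cast
            ring
        _ ≤ ∑ i, μ i := Finset.sum_le_sum fun i _ => hμ i
    have h5 := mul_le_gain h0 h1 hq
    rw [← hS] at h6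
    rw [← hΛ] at h5
    linarith
  -- The total loss is 7Λ/10000. It fits into the gap between 2 · 0.2719 β and 2 · 1.0002 · (4/15)
  -- β, about 0.01 β, because β ≥ 0.18.
  have hfin : 2 * (10002 / 10000) * (4 / 15 * β) * Λ ≤ 2 * S - D ^ 2 / M := by
    have : 2 * (10002 / 10000) * (4 / 15 * β) * Λ
        ≤ (2 * (2719 / 10000 * β - 2 / 10000 - 1 / 20000) - 2 / 10000) * Λ := by
      gcongr
      linarith
    linarith
  have hsqrt : Real.sqrt ((1 - p) / (n * p)) = Λ / R := by
    rw [hΛ, gain, hR]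
    have : (1 - p) / (n * p) = n * (p * (1 - p)) / (n * p) ^ 2 := by field_simp
    rw [this, Real.sqrt_div' _ (by positivity), Real.sqrt_sq (by positivity)]
    field_simp
  rw [hsqrt, one_div, inv_mul_eq_div, le_div_iff₀ (by positivity)]
  calc 4 / 15 * β * (Λ / R) * (2 * M)
      ≤ 4 / 15 * β * (Λ / R) * (2 * (10002 / 10000 * R)) := by gcongr
    _ = 2 * (10002 / 10000) * (4 / 15 * β) * Λ := by field_simp
    _ ≤ _ := hfin

/-- The second moment of the difference of the volumes of the two parts. -/
theorem expect_volume_sq_le (h0 : 0 ≤ p) (h1 : p ≤ 1) :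
    expect p (fun ω : Sym2 (Fin n) → Bool =>
      (∑ z ∈ pairs n, (spin (graphOf ω) z.1 + spin (graphOf ω) z.2)
        * adj (graphOf ω) z.1 z.2) ^ 2) ≤ 16 * (p * n ^ 2) := by
  have hq : 0 ≤ 1 - p := by linarith
  have e1 := expect_otherPairs_sq_le (n := n) h0 h1 (B := 4) (by norm_num)
    (c := fun z ω => spin (graphOf ω) z.1 + spin (graphOf ω) z.2)
    (fun z ω ω' h => congrArg₂ (· + ·) (dependsOn_spin z.1 h) (dependsOn_spin z.2 h))
    (fun z ω => by
      have h1 := spin_sq (graphOf ω) z.1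
      have h2 := spin_sq (graphOf ω) z.2
      nlinarith [sq_nonneg (spin (graphOf ω) z.1 - spin (graphOf ω) z.2)])
  have e2 := expect_pairs_sq_le (n := n) h0 h1 product_subset_pairs (c := fun z => parity z.2)
    (fun z => (parity_sq z.2).le)
  have e3 := expect_sum_spin_mul_diff_sq_le (n := n) h0 h1
  have hk : 8 * ((n / 6 : ℕ) : ℝ) ^ 2 ≤ (n : ℝ) ^ 2 / 2 := by
    have : ((n / 6 : ℕ) : ℝ) ≤ n / 6 := Nat.cast_div_le
    have h0 : (0 : ℝ) ≤ (n / 6 : ℕ) := Nat.cast_nonneg _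
    nlinarith
  have hpq : 0 ≤ p * (1 - p) := by positivity
  -- (x + y + u + v)² ≤ 4(x² + y² + u² + v²), where v is the deterministic imbalance caused by odd
  -- n.
  have hpt : ∀ ω : Sym2 (Fin n) → Bool,
      (∑ z ∈ pairs n, (spin (graphOf ω) z.1 + spin (graphOf ω) z.2)
        * adj (graphOf ω) z.1 z.2) ^ 2
      ≤ 4 * (∑ z ∈ otherPairs n, (spin (graphOf ω) z.1 + spin (graphOf ω) z.2)
          * (adj (graphOf ω) z.1 z.2 - p)) ^ 2
        + 4 * (∑ z ∈ V₀ n ×ˢ V₁ n, parity z.2 * (adj (graphOf ω) z.1 z.2 - p)) ^ 2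
        + 4 * (∑ i, spin (graphOf ω) (b i) * diff (fun _ => 1) i ω) ^ 2
        + 4 * (p ^ 2 * n ^ 2) := by
    intro ω
    have hdiff : ∀ i : Fin (2 * (n / 6)), ∑ w ∈ V₁ n,
        (adj (graphOf ω) (b i) w - adj (graphOf ω) (a i) w) = diff (fun _ => 1) i ω :=
      fun i => by simp only [diff_eq, one_mul]
    rw [sum_pairs_spin_add_mul (graphOf ω) p]
    simp only [hdiff]
    set x := ∑ z ∈ otherPairs n, (spin (graphOf ω) z.1 + spin (graphOf ω) z.2)
      * (adj (graphOf ω) z.1 z.2 - p)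
    set y := ∑ z ∈ V₀ n ×ˢ V₁ n, parity z.2 * (adj (graphOf ω) z.1 z.2 - p)
    set u := ∑ i, spin (graphOf ω) (b i) * diff (fun _ => 1) i ω
    set v := p * (((n : ℝ) - 1) * (n % 2 : ℕ))
    have hv : v ^ 2 ≤ p ^ 2 * n ^ 2 := by
      simp only [v]
      rcases Nat.mod_two_eq_zero_or_one n with h | h
      · rw [h, Nat.cast_zero, mul_zero, mul_zero, zero_pow two_ne_zero]
        positivity
      · rw [h, mul_pow]
        have hn1 : (1 : ℝ) ≤ n := by exact_mod_cast (by omega : 1 ≤ n)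
        have : ((n : ℝ) - 1) * ((1 : ℕ) : ℝ) ≤ n := by
          push_cast
          linarith
        have h0 : 0 ≤ ((n : ℝ) - 1) * ((1 : ℕ) : ℝ) := by
          push_cast
          linarith
        gcongr
    nlinarith [sq_nonneg (x - y), sq_nonneg (x - u), sq_nonneg (x - v), sq_nonneg (y - u),
      sq_nonneg (y - v), sq_nonneg (u - v)]
  refine (expect_mono h0 h1 hpt).trans ?_
  simp only [expect_add, expect_const_mul, expect_const]
  have h8 := mul_le_mul_of_nonneg_right hk hpq
  have hpp : p * (1 - p) * n ^ 2 + p ^ 2 * n ^ 2 = p * n ^ 2 := by ring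
  have hn2 : 0 ≤ p ^ 2 * (n : ℝ) ^ 2 := by positivity
  nlinarith

/-- Swap achieves large modularity with probability `1 - O(1/n)`, provided the statistics `T_i`
have first absolute moments of the order of their standard deviation. -/
theorem binomialRandom_real_le (hn : 10 ^ 5 ≤ n) (p : unitInterval) (hp : 1 ≤ (n : ℝ) * p)
    (hq : 10 ^ 8 ≤ (n : ℝ) * (1 - p)) {β : ℝ} (hβ : 18 / 100 ≤ β)
    (hμ : ∀ i : Fin (2 * (n / 6)), β * Real.sqrt (4 * (n / 6 : ℕ) * (p * (1 - p)))
      ≤ expect (p : ℝ) (fun ω : Sym2 (Fin n) → Bool => |(T (graphOf ω) i : ℝ)|)) :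
    (SimpleGraph.binomialRandom (Fin n) p).real
      {G | ¬ 4 / 15 * β * Real.sqrt ((1 - (p : ℝ)) / ((n : ℝ) * p))
        ≤ modularityScore G (partition G)} ≤ 10 ^ 9 / n := by
  classical
  have h0 : 0 ≤ (p : ℝ) := p.2.1
  have h1 : (p : ℝ) ≤ 1 := p.2.2
  have hn5 : (10 ^ 5 : ℝ) ≤ n := by exact_mod_cast hn
  have hn0 : (0 : ℝ) < n := by linarith
  have hp0 : 0 < (p : ℝ) := by
    rcases h0.lt_or_eq with h | h
    · exact h
    · rw [← h] at hp
      norm_num at hp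
  have hq0 : 0 < 1 - (p : ℝ) := by
    by_contra h
    nlinarith
  have hg := half_mul_le_gain h0 h1 hp hq
  have hgpos : 0 < gain n p := by linarith
  have hgsq := sq_gain (n := n) h0 h1
  set Λ := gain n p with hΛ
  let X : (Sym2 (Fin n) → Bool) → ℝ := fun ω => ∑ z ∈ pairs n, (adj (graphOf ω) z.1 z.2 - p)
  let Y : (Sym2 (Fin n) → Bool) → ℝ := fun ω => ∑ i, (|(T (graphOf ω) i : ℝ)|
    - expect (p : ℝ) (fun ω => |(T (graphOf ω) i : ℝ)|))
  let Z : (Sym2 (Fin n) → Bool) → ℝ := fun ω => ∑ z ∈ otherPairs n,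
    spin (graphOf ω) z.1 * spin (graphOf ω) z.2 * (adj (graphOf ω) z.1 z.2 - p)
  let D : (Sym2 (Fin n) → Bool) → ℝ := fun ω => ∑ z ∈ pairs n,
    (spin (graphOf ω) z.1 + spin (graphOf ω) z.2) * adj (graphOf ω) z.1 z.2
  have eX : expect (p : ℝ) (fun ω => X ω ^ 2) ≤ n ^ 2 / 2 * (p * (1 - p)) := by
    have := expect_pairs_sq_le (n := n) h0 h1 (Finset.Subset.refl _) (c := fun _ => 1)
      (fun _ => by norm_num)
    simpa only [one_mul] using this
  have eY : expect (p : ℝ) (fun ω => Y ω ^ 2) ≤ n ^ 2 / 2 * (p * (1 - p)) := by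
    refine (expect_sum_abs_T_sq_le h0 h1).trans ?_
    have hk : 8 * ((n / 6 : ℕ) : ℝ) ^ 2 ≤ (n : ℝ) ^ 2 / 2 := by
      have : ((n / 6 : ℕ) : ℝ) ≤ n / 6 := Nat.cast_div_le
      have h0 : (0 : ℝ) ≤ (n / 6 : ℕ) := Nat.cast_nonneg _
      nlinarith
    gcongr
  have eZ : expect (p : ℝ) (fun ω => Z ω ^ 2) ≤ n ^ 2 / 2 * (p * (1 - p)) := by
    have := expect_otherPairs_sq_le (n := n) h0 h1 (B := 1) (by norm_num)
      (c := fun z ω => spin (graphOf ω) z.1 * spin (graphOf ω) z.2)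
      (fun z ω ω' h => congrArg₂ (· * ·) (dependsOn_spin z.1 h) (dependsOn_spin z.2 h))
      (fun z ω => by rw [mul_pow, spin_sq, spin_sq, one_mul])
    simpa only [one_mul] using this
  have eD : expect (p : ℝ) (fun ω => D ω ^ 2) ≤ 16 * (p * n ^ 2) := expect_volume_sq_le h0 h1
  have hsq : ∀ {x t : ℝ}, 0 ≤ t → t ≤ |x| → t ^ 2 ≤ x ^ 2 := fun {x t} ht hx => by
    rw [← sq_abs x]
    gcongr
  have bX := expect_indicator_le h0 h1 (fun ω => 1 / 10000 * ((p : ℝ) * (n : ℝ) ^ 2) ≤ |X ω|)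
    (fun ω => sq_nonneg (X ω)) (t := (1 / 10000 * (p * n ^ 2)) ^ 2) (by positivity)
    (fun ω h => hsq (by positivity) h)
  have bY := expect_indicator_le h0 h1 (fun ω => 1 / 10000 * Λ ≤ |Y ω|)
    (fun ω => sq_nonneg (Y ω)) (t := (1 / 10000 * Λ) ^ 2) (by positivity)
    (fun ω h => hsq (by positivity) h)
  have bZ := expect_indicator_le h0 h1 (fun ω => 1 / 10000 * Λ ≤ |Z ω|)
    (fun ω => sq_nonneg (Z ω)) (t := (1 / 10000 * Λ) ^ 2) (by positivity)
    (fun ω h => hsq (by positivity) h)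
  have bD := expect_indicator_le h0 h1 (fun ω => 1 / 10000 * ((p : ℝ) * (n : ℝ) ^ 2) * Λ ≤ D ω ^ 2)
    (fun ω => sq_nonneg (D ω)) (t := 1 / 10000 * (p * n ^ 2) * Λ) (by positivity)
    (fun ω h => h)
  -- Here np ≥ 1 is what makes the edge count concentrate: the ratio is at most 10⁸/(pn²).
  have cX : expect (p : ℝ) (fun ω => X ω ^ 2) / (1 / 10000 * (p * n ^ 2)) ^ 2
      ≤ 10 ^ 8 / n := by
    rw [div_le_div_iff₀ (by positivity) hn0]
    calc expect (p : ℝ) (fun ω => X ω ^ 2) * n ≤ n ^ 2 / 2 * (p * (1 - p)) * n := by gcongr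
      _ ≤ n ^ 2 * (p * 1) * n := by
          gcongr
          · exact half_le_self (by positivity)
          · linarith
      _ = n ^ 3 * p * 1 := by ring
      _ ≤ n ^ 3 * p * (n * p) := by gcongr
      _ = 10 ^ 8 * (1 / 10000 * (p * n ^ 2)) ^ 2 := by ring
  have cΛ : ∀ {x : ℝ}, x ≤ n ^ 2 / 2 * (p * (1 - p)) → x / (1 / 10000 * Λ) ^ 2 ≤ 10 ^ 8 / n := by
    intro x hx
    rw [div_le_div_iff₀ (by positivity) hn0, mul_pow, hgsq]
    calc x * n ≤ n ^ 2 / 2 * (p * (1 - p)) * n := by gcongr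
      _ ≤ n ^ 2 * (p * (1 - p)) * n := by
          gcongr
          exact half_le_self (by positivity)
      _ = _ := by ring
  -- The factor pn² cancels, and the remaining 1/Λ is O(1/n).
  have cD : expect (p : ℝ) (fun ω => D ω ^ 2) / (1 / 10000 * (p * n ^ 2) * Λ) ≤ 10 ^ 8 / n := by
    rw [div_le_div_iff₀ (by positivity) hn0]
    calc expect (p : ℝ) (fun ω => D ω ^ 2) * n ≤ 16 * (p * n ^ 2) * n := by gcongr
      _ ≤ 10 ^ 8 * (1 / 10000 * (p * n ^ 2) * (n / 2)) := by
          have : 0 ≤ p * (n : ℝ) ^ 2 * n := by positivity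
          nlinarith
      _ ≤ _ := by gcongr
  have hpt : ∀ ω : Sym2 (Fin n) → Bool,
      (if ¬ 4 / 15 * β * Real.sqrt ((1 - (p : ℝ)) / ((n : ℝ) * p))
        ≤ modularityScore (graphOf ω) (partition (graphOf ω)) then (1 : ℝ) else 0)
      ≤ (if 1 / 10000 * ((p : ℝ) * (n : ℝ) ^ 2) ≤ |X ω| then 1 else 0)
        + (if 1 / 10000 * Λ ≤ |Y ω| then 1 else 0) + (if 1 / 10000 * Λ ≤ |Z ω| then 1 else 0)
        + (if 1 / 10000 * ((p : ℝ) * (n : ℝ) ^ 2) * Λ ≤ D ω ^ 2 then 1 else 0) := by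
    intro ω
    by_cases hX : 1 / 10000 * ((p : ℝ) * (n : ℝ) ^ 2) ≤ |X ω|
    · rw [if_pos hX]
      split_ifs <;> norm_num
    by_cases hY : 1 / 10000 * Λ ≤ |Y ω|
    · rw [if_pos hY]
      split_ifs <;> norm_num
    by_cases hZ : 1 / 10000 * Λ ≤ |Z ω|
    · rw [if_pos hZ]
      split_ifs <;> norm_num
    by_cases hD : 1 / 10000 * ((p : ℝ) * (n : ℝ) ^ 2) * Λ ≤ D ω ^ 2
    · rw [if_pos hD]
      split_ifs <;> norm_num
    have := modularityScore_ge hn h0 h1 hp hq (graphOf ω) hβ hμ (not_le.1 hX) (not_le.1 hY)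
      (not_le.1 hZ) (not_le.1 hD)
    rw [if_neg (not_not.2 this)]
    positivity
  rw [binomialRandom_real]
  refine le_trans (le_of_eq (by congr!)) ((expect_mono h0 h1 hpt).trans ?_)
  simp only [expect_add]
  have h9 : (10 : ℝ) ^ 9 / n = 10 ^ 8 / n * 10 := by ring
  have h10 : (0 : ℝ) ≤ 10 ^ 8 / n := by positivity
  have := cΛ eY
  have := cΛ eZ
  linarith

end Swap

/-! ### The two ranges of p and the limit -/

namespace Swap

open BernoulliProduct

variable {n : ℕ} {p : ℝ}

theorem half_mul_le_four_mul (hn : 10 ^ 5 ≤ n) : (n : ℝ) / 2 ≤ 4 * (n / 6 : ℕ) := by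
  have h1 : n ≤ 2 * (4 * (n / 6)) := by omega
  have h2 : (n : ℝ) ≤ 2 * (4 * (n / 6 : ℕ)) := by exact_mod_cast h1
  linarith

theorem half_le_sqrt (hn : 10 ^ 5 ≤ n) (h0 : 0 ≤ p) (h1 : p ≤ 1) (hp : 1 ≤ n * p)
    (hq : 10 ^ 8 ≤ n * (1 - p)) :
    1 / 2 ≤ Real.sqrt (4 * (n / 6 : ℕ) * (p * (1 - p))) := by
  apply Real.le_sqrt_of_sq_le
  have h := half_le_mul_mul_one_sub h0 h1 hp hq
  have hpq : 0 ≤ p * (1 - p) := mul_nonneg h0 (by linarith)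
  have := mul_le_mul_of_nonneg_right (half_mul_le_four_mul hn) hpq
  linarith

/-- Since 4k ≥ n/2 and one of p, 1−p is at least 1/2, the variance is at least 10⁸/4, well above
100². -/
theorem hundred_le_sqrt (hn : 10 ^ 5 ≤ n) (h0 : 0 ≤ p) (h1 : p ≤ 1) (hp : 10 ^ 8 ≤ n * p)
    (hq : 10 ^ 8 ≤ n * (1 - p)) :
    100 ≤ Real.sqrt (4 * (n / 6 : ℕ) * (p * (1 - p))) := by
  apply Real.le_sqrt_of_sq_le
  have h : 10 ^ 8 / 2 ≤ n * (p * (1 - p)) := by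
    rcases le_total p (1 / 2) with h | h
    · nlinarith
    · nlinarith
  have hpq : 0 ≤ p * (1 - p) := mul_nonneg h0 (by linarith)
  have := mul_le_mul_of_nonneg_right (half_mul_le_four_mul hn) hpq
  linarith

/-- Swap achieves large modularity with high probability, provided the statistics `T_i` have first
absolute moments of the order of their standard deviation. -/
theorem tendsto_binomialRandom {p : ℕ → unitInterval} {β : ℝ} (hβ : 18 / 100 ≤ β)
    (hp : ∀ᶠ n : ℕ in Filter.atTop, 1 ≤ (n : ℝ) * (p n : ℝ) ∧
      (n : ℝ) * (p n : ℝ) ≤ (n : ℝ) - 10 ^ 8 ∧ ∀ i : Fin (2 * (n / 6)),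
        β * Real.sqrt (4 * (n / 6 : ℕ) * (p n * (1 - p n)))
          ≤ expect (p n : ℝ) (fun ω : Sym2 (Fin n) → Bool => |(T (graphOf ω) i : ℝ)|)) :
    Filter.Tendsto
      (fun n : ℕ => SimpleGraph.binomialRandom (Fin n) (p n)
        {G | 4 / 15 * β * Real.sqrt ((1 - (p n : ℝ)) / ((n : ℝ) * (p n : ℝ)))
          ≤ modularityScore G (partition G)})
      Filter.atTop (nhds 1) := by
  have hlim : Filter.Tendsto (fun n : ℕ => ENNReal.ofReal (1 - 10 ^ 9 / (n : ℝ)))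
      Filter.atTop (nhds 1) := by
    have h1 : Filter.Tendsto (fun n : ℕ => 1 - 10 ^ 9 / (n : ℝ)) Filter.atTop (nhds (1 - 0)) :=
      tendsto_const_nhds.sub (tendsto_const_div_atTop_nhds_zero_nat _)
    rw [sub_zero] at h1
    simpa using ENNReal.tendsto_ofReal h1
  refine tendsto_of_tendsto_of_tendsto_of_le_of_le' hlim tendsto_const_nhds ?_
    (Filter.Eventually.of_forall fun n => MeasureTheory.prob_le_one)
  filter_upwards [hp, Filter.eventually_ge_atTop (10 ^ 5)] with n hn hn5
  obtain ⟨hp1, hq1, hμ⟩ := hn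
  have hbad := binomialRandom_real_le hn5 (p n) hp1 (by linarith) hβ hμ
  set S := {G : SimpleGraph (Fin n) | 4 / 15 * β *
    Real.sqrt ((1 - (p n : ℝ)) / ((n : ℝ) * (p n : ℝ))) ≤ modularityScore G (partition G)} with hS
  have hle : (1 : ℝ) ≤ (SimpleGraph.binomialRandom (Fin n) (p n)).real S
      + (SimpleGraph.binomialRandom (Fin n) (p n)).real Sᶜ := by
    have := MeasureTheory.measureReal_union_le (μ := SimpleGraph.binomialRandom (Fin n) (p n)) S Sᶜ
    rwa [Set.union_compl_self, MeasureTheory.probReal_univ] at this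
  have hc : Sᶜ = {G : SimpleGraph (Fin n) | ¬ 4 / 15 * β *
    Real.sqrt ((1 - (p n : ℝ)) / ((n : ℝ) * (p n : ℝ))) ≤ modularityScore G (partition G)} := rfl
  rw [← hc] at hbad
  rw [← MeasureTheory.ofReal_measureReal (μ := SimpleGraph.binomialRandom (Fin n) (p n)) (s := S)]
  exact ENNReal.ofReal_le_ofReal (by linarith)

theorem tendsto_binomialRandom_of_large {p : ℕ → unitInterval}
    (hp : ∀ᶠ n : ℕ in Filter.atTop, 10 ^ 8 ≤ (n : ℝ) * (p n : ℝ) ∧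
      (n : ℝ) * (p n : ℝ) ≤ (n : ℝ) - 10 ^ 8) :
    Filter.Tendsto
      (fun n : ℕ => SimpleGraph.binomialRandom (Fin n) (p n)
        {G | 1 / 5 * Real.sqrt ((1 - (p n : ℝ)) / ((n : ℝ) * (p n : ℝ)))
          ≤ modularityScore G (partition G)})
      Filter.atTop (nhds 1) := by
  have h := tendsto_binomialRandom (p := p) (β := 3 / 4) (by norm_num) (by
    filter_upwards [hp, Filter.eventually_ge_atTop (10 ^ 5)] with n hn hn5
    refine ⟨by linarith [hn.1], hn.2, fun i => ?_⟩
    exact three_quarters_mul_le_expect_abs (p n).2.1 (p n).2.2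
      (hundred_le_sqrt hn5 (p n).2.1 (p n).2.2 hn.1 (by linarith [hn.2]))
      (expect_cos_T_le (p n).2.1 (p n).2.2 i))
  norm_num at h ⊢
  exact h

theorem tendsto_binomialRandom_of_one_le {p : ℕ → unitInterval}
    (hp : ∀ᶠ n : ℕ in Filter.atTop, 1 ≤ (n : ℝ) * (p n : ℝ) ∧
      (n : ℝ) * (p n : ℝ) ≤ (n : ℝ) - 10 ^ 8) :
    Filter.Tendsto
      (fun n : ℕ => SimpleGraph.binomialRandom (Fin n) (p n)
        {G | 4 / 15 * (18 / 100) * Real.sqrt ((1 - (p n : ℝ)) / ((n : ℝ) * (p n : ℝ)))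
          ≤ modularityScore G (partition G)})
      Filter.atTop (nhds 1) :=
  tendsto_binomialRandom (p := p) (β := 18 / 100) le_rfl (by
    filter_upwards [hp, Filter.eventually_ge_atTop (10 ^ 5)] with n hn hn5
    refine ⟨hn.1, hn.2, fun i => ?_⟩
    exact mul_le_expect_abs (p n).2.1 (p n).2.2
      (half_le_sqrt hn5 (p n).2.1 (p n).2.2 hn.1 (by linarith [hn.2]))
      (expect_cos_T_le (p n).2.1 (p n).2.2 i))

end Swap

namespace RAM

/-! ### Total correctness with time bounds -/

theorem State.reg_setReg (s : State) (x v y : ℕ) :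
    (s.setReg x v).reg y = if y = x then v else s.reg y := by
  simp [State.setReg, Function.update_apply]

theorem State.mem_setReg (s : State) (x v : ℕ) : (s.setReg x v).mem = s.mem := rfl

theorem State.reg_setMem (s : State) (i v : ℕ) : (s.setMem i v).reg = s.reg := rfl

theorem State.mem_setMem (s : State) (i v j : ℕ) :
    (s.setMem i v).mem j = if j = i then v else s.mem j := by
  simp [State.setMem, Function.update_apply]

/-- Started in `s`, the program `c` halts within `t` steps in a state that satisfies `Q`. -/
def Runs (W : ℕ) (inp : ℕ → ℕ) (c : Cmd) (s : State) (t : ℕ) (Q : State → Prop) : Prop :=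
  ∃ t' s', Exec W inp c s t' s' ∧ t' ≤ t ∧ Q s'

variable {W : ℕ} {inp : ℕ → ℕ} {s : State} {t t' x y z : ℕ} {c d : Cmd} {Q R : State → Prop}

theorem Runs.mono (h : Runs W inp c s t Q) (ht : t ≤ t') (hQ : ∀ s, Q s → R s) :
    Runs W inp c s t' R := by
  obtain ⟨t₁, s₁, h₁, h₂, h₃⟩ := h
  exact ⟨t₁, s₁, h₁, h₂.trans ht, hQ _ h₃⟩

theorem Runs.skip (h : Q s) : Runs W inp .skip s 1 Q := ⟨1, s, .skip s, le_rfl, h⟩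

theorem Runs.const {k : ℕ} (h : k < W) (hQ : Q (s.setReg x k)) :
    Runs W inp (.const x k) s 1 Q := ⟨1, _, .const s x k h, le_rfl, hQ⟩

theorem Runs.add (h : s.reg y + s.reg z < W) (hQ : Q (s.setReg x (s.reg y + s.reg z))) :
    Runs W inp (.add x y z) s 1 Q := ⟨1, _, .add s x y z h, le_rfl, hQ⟩

theorem Runs.sub (h : s.reg y - s.reg z < W) (hQ : Q (s.setReg x (s.reg y - s.reg z))) :
    Runs W inp (.sub x y z) s 1 Q := ⟨1, _, .sub s x y z h, le_rfl, hQ⟩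

theorem Runs.read (h : inp (s.reg y) < W) (hQ : Q (s.setReg x (inp (s.reg y)))) :
    Runs W inp (.read x y) s 1 Q := ⟨1, _, .read s x y h, le_rfl, hQ⟩

theorem Runs.load (h : s.mem (s.reg y) < W) (hQ : Q (s.setReg x (s.mem (s.reg y)))) :
    Runs W inp (.load x y) s 1 Q := ⟨1, _, .load s x y h, le_rfl, hQ⟩

theorem Runs.store (h : s.reg y < W) (hQ : Q (s.setMem (s.reg x) (s.reg y))) :
    Runs W inp (.store x y) s 1 Q := ⟨1, _, .store s x y h, le_rfl, hQ⟩

theorem Runs.seq (h : Runs W inp c s t (fun s' => Runs W inp d s' t' Q)) :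
    Runs W inp (.seq c d) s (t + t') Q := by
  obtain ⟨t₁, s₁, h₁, h₂, t₂, s₂, h₃, h₄, h₅⟩ := h
  exact ⟨t₁ + t₂, s₂, .seq _ _ _ _ _ _ _ h₁ h₃, by omega, h₅⟩

theorem Runs.ite (hc : s.reg x < s.reg y → Runs W inp c s t Q)
    (hd : ¬ s.reg x < s.reg y → Runs W inp d s t Q) :
    Runs W inp (.ifLt x y c d) s (1 + t) Q := by
  by_cases h : s.reg x < s.reg y
  · obtain ⟨t₁, s₁, h₁, h₂, h₃⟩ := hc h
    exact ⟨1 + t₁, s₁, .ifTrue _ _ _ _ _ _ _ h h₁, by omega, h₃⟩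
  · obtain ⟨t₁, s₁, h₁, h₂, h₃⟩ := hd h
    exact ⟨1 + t₁, s₁, .ifFalse _ _ _ _ _ _ _ h h₁, by omega, h₃⟩

/-- A loop with invariant `I` whose running time is paid for by the potential `Φ`. -/
theorem Runs.while {I : State → Prop} {Φ : State → ℕ}
    (hbody : ∀ s, I s → s.reg x < s.reg y →
      ∃ t, Runs W inp c s t (fun s' => I s' ∧ 1 + t + Φ s' ≤ Φ s))
    (hs : I s) :
    Runs W inp (.whileLt x y c) s (Φ s + 1) (fun s' => I s' ∧ ¬ s'.reg x < s'.reg y) := by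
  induction hm : Φ s using Nat.strong_induction_on generalizing s with
  | _ m ih =>
    by_cases h : s.reg x < s.reg y
    · obtain ⟨t, t₁, s₁, h₁, h₂, h₃, h₄⟩ := hbody s hs h
      obtain ⟨t₂, s₂, h₅, h₆, h₇⟩ := ih (Φ s₁) (by omega) h₃ rfl
      exact ⟨1 + t₁ + t₂, s₂, .whileTrue _ _ _ _ _ _ _ _ h h₁ h₅, by omega, h₇⟩
    · exact ⟨1, s, .whileFalse _ _ _ _ h, by omega, hs, h⟩

/-! ### The program -/

/-- Registers: `r₁ = 4k`, `r₃ = 6k`, `r₄ = 1`, `r₅` is the current vertex, `r₆` the position in the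
input. The adjacency list of `r₅` is read, and its entries in `V₁` are counted in `r₇` if their
parity differs from that of `r₅`, and in `r₈` otherwise. -/
def scanEntry : Cmd :=
  .seq (.read 11 6) <| .seq (.add 6 6 4) <|
    .ifLt 11 1 .skip <| .ifLt 11 3
      (.seq (.load 12 11) <| .ifLt 10 12 (.add 7 7 4) <| .ifLt 12 10 (.add 7 7 4) (.add 8 8 4))
      .skip

/-- Read the adjacency list of the vertex `r₅`. -/
def scanList : Cmd :=
  .seq (.read 9 6) <| .seq (.add 6 6 4) <| .seq (.add 9 6 9) <| .seq (.load 10 5) <|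
    .whileLt 6 9 scanEntry

/-- Treat the pair of vertices `r₅`, `r₅ + 1`. -/
def swapPair : Cmd :=
  .seq (.const 7 0) <| .seq (.const 8 0) <| .seq scanList <| .seq (.add 5 5 4) <| .seq scanList <|
    .seq (.ifLt 8 7 (.seq (.sub 15 5 4) <| .seq (.store 15 14) (.store 5 4)) .skip) (.add 5 5 4)

/-- Compute `4k` and `6k` with `k = ⌊n / 6⌋`. -/
def computeBounds : Cmd :=
  .seq (.const 4 1) <| .seq (.read 0 14) <| .seq (.const 2 5) <| .seq (.const 13 6) <|
    .seq (.const 16 4) <| .seq (.whileLt 2 0 (.seq (.add 2 2 13) (.add 1 1 16))) <|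
      .seq (.const 13 5) (.sub 3 2 13)

/-- Mark the vertices with odd label. -/
def markOdd : Cmd :=
  .seq (.const 13 2) <| .seq (.whileLt 5 0 (.seq (.store 5 4) (.add 5 5 13))) <|
    .seq (.const 5 0) (.const 6 1)

/-- The algorithm Swap. -/
def swapProgram : Cmd := .seq computeBounds <| .seq markOdd <| .whileLt 5 1 swapPair

/-! ### Correctness of the program -/

/-- The input consists of `n` and, from the position `off v` on, of the length `len v` and the
entries `ent v j` of the list of the vertex `v`; its size is `N`. -/
structure Layout (inp : ℕ → ℕ) (n N : ℕ) (len off : ℕ → ℕ) (ent : ℕ → ℕ → ℕ) : Prop where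
  size : inp 0 = n
  off_zero : off 0 = 1
  off_succ : ∀ v, off (v + 1) = off v + 1 + len v
  off_last : off n = N
  length : ∀ v < n, inp (off v) = len v
  entry : ∀ v < n, ∀ j < len v, inp (off v + 1 + j) = ent v j
  entry_lt : ∀ v < n, ∀ j < len v, ent v j < n

/-- The initial mark of a vertex. -/
def mark (v : ℕ) : ℕ := if v % 2 = 0 then 1 else 0

/-- The number of the first `j` entries of the list of `v` that lie in `[l, u)` and have a different
parity from `v`. -/
def countDiff (ent : ℕ → ℕ → ℕ) (l u v j : ℕ) : ℕ :=
  ∑ i ∈ Finset.range j, if l ≤ ent v i ∧ ent v i < u ∧ ent v i % 2 ≠ v % 2 then 1 else 0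

/-- The number of the first `j` entries of the list of `v` that lie in `[l, u)` and have the same
parity as `v`. -/
def countSame (ent : ℕ → ℕ → ℕ) (l u v j : ℕ) : ℕ :=
  ∑ i ∈ Finset.range j, if l ≤ ent v i ∧ ent v i < u ∧ ent v i % 2 = v % 2 then 1 else 0

/-- Keeps the two counters below the word bound. -/
theorem countDiff_add_countSame_le (ent : ℕ → ℕ → ℕ) (l u v j : ℕ) :
    countDiff ent l u v j + countSame ent l u v j ≤ j := by
  unfold countDiff countSame
  rw [← Finset.sum_add_distrib]
  calc _ ≤ ∑ i ∈ Finset.range j, 1 := Finset.sum_le_sum fun i _ => by split_ifs <;> omega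
    _ = j := by simp

variable {n N : ℕ} {len off : ℕ → ℕ} {ent : ℕ → ℕ → ℕ}

theorem Layout.off_le (h : Layout inp n N len off ent) {v : ℕ} (hv : v ≤ n) : off v ≤ N := by
  rw [← h.off_last]
  exact monotone_nat_of_le_succ (fun v => by rw [h.off_succ]; omega) hv

theorem Layout.le_off (h : Layout inp n N len off ent) (v : ℕ) : v + 1 ≤ off v := by
  induction v with
  | zero => rw [h.off_zero]
  | succ v ih =>
    rw [h.off_succ]
    omega

/-- The machine has no remainder instruction, so the marks of the vertices in [l, u) serve as a
table of parities; `hm` requires these cells to be still unchanged. The bound `h78` ties the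
counters to the input position, so they remain valid words. -/
theorem runs_scanEntry (h : Layout inp n N len off ent) (hW : N + 10 ≤ W) {v j l u : ℕ}
    (hv : v < n) (hj : j < len v) (h1 : s.reg 1 = l) (h3 : s.reg 3 = u) (h4 : s.reg 4 = 1)
    (h6 : s.reg 6 = off v + 1 + j) (h10 : s.reg 10 = mark v)
    (h78 : s.reg 7 + s.reg 8 ≤ off v + j)
    (hm : ∀ w, l ≤ w → w < u → s.mem w = mark w) :
    Runs W inp scanEntry s 8 (fun s' => s'.mem = s.mem ∧
      (∀ r, r ≠ 6 → r ≠ 7 → r ≠ 8 → r ≠ 11 → r ≠ 12 → s'.reg r = s.reg r) ∧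
      s'.reg 6 = off v + 1 + (j + 1) ∧
      s'.reg 7 = s.reg 7 + (if l ≤ ent v j ∧ ent v j < u ∧ ent v j % 2 ≠ v % 2 then 1 else 0) ∧
      s'.reg 8 = s.reg 8 + (if l ≤ ent v j ∧ ent v j < u ∧ ent v j % 2 = v % 2 then 1 else 0)) := by
  have hoff : off v + 1 + len v ≤ N := by
    rw [← h.off_succ]
    exact h.off_le hv
  have hn := h.le_off v
  have hnN : n + 1 ≤ N := by
    have := h.le_off n
    rwa [h.off_last] at this
  have he := h.entry v hv j hj
  have hel := h.entry_lt v hv j hj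
  have hmark : ∀ w, mark w < W := fun w => by unfold mark; split_ifs <;> omega
  unfold scanEntry
  refine Runs.seq (t := 1) (t' := 7) (Runs.read (by rw [h6, he]; omega) ?_)
  refine Runs.seq (t := 1) (t' := 6) (Runs.add ?_ ?_)
  · simp [State.reg_setReg]
    omega
  rw [h6, he]
  refine Runs.ite (t := 5) (fun hlt => ?_) fun hlt => ?_
  · simp [State.reg_setReg, h1] at hlt
    refine (Runs.skip ?_).mono (by omega : 1 ≤ 5) fun _ h => h
    refine ⟨rfl, fun r _ _ _ _ _ => ?_, ?_, ?_, ?_⟩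
    · simp [State.reg_setReg, *]
    · simp [State.reg_setReg, h4]
      omega
    · simp [State.reg_setReg]
      omega
    · simp [State.reg_setReg]
      omega
  simp [State.reg_setReg, h1] at hlt
  refine Runs.ite (t := 4) (fun hlu => ?_) fun hlu => ?_
  swap
  · simp [State.reg_setReg, h3] at hlu
    refine (Runs.skip ?_).mono (by omega : 1 ≤ 4) fun _ h => h
    refine ⟨rfl, fun r _ _ _ _ _ => ?_, ?_, ?_, ?_⟩
    · simp [State.reg_setReg, *]
    · simp [State.reg_setReg, h4]
      omega
    · simp [State.reg_setReg]
      omega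
    · simp [State.reg_setReg]
      omega
  simp [State.reg_setReg, h3] at hlu
  have hme := hm _ hlt hlu
  refine Runs.seq (t := 1) (t' := 3) (Runs.load ?_ ?_)
  · simp [State.reg_setReg, State.mem_setReg, hme, hmark]
  -- Marks are 0 or 1, so two strict comparisons decide whether the parities differ.
  have hcmp : ((mark v < mark (ent v j) ∨ mark (ent v j) < mark v) ↔ ent v j % 2 ≠ v % 2) := by
    unfold mark
    split_ifs <;> omega
  refine Runs.ite (t := 2) (fun hc => ?_) fun hc => ?_
  · simp [State.reg_setReg, State.mem_setReg, hme, h10] at hc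
    have hne := hcmp.1 (Or.inl hc)
    refine (Runs.add ?_ ?_).mono (by omega : 1 ≤ 2) fun _ h => h
    · simp [State.reg_setReg]
      omega
    refine ⟨rfl, fun r _ _ _ _ _ => ?_, ?_, ?_, ?_⟩
    · simp [State.reg_setReg, *]
    · simp [State.reg_setReg, h4]
      omega
    · simp [State.reg_setReg, h4, hlt, hlu, hne]
    · simp [State.reg_setReg, hne]
  simp [State.reg_setReg, State.mem_setReg, hme, h10] at hc
  refine Runs.ite (t := 1) (fun hc' => ?_) fun hc' => ?_
  · simp [State.reg_setReg, State.mem_setReg, hme, h10] at hc'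
    have hne := hcmp.1 (Or.inr hc')
    refine Runs.add ?_ ?_
    · simp [State.reg_setReg]
      omega
    refine ⟨rfl, fun r _ _ _ _ _ => ?_, ?_, ?_, ?_⟩
    · simp [State.reg_setReg, *]
    · simp [State.reg_setReg, h4]
      omega
    · simp [State.reg_setReg, h4, hlt, hlu, hne]
    · simp [State.reg_setReg, hne]
  simp [State.reg_setReg, State.mem_setReg, hme, h10] at hc'
  have heq : ent v j % 2 = v % 2 := by
    by_contra hne
    rcases hcmp.2 hne with h | h <;> omega
  refine Runs.add ?_ ?_
  · simp [State.reg_setReg]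
    omega
  refine ⟨rfl, fun r _ _ _ _ _ => ?_, ?_, ?_, ?_⟩
  · simp [State.reg_setReg, *]
  · simp [State.reg_setReg, h4]
    omega
  · simp [State.reg_setReg, heq]
  · simp [State.reg_setReg, h4, hlt, hlu, heq]

theorem runs_scanList (h : Layout inp n N len off ent) (hW : N + 10 ≤ W) {v l u : ℕ}
    (hv : v < n) (h1 : s.reg 1 = l) (h3 : s.reg 3 = u) (h4 : s.reg 4 = 1) (h5 : s.reg 5 = v)
    (h6 : s.reg 6 = off v) (h78 : s.reg 7 + s.reg 8 ≤ off v) (hmv : s.mem v = mark v)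
    (hm : ∀ w, l ≤ w → w < u → s.mem w = mark w) :
    Runs W inp scanList s (9 * (1 + len v)) (fun s' => s'.mem = s.mem ∧
      (∀ r, r < 6 → s'.reg r = s.reg r) ∧ s'.reg 14 = s.reg 14 ∧ s'.reg 6 = off (v + 1) ∧
      s'.reg 7 = s.reg 7 + countDiff ent l u v (len v) ∧
      s'.reg 8 = s.reg 8 + countSame ent l u v (len v)) := by
  have hoff : off v + 1 + len v ≤ N := by
    rw [← h.off_succ]
    exact h.off_le hv
  have hlen := h.length v hv
  have hmark : ∀ w, mark w < W := fun w => by unfold mark; split_ifs <;> omega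
  let I : State → Prop := fun s' => s'.mem = s.mem ∧ (∀ r, r < 6 → s'.reg r = s.reg r) ∧
    s'.reg 14 = s.reg 14 ∧ s'.reg 9 = off v + 1 + len v ∧ s'.reg 10 = mark v ∧
    ∃ j ≤ len v, s'.reg 6 = off v + 1 + j ∧ s'.reg 7 = s.reg 7 + countDiff ent l u v j ∧
      s'.reg 8 = s.reg 8 + countSame ent l u v j
  have hloop : ∀ s', I s' → s'.reg 6 = off v + 1 →
      Runs W inp (.whileLt 6 9 scanEntry) s' (9 * len v + 1) (fun s' => I s' ∧
        ¬ s'.reg 6 < s'.reg 9) := by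
    intro s' hs' hs6
    refine (Runs.while (I := I) (Φ := fun s' => 9 * (off v + 1 + len v - s'.reg 6)) ?_ hs').mono
      (by rw [hs6]; omega) fun _ h => h
    rintro s₁ ⟨g0, g1, g14, g9, g10, j, hj, g6, g7, g8⟩ hlt
    have hj' : j < len v := by omega
    have hcnt := countDiff_add_countSame_le ent l u v j
    refine ⟨8, (runs_scanEntry h hW (l := l) (u := u) hv hj' (by rw [g1 1 (by norm_num), h1])
      (by rw [g1 3 (by norm_num), h3]) (by rw [g1 4 (by norm_num), h4]) g6 g10 (by omega)
      (by rw [g0]; exact hm)).mono le_rfl ?_⟩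
    rintro s₂ ⟨k0, kr, k6, k7, k8⟩
    have kr' : ∀ r, r < 6 → s₂.reg r = s₁.reg r := fun r hr =>
      kr r (by omega) (by omega) (by omega) (by omega) (by omega)
    refine ⟨⟨by rw [k0, g0], fun r hr => by rw [kr' r hr, g1 r hr], ?_, ?_, ?_, j + 1, hj', k6,
      ?_, ?_⟩, by omega⟩
    · rw [kr 14 (by norm_num) (by norm_num) (by norm_num) (by norm_num) (by norm_num), g14]
    · rw [kr 9 (by norm_num) (by norm_num) (by norm_num) (by norm_num) (by norm_num), g9]
    · rw [kr 10 (by norm_num) (by norm_num) (by norm_num) (by norm_num) (by norm_num), g10]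
    · rw [k7, g7, countDiff, countDiff, Finset.sum_range_succ, add_assoc]
    · rw [k8, g8, countSame, countSame, Finset.sum_range_succ, add_assoc]
  unfold scanList
  -- Each entry costs 8 steps and a test; the set-up and the last test cost 5.
  refine Runs.mono (t := 1 + (1 + (1 + (1 + (9 * len v + 1))))) ?_ (by omega) fun _ h => h
  refine Runs.seq (Runs.read (by rw [h6, hlen]; omega) ?_)
  refine Runs.seq (Runs.add ?_ ?_)
  · simp [State.reg_setReg]
    omega
  refine Runs.seq (Runs.add ?_ ?_)
  · simp [State.reg_setReg, h6, hlen, h4]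
    omega
  refine Runs.seq (Runs.load ?_ ?_)
  · simp [State.reg_setReg, State.mem_setReg, h5, hmv, hmark]
  refine Runs.mono (hloop _ ?_ ?_) le_rfl ?_
  · refine ⟨rfl, fun r hr => ?_, ?_, ?_, ?_, 0, Nat.zero_le _, ?_, ?_, ?_⟩
    · simp only [State.reg_setReg]
      rw [if_neg (by omega), if_neg (by omega), if_neg (by omega), if_neg (by omega)]
    · simp [State.reg_setReg]
    · simp [State.reg_setReg, h6, hlen, h4]
    · simp [State.reg_setReg, State.mem_setReg, h5, hmv]
    · simp [State.reg_setReg, h6, h4]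
    · simp [State.reg_setReg, countDiff]
    · simp [State.reg_setReg, countSame]
  · simp [State.reg_setReg, h6, h4]
  · rintro s₂ ⟨⟨g0, g1, g14, g9, g10, j, hj, g6, g7, g8⟩, hge⟩
    have hj' : j = len v := by omega
    subst hj'
    exact ⟨g0, g1, g14, by rw [g6, h.off_succ], g7, g8⟩

end RAM

/-! ### Correctness and running time of the whole program -/

namespace RAM

variable {W : ℕ} {inp : ℕ → ℕ} {s : State}
variable {n N : ℕ} {len off : ℕ → ℕ} {ent : ℕ → ℕ → ℕ}

/-- The final mark of a vertex `w < l`: it is changed if the pair of `w` is swapped. -/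
def finalMark (len : ℕ → ℕ) (ent : ℕ → ℕ → ℕ) (l u w : ℕ) : ℕ :=
  if countSame ent l u (2 * (w / 2)) (len (2 * (w / 2)))
      + countSame ent l u (2 * (w / 2) + 1) (len (2 * (w / 2) + 1))
    < countDiff ent l u (2 * (w / 2)) (len (2 * (w / 2)))
      + countDiff ent l u (2 * (w / 2) + 1) (len (2 * (w / 2) + 1))
  then 1 - mark w else mark w

/-- The invariant of the main loop after `i` pairs. -/
def PairInvariant (n l u : ℕ) (len off : ℕ → ℕ) (ent : ℕ → ℕ → ℕ) (i : ℕ) (s : State) : Prop :=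
  s.reg 1 = l ∧ s.reg 3 = u ∧ s.reg 4 = 1 ∧ s.reg 14 = 0 ∧ s.reg 5 = 2 * i ∧
    s.reg 6 = off (2 * i) ∧
    ∀ w < n, s.mem w = if w < 2 * i then finalMark len ent l u w else mark w

/-- The marks of both vertices are read before either is overwritten, and writes hit only cells
below l, so the parity table for [l, u) stays intact. Register 14 supplies the constant 0. -/
theorem runs_swapPair (h : Layout inp n N len off ent) (hW : N + 10 ≤ W) {i l u : ℕ}
    (hi : 2 * i < l) (hl : l % 2 = 0) (hln : l ≤ n) (hu : u ≤ n)
    (hs : PairInvariant n l u len off ent i s) :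
    Runs W inp swapPair s (8 + 9 * (1 + len (2 * i)) + 9 * (1 + len (2 * i + 1)))
      (PairInvariant n l u len off ent (i + 1)) := by
  obtain ⟨h1, h3, h4, h14, h5, h6, hm⟩ := hs
  have hoff1 := h.off_le (show 2 * i + 1 ≤ n by omega)
  have hoff2 := h.off_le (show 2 * i + 1 + 1 ≤ n by omega)
  have hs1 := h.off_succ (2 * i)
  have hs2 := h.off_succ (2 * i + 1)
  have hle := h.le_off (2 * i + 1 + 1)
  have hc1 := countDiff_add_countSame_le ent l u (2 * i) (len (2 * i))
  unfold swapPair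
  refine Runs.mono (t := 1 + (1 + (9 * (1 + len (2 * i)) + (1 + (9 * (1 + len (2 * i + 1)) +
    ((1 + (1 + (1 + 1))) + 1)))))) ?_ (by omega) fun _ h => h
  refine Runs.seq (Runs.const (by omega) ?_)
  refine Runs.seq (Runs.const (by omega) ?_)
  refine Runs.seq ((runs_scanList h hW (v := 2 * i) (l := l) (u := u) (by omega) ?_ ?_ ?_ ?_ ?_ ?_
    ?_ ?_).mono le_rfl ?_)
  · simp [State.reg_setReg, h1]
  · simp [State.reg_setReg, h3]
  · simp [State.reg_setReg, h4]
  · simp [State.reg_setReg, h5]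
  · simp [State.reg_setReg, h6]
  · simp [State.reg_setReg]
  · simp only [State.mem_setReg]
    rw [hm _ (by omega), if_neg (by omega)]
  · intro w hw hw'
    simp only [State.mem_setReg]
    rw [hm _ (by omega), if_neg (by omega)]
  simp only [State.mem_setReg, State.reg_setReg]
  rintro s₁ ⟨g0, gr, g14, g6, g7, g8⟩
  have g1 := gr 1 (by norm_num)
  have g3 := gr 3 (by norm_num)
  have g4 := gr 4 (by norm_num)
  have g5 := gr 5 (by norm_num)
  norm_num [h1, h3, h4, h5, h14] at g1 g3 g4 g5 g7 g8 g14
  refine Runs.seq (Runs.add (by omega) ?_)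
  refine Runs.seq ((runs_scanList h hW (v := 2 * i + 1) (l := l) (u := u) (by omega) ?_ ?_ ?_ ?_ ?_
    ?_ ?_ ?_).mono le_rfl ?_)
  · simp [State.reg_setReg, g1]
  · simp [State.reg_setReg, g3]
  · simp [State.reg_setReg, g4]
  · simp [State.reg_setReg, g5, g4]
  · simp [State.reg_setReg, g6]
  · simp [State.reg_setReg]
    omega
  · simp only [State.mem_setReg]
    rw [g0, hm _ (by omega), if_neg (by omega)]
  · intro w hw hw'
    simp only [State.mem_setReg]
    rw [g0, hm _ (by omega), if_neg (by omega)]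
  simp only [State.mem_setReg, State.reg_setReg]
  rintro s₂ ⟨k0, kr, k14, k6, k7, k8⟩
  have k1 := kr 1 (by norm_num)
  have k3 := kr 3 (by norm_num)
  have k4 := kr 4 (by norm_num)
  have k5 := kr 5 (by norm_num)
  norm_num [g1, g3, g4, g5, g7, g8, g14] at k1 k3 k4 k5 k7 k8 k14
  have hfin : ∀ w, w / 2 = i → (finalMark len ent l u w =
      if s₂.reg 8 < s₂.reg 7 then 1 - mark w else mark w) := by
    intro w hw
    rw [finalMark, hw, k7, k8]
  refine Runs.seq (Runs.ite (fun hlt => ?_) fun hlt => ?_)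
  · refine Runs.seq (Runs.sub (by omega) ?_)
    refine Runs.seq (Runs.store ?_ ?_)
    · simp [State.reg_setReg, k14]
      omega
    refine Runs.store ?_ ?_
    · simp [State.reg_setMem, State.reg_setReg, k4]
      omega
    refine Runs.add ?_ ?_
    · simp [State.reg_setMem, State.reg_setReg, k4, k5]
      omega
    refine ⟨?_, ?_, ?_, ?_, ?_, ?_, ?_⟩
    · simp [State.reg_setMem, State.reg_setReg, k1]
    · simp [State.reg_setMem, State.reg_setReg, k3]
    · simp [State.reg_setMem, State.reg_setReg, k4]
    · simp [State.reg_setMem, State.reg_setReg, k14]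
    · simp [State.reg_setMem, State.reg_setReg, k4, k5]
      omega
    · simp [State.reg_setMem, State.reg_setReg, k6]
      rfl
    · intro w hw
      simp only [State.mem_setReg, State.mem_setMem, State.reg_setMem, State.reg_setReg, k0, g0,
        k4, k5, k14]
      norm_num
      rw [hm w hw]
      by_cases hw1 : w = 2 * i + 1
      · rw [if_pos hw1, if_pos (by omega), hfin w (by omega), if_pos hlt, mark,
          if_neg (by omega)]
      · rw [if_neg hw1]
        by_cases hw0 : w = 2 * i
        · rw [if_pos hw0, if_pos (by omega), hfin w (by omega), if_pos hlt, mark,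
            if_pos (by omega)]
        · rw [if_neg hw0]
          by_cases hlt' : w < 2 * i
          · rw [if_pos hlt', if_pos (by omega)]
          · rw [if_neg hlt', if_neg (by omega)]
  · refine (Runs.skip ?_).mono (by omega : 1 ≤ 1 + (1 + 1)) fun _ h => h
    refine Runs.add (by omega) ?_
    refine ⟨?_, ?_, ?_, ?_, ?_, ?_, ?_⟩
    · simp [State.reg_setReg, k1]
    · simp [State.reg_setReg, k3]
    · simp [State.reg_setReg, k4]
    · simp [State.reg_setReg, k14]
    · simp [State.reg_setReg, k4, k5]
      omega
    · simp [State.reg_setReg, k6]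
      rfl
    · intro w hw
      simp only [State.mem_setReg, k0, g0]
      rw [hm w hw]
      by_cases hlt' : w < 2 * i
      · rw [if_pos hlt', if_pos (by omega)]
      · by_cases hw1 : w < 2 * (i + 1)
        · rw [if_neg hlt', if_pos hw1, hfin w (by omega), if_neg hlt]
        · rw [if_neg hlt', if_neg hw1]

theorem runs_computeBounds (hn : inp 0 = n) (hW : n + 10 ≤ W) :
    Runs W inp computeBounds State.init (3 * n + 8) (fun s => s.mem = (fun _ => 0) ∧
      s.reg 0 = n ∧ s.reg 1 = 4 * (n / 6) ∧ s.reg 3 = 6 * (n / 6) ∧ s.reg 4 = 1 ∧ s.reg 14 = 0 ∧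
      s.reg 5 = 0) := by
  -- Division by 6 through counting. Starting r₂ at 5 makes the test r₂ < n equivalent to 6(j+1) ≤
  -- n, so the loop stops at j = ⌊n/6⌋.
  let I : State → Prop := fun s => s.mem = (fun _ => 0) ∧ s.reg 0 = n ∧ s.reg 4 = 1 ∧
    s.reg 14 = 0 ∧ s.reg 5 = 0 ∧ s.reg 13 = 6 ∧ s.reg 16 = 4 ∧
    ∃ j ≤ n / 6, s.reg 2 = 6 * j + 5 ∧ s.reg 1 = 4 * j
  have hloop : ∀ s, I s → Runs W inp (.whileLt 2 0 (.seq (.add 2 2 13) (.add 1 1 16))) s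
      (3 * n + 1) (fun s => I s ∧ ¬ s.reg 2 < s.reg 0) := by
    intro s hs
    refine (Runs.while (I := I) (Φ := fun s => 3 * (n - s.reg 2)) ?_ hs).mono
      (by omega) fun _ h => h
    rintro s₁ ⟨g0, gn, g4, g14, g5, g13, g16, j, hj, g2, g1⟩ hlt
    refine ⟨1 + 1, Runs.seq (Runs.add (by omega) (Runs.add ?_ ?_))⟩
    · simp [State.reg_setReg]
      omega
    refine ⟨⟨g0, ?_, ?_, ?_, ?_, ?_, ?_, j + 1, by omega, ?_, ?_⟩, ?_⟩
    · simp [State.reg_setReg, gn]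
    · simp [State.reg_setReg, g4]
    · simp [State.reg_setReg, g14]
    · simp [State.reg_setReg, g5]
    · simp [State.reg_setReg, g13]
    · simp [State.reg_setReg, g16]
    · simp [State.reg_setReg]
      omega
    · simp [State.reg_setReg]
      omega
    · simp [State.reg_setReg]
      omega
  unfold computeBounds
  refine Runs.mono (t := 1 + (1 + (1 + (1 + (1 + ((3 * n + 1) + (1 + 1))))))) ?_ (by omega)
    fun _ h => h
  refine Runs.seq (Runs.const (by omega) ?_)
  refine Runs.seq (Runs.read ?_ ?_)
  · simp [State.reg_setReg, State.init, hn]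
    omega
  refine Runs.seq (Runs.const (by omega) ?_)
  refine Runs.seq (Runs.const (by omega) ?_)
  refine Runs.seq (Runs.const (by omega) ?_)
  refine Runs.seq ((hloop _ ⟨rfl, ?_, ?_, ?_, ?_, ?_, ?_, 0, Nat.zero_le _, ?_, ?_⟩).mono le_rfl ?_)
  any_goals simp [State.reg_setReg, State.init, hn]
  rintro s₁ ⟨g0, gn, g4, g14, g5, g13, g16, j, hj, g2, g1⟩ hge
  refine Runs.seq (Runs.const (by omega) (Runs.sub ?_ ?_))
  · simp [State.reg_setReg]
    omega
  refine ⟨g0, ?_, ?_, ?_, ?_, ?_, ?_⟩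
  · simp [State.reg_setReg, gn]
  · simp [State.reg_setReg]
    omega
  · simp [State.reg_setReg]
    omega
  · simp [State.reg_setReg, g4]
  · simp [State.reg_setReg, g14]
  · simp [State.reg_setReg, g5]

theorem runs_markOdd (hW : n + 10 ≤ W) (hmem : s.mem = fun _ => 0) (h0 : s.reg 0 = n)
    (h4 : s.reg 4 = 1) (h5 : s.reg 5 = 0) :
    Runs W inp markOdd s (3 * n + 7) (fun s' =>
      (∀ r, r ≠ 5 → r ≠ 6 → r ≠ 13 → s'.reg r = s.reg r) ∧ s'.reg 5 = 0 ∧ s'.reg 6 = 1 ∧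
      ∀ w < n, s'.mem w = mark w) := by
  -- The counter moves in steps of 2 and overshoots to n + 1 when n is odd.
  let I : State → Prop := fun s' => (∀ r, r ≠ 5 → r ≠ 13 → s'.reg r = s.reg r) ∧
    s'.reg 13 = 2 ∧ ∃ j, 2 * j ≤ n + 1 ∧ s'.reg 5 = 2 * j ∧
    ∀ w, s'.mem w = if w < 2 * j then mark w else 0
  have hloop : ∀ s', I s' → Runs W inp (.whileLt 5 0 (.seq (.store 5 4) (.add 5 5 13))) s'
      (3 * (n + 1) + 1) (fun s' => I s' ∧ ¬ s'.reg 5 < s'.reg 0) := by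
    intro s' hs'
    refine (Runs.while (I := I) (Φ := fun s => 3 * (n + 1 - s.reg 5)) ?_ hs').mono
      (by omega) fun _ h => h
    rintro s₁ ⟨gr, g13, j, hj, g5, gm⟩ hlt
    have g0 := gr 0 (by norm_num) (by norm_num)
    have g4 := gr 4 (by norm_num) (by norm_num)
    refine ⟨1 + 1, Runs.seq (Runs.store (by omega) (Runs.add ?_ ?_))⟩
    · simp [State.reg_setMem]
      omega
    refine ⟨⟨?_, ?_, j + 1, by omega, ?_, ?_⟩, ?_⟩
    · intro r hr hr'
      simp only [State.reg_setReg, State.reg_setMem]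
      rw [if_neg hr, gr r hr hr']
    · simp [State.reg_setReg, State.reg_setMem, g13]
    · simp [State.reg_setReg, State.reg_setMem]
      omega
    · intro w
      simp only [State.mem_setReg, State.mem_setMem, g5, g4, h4, gm]
      unfold mark
      split_ifs <;> omega
    · simp [State.reg_setReg, State.reg_setMem]
      omega
  unfold markOdd
  refine Runs.mono (t := 1 + ((3 * (n + 1) + 1) + (1 + 1))) ?_ (by omega) fun _ h => h
  refine Runs.seq (Runs.const (by omega) ?_)
  refine Runs.seq ((hloop _ ⟨?_, ?_, 0, by omega, ?_, ?_⟩).mono le_rfl ?_)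
  · intro r hr hr'
    simp [State.reg_setReg, hr']
  · simp [State.reg_setReg]
  · simp [State.reg_setReg, h5]
  · simp [State.mem_setReg, hmem]
  rintro s₁ ⟨⟨gr, g13, j, hj, g5, gm⟩, hge⟩
  have g0 := gr 0 (by norm_num) (by norm_num)
  refine Runs.seq (Runs.const (by omega) (Runs.const (by omega) ⟨?_, ?_, ?_, ?_⟩))
  · intro r h5 h6 h13
    simp [State.reg_setReg, h5, h6, gr r h5 h13]
  · simp [State.reg_setReg]
  · simp [State.reg_setReg]
  · intro w hw
    simp only [State.mem_setReg, gm]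
    rw [if_pos (by omega)]

theorem runs_swapProgram (h : Layout inp n N len off ent) (hW : N + 10 ≤ W) :
    Runs W inp swapProgram State.init (6 * n + 14 * N + 16) (fun s => ∀ w < n, s.mem w =
      if w < 4 * (n / 6) then finalMark len ent (4 * (n / 6)) (6 * (n / 6)) w else mark w) := by
  have hnN : n + 1 ≤ N := by
    have := h.le_off n
    rwa [h.off_last] at this
  unfold swapProgram
  refine Runs.mono (t := (3 * n + 8) + ((3 * n + 7) + (14 * N + 1))) ?_ (by omega) fun _ h => h
  refine Runs.seq ((runs_computeBounds h.size (by omega)).mono le_rfl ?_)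
  rintro s₁ ⟨g0, gn, g1, g3, g4, g14, g5⟩
  refine Runs.seq ((runs_markOdd (by omega) g0 gn g4 g5).mono le_rfl ?_)
  rintro s₂ ⟨kr, k5, k6, km⟩
  have k1 := kr 1 (by norm_num) (by norm_num) (by norm_num)
  have k3 := kr 3 (by norm_num) (by norm_num) (by norm_num)
  have k4 := kr 4 (by norm_num) (by norm_num) (by norm_num)
  have k14 := kr 14 (by norm_num) (by norm_num) (by norm_num)
  -- With ℓ list entries in total, a pair costs 27 + 9ℓ steps including the test and advances the
  -- input position by 2 + ℓ; a potential of 14 per word pays for it.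
  refine (Runs.while (I := fun s => ∃ i, 2 * i ≤ 4 * (n / 6) ∧
    PairInvariant n (4 * (n / 6)) (6 * (n / 6)) len off ent i s)
    (Φ := fun s => 14 * (N - s.reg 6)) ?_ ⟨0, Nat.zero_le _, ?_⟩).mono (by omega) ?_
  · rintro s ⟨i, hi, hs⟩ hlt
    have hs' := hs
    obtain ⟨h1, h3, h4, h14, h5, h6, hm⟩ := hs'
    have hi' : 2 * i < 4 * (n / 6) := by omega
    refine ⟨_, (runs_swapPair h hW hi' (by omega) (by omega) (by omega) hs).mono le_rfl ?_⟩
    intro s' hs'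
    refine ⟨⟨i + 1, by omega, hs'⟩, ?_⟩
    obtain ⟨-, -, -, -, -, h6', -⟩ := hs'
    have e1 := h.off_succ (2 * i)
    have e2 := h.off_succ (2 * i + 1)
    have e3 := h.off_le (show 2 * i + 1 + 1 ≤ n by omega)
    have e4 : off (2 * (i + 1)) = off (2 * i + 1 + 1) := rfl
    rw [h6, h6', e4]
    omega
  · refine ⟨by rw [k1, g1], by rw [k3, g3], by rw [k4, g4], by rw [k14, g14], by rw [k5],
      by rw [k6, mul_zero, h.off_zero], fun w hw => ?_⟩
    rw [km w hw, if_neg (by omega)]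
  · rintro s ⟨⟨i, hi, h1, h3, h4, h14, h5, h6, hm⟩, hge⟩ w hw
    rw [hm w hw, show 2 * i = 4 * (n / 6) by omega]

end RAM

namespace RAM

/-! ### The layout of the input -/

variable {n : ℕ} (L : Fin n → List (Fin n))

/-- The length of the list of the vertex `v`. -/
def listLength (v : ℕ) : ℕ := if h : v < n then (L ⟨v, h⟩).length else 0

/-- The entries of the list of the vertex `v`. -/
def listEntry (v j : ℕ) : ℕ := if h : v < n then ((L ⟨v, h⟩).map Fin.val).getD j 0 else 0

/-- The position of the list of the vertex `v` in the input. -/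
def listOffset (v : ℕ) : ℕ := 1 + ∑ u ∈ Finset.range v, (1 + listLength L u)

theorem listOffset_succ (v : ℕ) : listOffset L (v + 1) = listOffset L v + 1 + listLength L v := by
  rw [listOffset, listOffset, Finset.sum_range_succ]
  omega

/-- The part of the input that encodes the vertex `v`. -/
def block (v : Fin n) : List ℕ := (L v).length :: (L v).map Fin.val

theorem length_take_flatMap {v : ℕ} (hv : v ≤ n) :
    1 + (((List.finRange n).take v).flatMap (block L)).length = listOffset L v := by
  induction v with
  | zero => simp [listOffset]
  | succ v ih =>
    have hv' : v < n := hv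
    rw [listOffset_succ, ← ih hv'.le, List.take_add_one,
      List.getElem?_eq_getElem (by simpa using hv'), List.flatMap_append, List.length_append]
    simp [block, listLength, hv']
    omega

theorem input_listOffset_add {v : ℕ} (hv : v < n) {j : ℕ} (hj : j < 1 + listLength L v) :
    input L (listOffset L v + j) = (block L ⟨v, hv⟩).getD j 0 := by
  have hsplit : encode L = (n :: ((List.finRange n).take v).flatMap (block L)) ++
      (block L ⟨v, hv⟩ ++ ((List.finRange n).drop (v + 1)).flatMap (block L)) := by
    have h1 : List.finRange n = (List.finRange n).take v ++
        (⟨v, hv⟩ :: (List.finRange n).drop (v + 1)) := by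
      conv_lhs => rw [← List.take_append_drop v (List.finRange n)]
      rw [List.drop_eq_getElem_cons (by simpa using hv)]
      simp
    unfold encode
    rw [List.cons_append]
    congr 1
    conv_lhs => rw [h1]
    rw [List.flatMap_append, List.flatMap_cons]
    rfl
  have hlen : (n :: ((List.finRange n).take v).flatMap (block L)).length = listOffset L v := by
    rw [List.length_cons, add_comm, length_take_flatMap L hv.le]
  have hb : j < (block L ⟨v, hv⟩).length := by
    simp only [listLength, hv, dif_pos] at hj
    simp only [block, List.length_cons, List.length_map]
    omega
  unfold input
  rw [hsplit, List.getD_append_right _ _ _ _ (by rw [hlen]; omega), hlen, Nat.add_sub_cancel_left,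
    List.getD_append _ _ _ _ hb]

theorem layout : Layout (input L) n (listOffset L n) (listLength L) (listOffset L)
    (listEntry L) where
  size := rfl
  off_zero := rfl
  off_succ := listOffset_succ L
  off_last := rfl
  length v hv := by
    have := input_listOffset_add L hv (j := 0) (by omega)
    rw [add_zero] at this
    rw [this]
    simp [block, listLength, hv]
  entry v hv j hj := by
    rw [add_assoc, input_listOffset_add L hv (by omega), add_comm 1 j]
    simp [block, listEntry, hv]
  entry_lt v hv j hj := by
    simp only [listLength, hv, dif_pos] at hj
    simp [listEntry, hv, hj]

variable {L}

/-- The handshake lemma: the total length of the lists is 2m. This makes the bound linear in n + m.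
-/
theorem listOffset_eq {G : SimpleGraph (Fin n)} (hL : IsAdjList G L) :
    listOffset L n = 1 + n + 2 * G.edgeSet.ncard := by
  classical
  have h1 : ∀ v, (L v).length = G.degree v := by
    intro v
    rw [← List.toFinset_card_of_nodup (hL v).1, ← SimpleGraph.card_neighborFinset_eq_degree]
    congr 1
    ext w
    simp [(hL v).2 w]
  have h2 := G.sum_degrees_eq_twice_card_edges
  rw [listOffset, Finset.sum_add_distrib, ← SimpleGraph.coe_edgeFinset, Set.ncard_coe_finset, ← h2]
  have h3 : ∑ v ∈ Finset.range n, listLength L v = ∑ v, G.degree v := by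
    rw [← Fin.sum_univ_eq_sum_range]
    exact Finset.sum_congr rfl fun v _ => by simp [listLength, h1]
  rw [h3]
  simp
  omega

-- Positions in a list without repetitions correspond bijectively to neighbours, so counting entries
-- counts edges.
open scoped Classical in
theorem sum_listEntry {G : SimpleGraph (Fin n)} (hL : IsAdjList G L) (v : Fin n)
    (S : Finset (Fin n)) (q : ℕ → Prop) (hq : ∀ w : Fin n, q w.val ↔ w ∈ S) :
    (∑ i ∈ Finset.range (listLength L v), if q (listEntry L v i) then 1 else 0)
      = Swap.edgesTo G v S := by
  have hlen : listLength L v = (L v).length := by simp [listLength]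
  have hent : ∀ i (hi : i < (L v).length), listEntry L v i = ((L v)[i]).val := fun i hi => by
    simp [listEntry, hi]
  rw [← Finset.card_filter, Swap.edgesTo, hlen]
  refine Finset.card_bij
    (fun i hi => (L v)[i]'(Finset.mem_range.1 (Finset.mem_filter.1 hi).1)) ?_ ?_ ?_
  · intro i hi
    have h := Finset.mem_filter.1 hi
    rw [Finset.mem_range] at h
    rw [Finset.mem_filter, ← hq, ← hent i h.1]
    exact ⟨h.2, ((hL v).2 _).1 (List.getElem_mem _)⟩
  · intro i hi j hj hij
    exact (List.Nodup.getElem_inj_iff (hL v).1).1 hij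
  · intro w hw
    rw [Finset.mem_filter] at hw
    obtain ⟨i, hi, rfl⟩ := List.getElem_of_mem (((hL v).2 w).2 hw.2)
    refine ⟨i, ?_, rfl⟩
    rw [Finset.mem_filter, Finset.mem_range, hent i hi, hq]
    exact ⟨hi, hw.1⟩

/-- Why the program compares parities instead of parts: for a_i the entries of different parity are
B₁ and for b_i they are A₁, exactly the positive terms of T_i. -/
theorem zero_lt_T_iff {G : SimpleGraph (Fin n)} (hL : IsAdjList G L) (i : Fin (2 * (n / 6))) :
    0 < Swap.T G i ↔
      countSame (listEntry L) (4 * (n / 6)) (6 * (n / 6)) (2 * i) (listLength L (2 * i))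
        + countSame (listEntry L) (4 * (n / 6)) (6 * (n / 6)) (2 * i + 1) (listLength L (2 * i + 1))
      < countDiff (listEntry L) (4 * (n / 6)) (6 * (n / 6)) (2 * i) (listLength L (2 * i))
        + countDiff (listEntry L) (4 * (n / 6)) (6 * (n / 6)) (2 * i + 1)
          (listLength L (2 * i + 1)) := by
  have hA : ∀ w : Fin n, w ∈ Swap.A₁ n ↔
      4 * (n / 6) ≤ w.val ∧ w.val < 6 * (n / 6) ∧ w.val % 2 = 0 := fun w => by
    simp only [Swap.A₁, Swap.label, Finset.mem_filter, Finset.mem_univ, true_and, Nat.odd_iff]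
    omega
  have hB : ∀ w : Fin n, w ∈ Swap.B₁ n ↔
      4 * (n / 6) ≤ w.val ∧ w.val < 6 * (n / 6) ∧ w.val % 2 = 1 := fun w => by
    simp only [Swap.B₁, Swap.label, Finset.mem_filter, Finset.mem_univ, true_and, Nat.even_iff]
    omega
  have e1 := sum_listEntry hL (Swap.a i) (Swap.A₁ n) (fun x => 4 * (n / 6) ≤ x ∧ x < 6 * (n / 6) ∧
    x % 2 = (2 * i.val) % 2) (fun w => by rw [hA]; omega)
  have e2 := sum_listEntry hL (Swap.a i) (Swap.B₁ n) (fun x => 4 * (n / 6) ≤ x ∧ x < 6 * (n / 6) ∧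
    x % 2 ≠ (2 * i.val) % 2) (fun w => by rw [hB]; omega)
  have e3 := sum_listEntry hL (Swap.b i) (Swap.B₁ n) (fun x => 4 * (n / 6) ≤ x ∧ x < 6 * (n / 6) ∧
    x % 2 = (2 * i.val + 1) % 2) (fun w => by rw [hB]; omega)
  have e4 := sum_listEntry hL (Swap.b i) (Swap.A₁ n) (fun x => 4 * (n / 6) ≤ x ∧ x < 6 * (n / 6) ∧
    x % 2 ≠ (2 * i.val + 1) % 2) (fun w => by rw [hA]; omega)
  have f1 : countSame (listEntry L) (4 * (n / 6)) (6 * (n / 6)) (2 * i) (listLength L (2 * i))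
      = Swap.edgesTo G (Swap.a i) (Swap.A₁ n) := by
    rw [← e1, countSame]
    exact Finset.sum_congr rfl fun j _ => by congr!
  have f2 : countDiff (listEntry L) (4 * (n / 6)) (6 * (n / 6)) (2 * i) (listLength L (2 * i))
      = Swap.edgesTo G (Swap.a i) (Swap.B₁ n) := by
    rw [← e2, countDiff]
    exact Finset.sum_congr rfl fun j _ => by congr!
  have f3 : countSame (listEntry L) (4 * (n / 6)) (6 * (n / 6)) (2 * i + 1)
      (listLength L (2 * i + 1)) = Swap.edgesTo G (Swap.b i) (Swap.B₁ n) := by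
    rw [← e3, countSame]
    exact Finset.sum_congr rfl fun j _ => by congr!
  have f4 : countDiff (listEntry L) (4 * (n / 6)) (6 * (n / 6)) (2 * i + 1)
      (listLength L (2 * i + 1)) = Swap.edgesTo G (Swap.b i) (Swap.A₁ n) := by
    rw [← e4, countDiff]
    exact Finset.sum_congr rfl fun j _ => by congr!
  rw [f1, f2, f3, f4, Swap.T]
  omega

theorem finalMark_eq {G : SimpleGraph (Fin n)} (hL : IsAdjList G L) (v : Fin n) :
    (if v.val < 4 * (n / 6) then
      finalMark (listLength L) (listEntry L) (4 * (n / 6)) (6 * (n / 6)) v.val else mark v.val)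
      = if v ∈ Swap.partA G then 1 else 0 := by
  by_cases h : v.val < 4 * (n / 6)
  · rw [if_pos h]
    obtain ⟨i, hi⟩ := Swap.exists_a_or_b h
    have hdiv : v.val / 2 = i.val := by
      rcases hi with rfl | rfl <;> simp only [Swap.a, Swap.b] <;> omega
    rw [finalMark, hdiv]
    simp only [← zero_lt_T_iff hL]
    rcases hi with rfl | rfl
    · simp only [Swap.a_mem_partA]
      have : mark (Swap.a i : Fin n).val = 1 := by
        unfold mark
        rw [if_pos (by simp only [Swap.a]; omega)]
      rw [this]
      split_ifs <;> rfl
    · simp only [Swap.b_mem_partA]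
      have : mark (Swap.b i : Fin n).val = 0 := by
        unfold mark
        rw [if_neg (by simp only [Swap.b]; omega)]
      rw [this]
  · rw [if_neg h]
    simp only [Swap.mem_partA_of_le G (not_lt.1 h)]
    rfl

/-- Swap runs in linear time. -/
theorem computesInLinearTime_swapProgram : ComputesInLinearTime swapProgram Swap.partA := by
  -- With N = 1 + n + 2m the running time is at most 20n + 28m + 30; since n ≥ 1, the additive
  -- constants here and in the word bound are absorbed by 100(n + m).
  refine ⟨100, fun n hn G L hL => ?_⟩
  have hN := listOffset_eq hL
  obtain ⟨t, s, h1, h2, h3⟩ := runs_swapProgram (W := 100 * (n + G.edgeSet.ncard)) (layout L)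
    (by omega)
  refine ⟨t, s, h1, by omega, fun v => ?_⟩
  rw [h3 v.val v.isLt, finalMark_eq hL]

end RAM

theorem theorem4p1 :
    -- Swap constructs a balanced bipartition
    (∀ n : ℕ, 2 ≤ n → ∀ G : SimpleGraph (Fin n),
      (Swap.partition G).parts.card = 2 ∧ (Swap.partition G).IsEquipartition) ∧
    -- in linear time
    (∃ P : RAM.Cmd, RAM.ComputesInLinearTime P Swap.partA) ∧
    -- and the bipartition has large modularity score on the binomial random graph whp
    ∃ c₀ a : ℝ, 0 < c₀ ∧ 0 < a ∧
      (∀ p : ℕ → unitInterval,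
        (∀ᶠ n : ℕ in Filter.atTop,
          c₀ ≤ (n : ℝ) * (p n : ℝ) ∧ (n : ℝ) * (p n : ℝ) ≤ (n : ℝ) - c₀) →
        Filter.Tendsto
          (fun n : ℕ => SimpleGraph.binomialRandom (Fin n) (p n)
            {G | 1 / 5 * Real.sqrt ((1 - (p n : ℝ)) / ((n : ℝ) * (p n : ℝ)))
              ≤ modularityScore G (Swap.partition G)})
          Filter.atTop (nhds 1)) ∧
      (∀ p : ℕ → unitInterval,
        (∀ᶠ n : ℕ in Filter.atTop,
          1 ≤ (n : ℝ) * (p n : ℝ) ∧ (n : ℝ) * (p n : ℝ) ≤ (n : ℝ) - c₀) →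
        Filter.Tendsto
          (fun n : ℕ => SimpleGraph.binomialRandom (Fin n) (p n)
            {G | a * Real.sqrt ((1 - (p n : ℝ)) / ((n : ℝ) * (p n : ℝ)))
              ≤ modularityScore G (Swap.partition G)})
          Filter.atTop (nhds 1)) :=
  ⟨fun _ hn G => Swap.partition_card_and_isEquipartition hn G,
    ⟨RAM.swapProgram, RAM.computesInLinearTime_swapProgram⟩,
    -- c₀ = 10⁸ serves both ranges; a is 4/15 times the moment constant 18/100 for standard
    -- deviation at least 1/2.
    10 ^ 8, 4 / 15 * (18 / 100), by norm_num, by norm_num,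
    fun _ hp => Swap.tendsto_binomialRandom_of_large hp,
    fun _ hp => Swap.tendsto_binomialRandom_of_one_le hp⟩
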